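/- Let $Y_1,\dots,Y_p\ge 0$ ($p\ge 1$) be iid random variables that are regularly varying with index $\alpha>0$, i.e. $\mathbb P(Y_1>x)=x^{-\alpha}L(x)$, $x>0$, for a slowly varying function $L$. Let $(a_{ij})\in[0,\infty)^{n\times p}$, $n\ge 1$, be such that $\max_{1\le i\le n}a_{ik}=a_{\max}:=\max_{i,j}a_{ij}>0$ for every $1\le k\le p$, and set $\mathbf Y:=\big(\prod_{j=1}^pY_j^{a_{ij}}\big)_{1\le i\le n}$ (with the convention $0^0=1$) and $\nu_\alpha(dz)=\alpha z^{-\alpha-1}dz$ on $(0,\infty)$. Here an $\mathbb R^n$-valued random vector $\mathbf X$ is called regularly varying with index $\gamma>0$ and limit measure $\mu$ if $\mu$ is a non-null Radon measure on $[-\infty,\infty]^n\setminus\{\mathbf 0\}$, homogeneous of order $-\gamma$ (i.e. $\mu(tB)=t^{-\gamma}\mu(B)$ for $t>0$ and Borel $B$), and $\mathbb P(x^{-1}\mathbf X\in\cdot)/\mathbb P(\|\mathbf X\|>x)$ converges vaguely to $\mu$ on $[-\infty,\infty]^n\setminus\{\mathbf 0\}$ as $x\to\infty$, where $\|\cdot\|$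 is any given norm on $\mathbb R^n$. (i) Assume that $\lim_{t\to\infty}\mathbb P(Y\cdot Y'>t)/\mathbb P(Y>t)=c$ for some $c\in(0,\infty)$, where $Y,Y'$ are independent copies of $Y_1$. Then $\mathbf Y$ is regularly varying with index $\alpha/a_{\max}$, and its limit measure is, up to a positive finite constant factor, $\sum_{j=1}^p\mu_j$, where for every Borel set $B\subset[-\infty,\infty]^n$ bounded away from $\mathbf 0$ $$\mu_j(B)=\int_0^\infty\mathbb P\bigg(\Big(\mathbf 1(a_{ij}=a_{\max})\,z^{a_{\max}}\prod_{k\ne j}Y_k^{a_{ik}}\Big)_{1\le i\le n}\in B\bigg)\,\nu_\alpha(dz).$$ (ii) Assume that $\mathbb E[Y_1^\alpha]=\infty$. Set $p_{\mathrm{eff}}:=\max_i|\{1\le j\le p:a_{ij}=a_{\max}\}|$ and $$P_{\mathrm{eff}}:=\{A\subset\{1,\dots,p\}:\ |A|=p_{\mathrm{eff}}\ \text{and there is } i \text{ with } a_{ij}=a_{\max}\text{ for all }j\in A\}.$$ Then $\mathbf Y$ is regularly varying with index $\alpha/a_{\max}$, and its limit measure is, up to a positive finite constant factor, $\sum_{A\in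 P_{\mathrm{eff}}}\mu_A$, where for every Borel set $B\subset[-\infty,\infty]^n$ bounded away from $\mathbf 0$ $$\mu_A(B)=\int_0^\infty\mathbb P\bigg(\Big(\mathbf 1(a_{ij}=a_{\max}\ \forall j\in A)\,z^{a_{\max}}\prod_{k\notin A}Y_k^{a_{ik}}\Big)_{1\le i\le n}\in B\bigg)\,\nu_\alpha(dz).$$ -/

import Mathlib

open MeasureTheory ProbabilityTheory Filter Topology Set
open scoped ENNReal NNReal

noncomputable section

/-- A slowly varying function: measurable, eventually positive, and
`L (c x) / L x → 1` as `x → ∞` for every `c > 0`. -/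
structure SlowlyVarying (L : ℝ → ℝ) : Prop where
  measurable : Measurable L
  eventually_pos : ∀ᶠ x in atTop, 0 < L x
  tendsto_ratio : ∀ c : ℝ, 0 < c → Tendsto (fun x => L (c * x) / L x) atTop (𝓝 1)

/-- A nonnegative random variable `X` is regularly varying with index `α > 0` if
`P (X > x) = x ^ (-α) * L x`, `x > 0`, for some slowly varying function `L`. -/
def RegularlyVaryingTail {Ω : Type*} [MeasurableSpace Ω] (P : Measure Ω) (X : Ω → ℝ)
    (α : ℝ) : Prop :=
  0 < α ∧ ∃ L : ℝ → ℝ, SlowlyVarying L ∧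
    ∀ x : ℝ, 0 < x → P.real {ω | x < X ω} = x ^ (-α) * L x

/-- `P (Y₁ Y₂ > t) / P (Y₁ > t) → c` as `t → ∞` for some `c ∈ (0, ∞)`, where `Y₁` and `Y₂` are
independent with common law `ρ`. -/
def ProductTailEquivalent (ρ : Measure ℝ) : Prop :=
  ∃ c : ℝ, 0 < c ∧
    Tendsto (fun t : ℝ => (ρ.prod ρ).real {y : ℝ × ℝ | t < y.1 * y.2} / ρ.real (Ioi t))
      atTop (𝓝 c)

/-- The punctured compactified space `[-∞, ∞]ⁿ \ {0}`. -/
abbrev PuncturedSpace (n : ℕ) : Type := {v : Fin n → EReal // v ≠ 0}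

/-- The dilated set `t B = {t w : w ∈ B}`. -/
def dilate {n : ℕ} (t : ℝ) (B : Set (PuncturedSpace n)) : Set (PuncturedSpace n) :=
  {v | ∃ w ∈ B, ∀ i, v.1 i = (t : EReal) * w.1 i}

/-- Vague convergence of a family of measures, as the real parameter tends to `∞`: the integrals
of all continuous functions with compact support converge. -/
def VagueTendsto {E : Type*} [TopologicalSpace E] [MeasurableSpace E]
    (κ : ℝ → Measure E) (μ : Measure E) : Prop :=
  ∀ f : E → ℝ, Continuous f → HasCompactSupport f →
    Tendsto (fun x => ∫ v, f v ∂(κ x)) atTop (𝓝 (∫ v, f v ∂μ))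

/-- The measure `P (x⁻¹ X ∈ ·)` on `[-∞, ∞]ⁿ \ {0}`. -/
def scaledLaw {Ω : Type*} [MeasurableSpace Ω] (P : Measure Ω) {n : ℕ} (X : Ω → Fin n → ℝ)
    (x : ℝ) : Measure (PuncturedSpace n) :=
  (P.map (fun ω => fun i => ((x⁻¹ * X ω i : ℝ) : EReal))).comap Subtype.val

/-- The random vector `X` is regularly varying with index `γ > 0` and limit measure `μ`, for the
normalization by the norm `N`: `μ` is a non-null Radon measure on `[-∞, ∞]ⁿ \ {0}`, homogeneous of
order `-γ`, and `P (x⁻¹ X ∈ ·) / P (N X > x)` converges vaguely to `μ` as `x → ∞`. -/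
structure RegularlyVaryingVector {Ω : Type*} [MeasurableSpace Ω] (P : Measure Ω) {n : ℕ}
    (X : Ω → Fin n → ℝ) (γ : ℝ) (N : Seminorm ℝ (Fin n → ℝ))
    (μ : Measure (PuncturedSpace n)) : Prop where
  index_pos : 0 < γ
  ne_zero : μ ≠ 0
  radon : μ.Regular
  homogeneous : ∀ t : ℝ, 0 < t → ∀ B : Set (PuncturedSpace n), MeasurableSet B →
    μ (dilate t B) = ENNReal.ofReal (t ^ (-γ)) * μ B
  vague : VagueTendsto (fun x => (P {ω | x < N (X ω)})⁻¹ • scaledLaw P X x) μ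

/-- The measure `ν_α (dz) = α z ^ (-α - 1) dz` on `(0, ∞)`. -/
def powerMeasure (α : ℝ) : Measure ℝ :=
  (volume.restrict (Ioi 0)).withDensity (fun z => ENNReal.ofReal (α * z ^ (-α - 1)))

/-- The vector `(∏ j, y_j ^ a_ij)_i`. -/
def productVector {n p : ℕ} (a : Fin n → Fin p → ℝ) (y : Fin p → ℝ) : Fin n → ℝ :=
  fun i => ∏ j, y j ^ a i j

open Classical in
/-- The vector `(1(a_ij = amax for all j ∈ A) * z ^ amax * ∏ k ∉ A, y_k ^ a_ik)_i`. -/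
def limitVector {n p : ℕ} (a : Fin n → Fin p → ℝ) (amax : ℝ) (A : Finset (Fin p))
    (y : Fin p → ℝ) (z : ℝ) : Fin n → ℝ :=
  fun i => if ∀ j ∈ A, a i j = amax then z ^ amax * ∏ k ∈ Aᶜ, y k ^ a i k else 0

/-- The value `μ_A (B) = ∫₀^∞ P (limitVector ∈ B) ν_α (dz)`. -/
def limitMass {Ω : Type*} [MeasurableSpace Ω] (P : Measure Ω) {n p : ℕ} (Y : Fin p → Ω → ℝ)
    (a : Fin n → Fin p → ℝ) (amax α : ℝ) (A : Finset (Fin p)) (B : Set (Fin n → EReal)) : ℝ≥0∞ :=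
  ∫⁻ z, P {ω | (fun i => ((limitVector a amax A (fun j => Y j ω) z i : ℝ) : EReal)) ∈ B}
    ∂(powerMeasure α)

open Classical in
/-- `p_eff`: the largest number of entries equal to `amax` in a row. -/
def pEff {n p : ℕ} (a : Fin n → Fin p → ℝ) (amax : ℝ) : ℕ :=
  Finset.univ.sup (fun i : Fin n => (Finset.univ.filter (fun j : Fin p => a i j = amax)).card)

open Classical in
/-- `P_eff`: the sets of `p_eff` columns on which some row is constantly equal to `amax`. -/
def PEff {n p : ℕ} (a : Fin n → Fin p → ℝ) (amax : ℝ) : Finset (Finset (Fin p)) :=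
  Finset.univ.filter (fun A => A.card = pEff a amax ∧ ∃ i, ∀ j ∈ A, a i j = amax)

end

/-! ### Tails of measures on the real line -/

/-! Raising the variables to the power `amax` and dividing the exponents by `amax` reduces
everything to exponents in [0, 1] and index α / amax. The aim is then a normalization h and finitely
many nonnegative vectors W such that E φ(X / x) / h(x) tends to the sum of the integrals of φ(z W)
under P ⊗ ν, for all test functions φ vanishing near the origin (`VectorLimit`). This implies
regular variation (`VectorLimit.regularlyVarying`): ramps of the norm inserted for φ give P(N X > x)
~ κ h(x), so the normalization by the norm differs only by the constant κ, and the limit inherits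
homogeneity from ν. Single terms of the sum come from the vector form of Breiman's lemma
(`IsTest.breiman`): a regularly varying T, multiplied by an independent W with a moment beyond the
index, behaves like z W with z governed by ν. Potter's bound gives the domination.

Part (i) is the principle of one large factor. Cut the event {Y Y' > x} at a level M. Relative to
P(Y > x), the two pieces with one factor at most M contribute the moment of order α truncated at M,
each once, and the piece with both factors above M contributes the rest of c. So the moment is
finite, and two large factors are negligible exactly when c is twice the moment. This is proved for
max(Y, 1), and the delicate half is the upper bound `RVTail.prodTail_constant_le`: a larger constant
would give a quadratic inequality for truncated moments of order α + ε that traps them below a bound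
independent of the truncation, although moments beyond the index are infinite. By induction a
product of p factors has tail p m^(p-1) times that of one factor, so asymptotically it is large only
when one factor is large and the product of the others is bounded. Rows whose exponent at the large
factor is below one disappear in the limit.

Part (ii) is the opposite regime. If the moment of order α is infinite, each additional factor makes
the tail heavier by an unbounded amount, while regular variation persists (`RVTail.powLaw_aux`).
Hence the tail order of a monomial with exponents in [0, 1] is bounded by the number of exponents
equal to one (`IIDSample.tendsto_tail_monomial`). Rows with fewer than `pEff` such exponents are
negligible. Two rows with different sets of such columns are not large together, since their
geometric mean is a monomial with too few exponents equal to one. Each set A in `PEff` therefore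
contributes separately, through Breiman's lemma with T the product over A. -/

/-- The tail function `x ↦ ρ (x, ∞)`. -/
noncomputable def tail (ρ : Measure ℝ) (x : ℝ) : ℝ := ρ.real (Ioi x)

/-- The tail at `x` of the image of `σ` under multiplication by `m`. -/
noncomputable def scaledTail (σ : Measure ℝ) (m x : ℝ) : ℝ := σ.real {u | x < m * u}

/-- The tail of `ρ` is positive and regularly varying with index `-α`. -/
structure RVTail (ρ : Measure ℝ) (α : ℝ) : Prop where
  index_pos : 0 < α
  tail_pos : ∀ x, 0 < tail ρ x
  tendsto_ratio : ∀ l : ℝ, 0 < l →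
    Tendsto (fun x => tail ρ (l * x) / tail ρ x) atTop (𝓝 (l ^ (-α)))

section Tail

variable {ρ σ : Measure ℝ} {α β : ℝ}

lemma tail_nonneg (ρ : Measure ℝ) (x : ℝ) : 0 ≤ tail ρ x := measureReal_nonneg

lemma tail_antitone (ρ : Measure ℝ) [IsFiniteMeasure ρ] : Antitone (tail ρ) :=
  fun _ _ h => measureReal_mono (Ioi_subset_Ioi h)

lemma tail_le_one (ρ : Measure ℝ) [IsProbabilityMeasure ρ] (x : ℝ) : tail ρ x ≤ 1 :=
  measureReal_le_one

lemma scaledTail_nonneg (σ : Measure ℝ) (m x : ℝ) : 0 ≤ scaledTail σ m x := measureReal_nonneg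

lemma scaledTail_of_pos (σ : Measure ℝ) {m : ℝ} (hm : 0 < m) (x : ℝ) :
    scaledTail σ m x = tail σ (x / m) := by
  unfold scaledTail tail
  congr 1
  ext u
  simp [div_lt_iff₀ hm, mul_comm]

lemma scaledTail_zero (σ : Measure ℝ) {x : ℝ} (hx : 0 ≤ x) : scaledTail σ 0 x = 0 := by
  simp [scaledTail, not_lt.2 hx]

lemma measurable_scaledTail (σ : Measure ℝ) [IsFiniteMeasure σ] (x : ℝ) :
    Measurable fun m => scaledTail σ m x := by
  have hs : MeasurableSet {q : ℝ × ℝ | x < q.1 * q.2} :=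
    measurableSet_lt measurable_const (measurable_fst.mul measurable_snd)
  exact (measurable_measure_prodMk_left hs).ennreal_toReal

/-- Since 2^(-β) < 2^(-α), halving the argument eventually costs at most a factor 2^β; iterating
this gives the dyadic form of Potter's bound. -/
lemma RVTail.tail_le_pow [IsFiniteMeasure ρ] (h : RVTail ρ α) (hβ : α < β) :
    ∃ x₀ > 0, ∀ k : ℕ, ∀ y ≥ x₀, tail ρ y ≤ ((2 : ℝ) ^ β) ^ k * tail ρ (2 ^ k * y) := by
  have h2 : (2 : ℝ) ^ (-β) < 2 ^ (-α) := Real.rpow_lt_rpow_of_exponent_lt (by norm_num) (by linarith)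
  obtain ⟨x₁, hx₁⟩ := eventually_atTop.1
    ((h.tendsto_ratio 2 two_pos).eventually (lt_mem_nhds h2))
  refine ⟨max x₁ 1, by positivity, fun k => ?_⟩
  induction k with
  | zero => simp
  | succ k ih =>
    intro y hy
    have hpos : (0 : ℝ) < y := lt_of_lt_of_le (by positivity) hy
    have h1 : max x₁ 1 ≤ 2 ^ k * y :=
      hy.trans (le_mul_of_one_le_left hpos.le (one_le_pow₀ (by norm_num)))
    have h3 := (hx₁ (2 ^ k * y) ((le_max_left _ _).trans h1)).le
    rw [le_div_iff₀ (h.tail_pos _), Real.rpow_neg two_pos.le,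
      inv_mul_le_iff₀ (by positivity)] at h3
    calc tail ρ y ≤ ((2 : ℝ) ^ β) ^ k * tail ρ (2 ^ k * y) := ih y hy
      _ ≤ ((2 : ℝ) ^ β) ^ k * (2 ^ β * tail ρ (2 * (2 ^ k * y))) := by gcongr
      _ = _ := by rw [pow_succ, pow_succ]; ring_nf

lemma exists_two_pow_between {m : ℝ} (hm : 1 ≤ m) : ∃ k : ℕ, m ≤ 2 ^ k ∧ (2 : ℝ) ^ k ≤ 2 * m := by
  obtain ⟨k, hk1, hk2⟩ := exists_nat_pow_near hm (one_lt_two : (1 : ℝ) < 2)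
  exact ⟨k + 1, hk2.le, by rw [pow_succ]; linarith⟩

/-- Potter's bound. -/
lemma RVTail.potter [IsProbabilityMeasure ρ] (h : RVTail ρ α) (hβ : α < β) :
    ∃ C > 0, ∃ x₀ > 0, ∀ x ≥ x₀, ∀ m ≥ 0, scaledTail ρ m x ≤ C * max 1 m ^ β * tail ρ x := by
  obtain ⟨x₀, hx₀, H⟩ := h.tail_le_pow hβ
  have hβ0 : 0 < β := h.index_pos.trans hβ
  -- Rounding `m` up to a power of two, at most `2 * m`, costs the extra factor 2^β.
  have key : ∀ m ≥ 1, ∀ y ≥ x₀, tail ρ y ≤ (2 * m) ^ β * tail ρ (m * y) := by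
    intro m hm y hy
    obtain ⟨k, hk1, hk2⟩ := exists_two_pow_between hm
    have hy0 : 0 ≤ y := hx₀.le.trans hy
    refine (H k y hy).trans ?_
    have : ((2 : ℝ) ^ β) ^ k = (2 ^ k) ^ β := by
      rw [← Real.rpow_natCast, ← Real.rpow_mul two_pos.le, mul_comm, Real.rpow_mul two_pos.le,
        Real.rpow_natCast]
    rw [this]
    exact mul_le_mul (Real.rpow_le_rpow (by positivity) hk2 hβ0.le)
      (tail_antitone ρ (by gcongr)) (tail_nonneg _ _) (by positivity)
  have hD1 : 1 ≤ (tail ρ x₀)⁻¹ := (one_le_inv₀ (h.tail_pos _)).2 (tail_le_one _ _)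
  have h2β : (1 : ℝ) ≤ 2 ^ β := Real.one_le_rpow (by norm_num) hβ0.le
  -- The factor `(tail ρ x₀)⁻¹` serves the range x / m < x₀, where `key` is unavailable at x / m:
  -- there the tail is bounded by one, and `key` compares x₀ with x.
  refine ⟨2 ^ β * (tail ρ x₀)⁻¹, by positivity, x₀, hx₀, fun x hx m hm => ?_⟩
  have hx0 : 0 < x := hx₀.trans_le hx
  have htx := tail_nonneg ρ x
  rcases hm.eq_or_lt with rfl | hm0
  · rw [scaledTail_zero _ hx0.le]; positivity
  rw [scaledTail_of_pos _ hm0]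
  rcases le_total m 1 with hm1 | hm1
  · rw [max_eq_left hm1, Real.one_rpow, mul_one]
    calc tail ρ (x / m) ≤ tail ρ x := tail_antitone ρ (by
          rw [le_div_iff₀ hm0]; nlinarith)
      _ ≤ _ := le_mul_of_one_le_left htx (one_le_mul_of_one_le_of_one_le h2β hD1)
  rw [max_eq_right hm1]
  rcases le_total x₀ (x / m) with hc | hc
  · calc tail ρ (x / m) ≤ (2 * m) ^ β * tail ρ (m * (x / m)) := key m hm1 _ hc
      _ = 2 ^ β * 1 * m ^ β * tail ρ x := by
        rw [mul_div_cancel₀ _ hm0.ne', Real.mul_rpow two_pos.le hm0.le]; ring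
      _ ≤ _ := by gcongr
  · have h1 : 1 ≤ x / x₀ := (one_le_div hx₀).2 hx
    have h2 := key (x / x₀) h1 x₀ le_rfl
    rw [div_mul_cancel₀ _ hx₀.ne'] at h2
    have h3 : x / x₀ ≤ m := by
      rw [div_le_iff₀ hm0] at hc
      rw [div_le_iff₀ hx₀]; linarith
    calc tail ρ (x / m) ≤ 1 := tail_le_one _ _
      _ = (tail ρ x₀)⁻¹ * tail ρ x₀ := (inv_mul_cancel₀ (h.tail_pos _).ne').symm
      _ ≤ (tail ρ x₀)⁻¹ * ((2 * m) ^ β * tail ρ x) := by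
        have := (inv_nonneg.2 (tail_nonneg ρ x₀))
        gcongr
        exact h2.trans (by gcongr)
      _ = _ := by rw [Real.mul_rpow two_pos.le hm0.le]; ring

lemma RVTail.tendsto_scaledTail (h : RVTail ρ α) {m : ℝ} (hm : 0 ≤ m) :
    Tendsto (fun x => scaledTail ρ m x / tail ρ x) atTop (𝓝 (m ^ α)) := by
  rcases hm.eq_or_lt with rfl | hm0
  · rw [Real.zero_rpow h.index_pos.ne']
    refine tendsto_const_nhds.congr' ?_
    filter_upwards [eventually_ge_atTop 0] with x hx
    rw [scaledTail_zero _ hx, zero_div]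
  · have := h.tendsto_ratio m⁻¹ (inv_pos.2 hm0)
    rw [Real.inv_rpow hm, Real.rpow_neg hm, inv_inv] at this
    refine this.congr fun x => ?_
    rw [scaledTail_of_pos _ hm0, div_eq_inv_mul x]

/-- Powers of order larger than the index dominate the inverse tail. -/
lemma RVTail.tendsto_rpow_mul_tail [IsProbabilityMeasure ρ] (h : RVTail ρ α) (hβ : α < β) :
    Tendsto (fun x => x ^ β * tail ρ x) atTop atTop := by
  obtain ⟨γ, hαγ, hγβ⟩ := exists_between hβ
  obtain ⟨C, hC, x₀, hx₀, H⟩ := h.potter hαγ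
  have h1 : Tendsto (fun x : ℝ => (C⁻¹ * tail ρ x₀ * x₀ ^ γ) * x ^ (β - γ)) atTop atTop :=
    (tendsto_rpow_atTop (sub_pos.2 hγβ)).const_mul_atTop
      (by have := h.tail_pos x₀; positivity)
  refine tendsto_atTop_mono' _ ?_ h1
  filter_upwards [eventually_ge_atTop x₀] with x hx
  have hx0 : 0 < x := hx₀.trans_le hx
  -- With m = x / x₀, Potter's bound compares the fixed value at x₀ with the tail at x, which is a
  -- lower bound of order x^(-γ).
  have h2 := H x hx (x / x₀) (by positivity)
  rw [scaledTail_of_pos _ (by positivity), max_eq_right ((one_le_div hx₀).2 hx),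
    div_div_cancel₀ hx0.ne', Real.div_rpow hx0.le hx₀.le] at h2
  rw [Real.rpow_sub hx0]
  have hxγ : 0 < x ^ γ := by positivity
  have hx₀γ : 0 < x₀ ^ γ := by positivity
  have h3 : C⁻¹ * tail ρ x₀ * x₀ ^ γ / x ^ γ ≤ tail ρ x := by
    rw [div_le_iff₀ hxγ]
    calc C⁻¹ * tail ρ x₀ * x₀ ^ γ ≤ C⁻¹ * (C * (x ^ γ / x₀ ^ γ) * tail ρ x) * x₀ ^ γ := by gcongr
      _ = _ := by field_simp
  calc C⁻¹ * tail ρ x₀ * x₀ ^ γ * (x ^ β / x ^ γ) = x ^ β * (C⁻¹ * tail ρ x₀ * x₀ ^ γ / x ^ γ) := by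
        ring
    _ ≤ _ := by gcongr

/-- A tail comparison at infinity is a comparison everywhere. -/
lemma RVTail.exists_tail_le [IsProbabilityMeasure ρ] [IsProbabilityMeasure σ] (h : RVTail ρ α)
    {k : ℝ} (hσ : Tendsto (fun x => tail σ x / tail ρ x) atTop (𝓝 k)) :
    ∃ D > 0, ∀ x, tail σ x ≤ D * tail ρ x := by
  obtain ⟨x₁, hx₁⟩ := eventually_atTop.1 (hσ.eventually (gt_mem_nhds (lt_add_one k)))
  refine ⟨max (k + 1) (tail ρ x₁)⁻¹,
    lt_max_of_lt_right (inv_pos.2 (h.tail_pos _)), fun x => ?_⟩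
  rcases le_total x₁ x with hx | hx
  · have := hx₁ x hx
    rw [div_lt_iff₀ (h.tail_pos _)] at this
    exact this.le.trans (mul_le_mul_of_nonneg_right (le_max_left _ _) (tail_nonneg _ _))
  · calc tail σ x ≤ 1 := tail_le_one _ _
      _ = (tail ρ x₁)⁻¹ * tail ρ x₁ := (inv_mul_cancel₀ (h.tail_pos _).ne').symm
      _ ≤ (tail ρ x₁)⁻¹ * tail ρ x := by
        have := inv_nonneg.2 (tail_nonneg ρ x₁)
        gcongr
        exact tail_antitone ρ hx
      _ ≤ _ := mul_le_mul_of_nonneg_right (le_max_right _ _) (tail_nonneg _ _)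

lemma scaledTail_le_of_tail_le {D : ℝ} (hD : ∀ x, tail σ x ≤ D * tail ρ x) {m x : ℝ}
    (hm : 0 ≤ m) (hx : 0 ≤ x) : scaledTail σ m x ≤ D * scaledTail ρ m x := by
  rcases hm.eq_or_lt with rfl | hm0
  · rw [scaledTail_zero _ hx, scaledTail_zero _ hx, mul_zero]
  · rw [scaledTail_of_pos _ hm0, scaledTail_of_pos _ hm0]; exact hD _

lemma RVTail.tendsto_scaledTail_of_ratio (h : RVTail ρ α) {k : ℝ}
    (hσ : Tendsto (fun x => tail σ x / tail ρ x) atTop (𝓝 k)) {m : ℝ} (hm : 0 ≤ m) :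
    Tendsto (fun x => scaledTail σ m x / tail ρ x) atTop (𝓝 (k * m ^ α)) := by
  rcases hm.eq_or_lt with rfl | hm0
  · rw [Real.zero_rpow h.index_pos.ne', mul_zero]
    refine tendsto_const_nhds.congr' ?_
    filter_upwards [eventually_ge_atTop 0] with x hx
    rw [scaledTail_zero _ hx, zero_div]
  · have h1 : Tendsto (fun x => tail σ (x / m) / tail ρ (x / m)) atTop (𝓝 k) :=
      hσ.comp (tendsto_id.atTop_div_const hm0)
    refine (h1.mul (h.tendsto_scaledTail hm)).congr fun x => ?_
    rw [scaledTail_of_pos _ hm0, scaledTail_of_pos _ hm0,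
      div_mul_div_cancel₀ (h.tail_pos _).ne']

/-- This is the dominating function in Breiman's lemma, uniform in the multiplier. The limit `k` may
be zero, which is how negligible factors are treated later. -/
lemma RVTail.eventually_scaledTail_le [IsProbabilityMeasure ρ] [IsProbabilityMeasure σ]
    (h : RVTail ρ α) (hβ : α < β) {k : ℝ}
    (hσ : Tendsto (fun x => tail σ x / tail ρ x) atTop (𝓝 k)) :
    ∃ C > 0, ∀ᶠ x in atTop, ∀ m ≥ 0, scaledTail σ m x ≤ C * max 1 m ^ β * tail ρ x := by
  obtain ⟨D, hD, H⟩ := h.exists_tail_le hσ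
  obtain ⟨C, hC, x₀, hx₀, H'⟩ := h.potter hβ
  refine ⟨D * C, by positivity, ?_⟩
  filter_upwards [eventually_ge_atTop x₀] with x hx m hm
  calc scaledTail σ m x ≤ D * scaledTail ρ m x := scaledTail_le_of_tail_le H hm (hx₀.le.trans hx)
    _ ≤ D * (C * max 1 m ^ β * tail ρ x) := by gcongr; exact H' x hx m hm
    _ = _ := by ring

/-- Breiman's lemma: the tail of a product with an independent factor with lighter tail. -/
lemma RVTail.breiman [IsProbabilityMeasure ρ] [IsProbabilityMeasure σ]
    (h : RVTail ρ α) (hβ : α < β) {k : ℝ}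
    (hσ : Tendsto (fun x => tail σ x / tail ρ x) atTop (𝓝 k)) {τ : Measure ℝ} [IsFiniteMeasure τ]
    (hτ0 : ∀ᵐ v ∂τ, 0 ≤ v) (hτ : Integrable (fun v => max 1 v ^ β) τ) :
    Tendsto (fun x => (∫ v, scaledTail σ v x ∂τ) / tail ρ x) atTop (𝓝 (k * ∫ v, v ^ α ∂τ)) := by
  obtain ⟨C, hC, H⟩ := h.eventually_scaledTail_le hβ hσ
  simp_rw [← integral_div, ← integral_const_mul]
  refine tendsto_integral_filter_of_dominated_convergence (fun v => C * max 1 v ^ β) ?_ ?_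
    (hτ.const_mul C) ?_
  · exact Eventually.of_forall fun x =>
      ((measurable_scaledTail σ x).div_const _).aestronglyMeasurable
  · filter_upwards [H] with x hx
    filter_upwards [hτ0] with v hv
    rw [Real.norm_of_nonneg (div_nonneg (scaledTail_nonneg _ _ _) (tail_nonneg _ _)),
      div_le_iff₀ (h.tail_pos _)]
    exact hx v hv
  · filter_upwards [hτ0] with v hv
    exact h.tendsto_scaledTail_of_ratio hσ hv

lemma RVTail.tendsto_self (h : RVTail ρ α) :
    Tendsto (fun x => tail ρ x / tail ρ x) atTop (𝓝 1) :=
  tendsto_const_nhds.congr fun x => (div_self (h.tail_pos x).ne').symm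

/-! ### Vague convergence on the half-line -/

lemma powerMeasure_Ioi (hα : 0 < α) {c : ℝ} (hc : 0 < c) :
    powerMeasure α (Ioi c) = ENNReal.ofReal (c ^ (-α)) := by
  rw [powerMeasure, withDensity_apply _ measurableSet_Ioi, Measure.restrict_restrict measurableSet_Ioi,
    inter_eq_left.2 (Ioi_subset_Ioi hc.le)]
  rw [← ofReal_integral_eq_lintegral_ofReal]
  · rw [integral_const_mul, integral_Ioi_rpow_of_lt (by linarith) hc]
    congr 1
    rw [sub_add_cancel, neg_div_neg_eq]
    field_simp
  · exact (integrableOn_Ioi_rpow_of_lt (by linarith) hc).const_mul _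
  · filter_upwards [ae_restrict_mem measurableSet_Ioi] with z hz
    have : 0 < z := hc.trans hz
    positivity

lemma powerMeasure_Iic_zero (α : ℝ) : powerMeasure α (Iic 0) = 0 := by
  rw [powerMeasure, withDensity_apply _ measurableSet_Iic, Measure.restrict_restrict measurableSet_Iic,
    Iic_inter_Ioi, Ioc_self, Measure.restrict_empty, lintegral_zero_measure]

lemma ae_powerMeasure_pos (α : ℝ) : ∀ᵐ z ∂powerMeasure α, 0 < z := by
  rw [ae_iff]; simp only [not_lt]; exact powerMeasure_Iic_zero α

instance (α : ℝ) : SFinite (powerMeasure α) := by unfold powerMeasure; infer_instance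

end Tail

section Vague

variable {ρ : Measure ℝ} {α : ℝ}

lemma powerMeasure_real_Ioi (hα : 0 < α) {c : ℝ} (hc : 0 < c) :
    (powerMeasure α).real (Ioi c) = c ^ (-α) := by
  rw [measureReal_def, powerMeasure_Ioi hα hc, ENNReal.toReal_ofReal (by positivity)]

lemma measurable_div_real (x : ℝ) : Measurable fun t : ℝ => t / x := measurable_id.div_const x

lemma map_div_real_Ioi (ρ : Measure ℝ) {x : ℝ} (hx : 0 < x) (c : ℝ) :
    (ρ.map (· / x)).real (Ioi c) = tail ρ (c * x) := by
  rw [map_measureReal_apply (measurable_div_real x) measurableSet_Ioi]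
  unfold tail
  congr 1
  ext u
  simp [lt_div_iff₀ hx]

/-- Expresses conditional masses of intervals through tails alone, so that convergence of tail
ratios yields weak convergence of the conditional laws. -/
lemma cond_Ioi_real_Ioc {τ : Measure ℝ} {ε a b : ℝ} (hτ : τ (Ioi ε) ≠ ∞) (hab : a ≤ b) :
    (τ[|Ioi ε]).real (Ioc a b) =
      (τ.real (Ioi ε))⁻¹ * (τ.real (Ioi (max ε a)) - τ.real (Ioi (max ε b))) := by
  have h1 : Ioi ε ∩ Ioc a b = Ioi (max ε a) \ Ioi (max ε b) := by
    ext z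
    simp only [mem_inter_iff, mem_Ioi, mem_Ioc, Set.mem_sdiff, max_lt_iff, not_and, not_lt]
    constructor
    · rintro ⟨h1, h2, h3⟩; exact ⟨⟨h1, h2⟩, fun _ => h3⟩
    · rintro ⟨⟨h1, h2⟩, h3⟩; exact ⟨h1, h2, h3 h1⟩
  rw [measureReal_def, cond_apply measurableSet_Ioi, ENNReal.toReal_mul, ENNReal.toReal_inv, h1,
    ← measureReal_def, ← measureReal_def,
    measureReal_sdiff (Ioi_subset_Ioi (max_le_max_left _ hab)) measurableSet_Ioi
      (ne_top_of_le_ne_top hτ (measure_mono (Ioi_subset_Ioi (le_max_left _ _))))]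

/-- The normalized laws of `T / x`, `T` having a regularly varying tail, converge vaguely on
`(0, ∞]` to the power measure. -/
lemma RVTail.tendsto_integral [IsProbabilityMeasure ρ] (h : RVTail ρ α) (hρ : ∀ᵐ t ∂ρ, 0 ≤ t)
    {g : ℝ → ℝ} (hg : Continuous g) {K ε : ℝ} (hK : ∀ z, |g z| ≤ K) (hε : 0 < ε)
    (hgε : ∀ z, 0 ≤ z → z ≤ ε → g z = 0) :
    Tendsto (fun x => (∫ t, g (t / x) ∂ρ) / tail ρ x) atTop (𝓝 (∫ z, g z ∂powerMeasure α)) := by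
  have hα := h.index_pos
  have hν : powerMeasure α (Ioi ε) ≠ ∞ := by rw [powerMeasure_Ioi hα hε]; simp
  have hν0 : powerMeasure α (Ioi ε) ≠ 0 := by
    rw [powerMeasure_Ioi hα hε]; simp; positivity
  -- Dividing by `max x 1` keeps the scale positive for every x, so the conditional laws are defined
  -- without restriction; it agrees with x eventually.
  let τ : ℝ → Measure ℝ := fun x => ρ.map (· / max x 1)
  have hm : ∀ x : ℝ, (0 : ℝ) < max x 1 := fun x => lt_max_of_lt_right one_pos
  have hτp : ∀ x, IsProbabilityMeasure (τ x) := fun x =>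
    Measure.isProbabilityMeasure_map (measurable_div_real _).aemeasurable
  have hτ : ∀ x c, (τ x).real (Ioi c) = tail ρ (c * max x 1) := fun x c =>
    map_div_real_Ioi ρ (hm x) c
  have hτ0 : ∀ x, τ x (Ioi ε) ≠ 0 := by
    intro x hx
    have h1 := hτ x ε
    rw [measureReal_def, hx, ENNReal.toReal_zero] at h1
    exact (h.tail_pos (ε * max x 1)).ne h1
  let κ : ℝ → ProbabilityMeasure ℝ := fun x =>
    ⟨(τ x)[|Ioi ε], cond_isProbabilityMeasure (hτ0 x)⟩
  let κ' : ProbabilityMeasure ℝ := ⟨(powerMeasure α)[|Ioi ε],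
    cond_isProbabilityMeasure_of_finite hν0 hν⟩
  have hmax : Tendsto (fun x : ℝ => max x 1) atTop atTop :=
    tendsto_atTop_mono (fun x => le_max_left x 1) tendsto_id
  have hr : ∀ c > 0, Tendsto (fun x => tail ρ (c * max x 1) / tail ρ (max x 1)) atTop
      (𝓝 (c ^ (-α))) := fun c hc => (h.tendsto_ratio c hc).comp hmax
  have hconv : Tendsto κ atTop (𝓝 κ') := by
    refine IsPiSystem.tendsto_probabilityMeasure_of_tendsto_of_mem
      (S := {s | ∃ l u, l < u ∧ Ioc (id l) (id u) = s})
      (isPiSystem_Ioc (id : ℝ → ℝ) (id : ℝ → ℝ)) ?_ ?_ ?_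
    · rintro s ⟨l, u, -, rfl⟩; exact measurableSet_Ioc
    · intro u hu x hx
      obtain ⟨r, hr, hru⟩ := Metric.isOpen_iff.1 hu x hx
      refine ⟨_, ⟨x - r / 2, x + r / 2, by linarith, rfl⟩,
        Ioc_mem_nhds (by simp; linarith) (by simp; linarith), fun y hy => hru ?_⟩
      simp only [id, mem_Ioc] at hy
      rw [Metric.mem_ball, Real.dist_eq, abs_lt]
      constructor <;> linarith [hy.1, hy.2]
    · rintro s ⟨l, u, hlu, rfl⟩
      rw [← NNReal.tendsto_coe]
      change Tendsto (fun x => ((τ x)[|Ioi ε]).real (Ioc l u)) atTop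
        (𝓝 (((powerMeasure α)[|Ioi ε]).real (Ioc l u)))
      have hcoef : ∀ c : ℝ, 0 < max ε c := fun c => lt_max_of_lt_left hε
      rw [cond_Ioi_real_Ioc hν hlu.le, powerMeasure_real_Ioi hα hε,
        powerMeasure_real_Ioi hα (hcoef _), powerMeasure_real_Ioi hα (hcoef _)]
      refine (((hr ε hε).inv₀ (by positivity)).mul
        ((hr _ (hcoef l)).sub (hr _ (hcoef u)))).congr fun x => ?_
      rw [cond_Ioi_real_Ioc (measure_ne_top _ _) hlu.le, hτ, hτ, hτ]
      have h1 := (h.tail_pos (max x 1)).ne'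
      have h2 := (h.tail_pos (ε * max x 1)).ne'
      field_simp
  have h1 := (ProbabilityMeasure.tendsto_iff_forall_integral_tendsto.1 hconv)
    (BoundedContinuousFunction.ofNormedAddCommGroup g hg K hK)
  change Tendsto (fun x => ∫ z, g z ∂((τ x)[|Ioi ε])) atTop
    (𝓝 (∫ z, g z ∂((powerMeasure α)[|Ioi ε]))) at h1
  have h2 := h1.mul (hr ε hε)
  -- Conditioning on (ε, ∞) only changes the normalization, because g vanishes on [0, ε].
  have h3 : ∀ ν : Measure ℝ, (∀ᵐ z ∂ν, 0 ≤ z) →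
      ∫ z, g z ∂(ν[|Ioi ε]) = (ν.real (Ioi ε))⁻¹ * ∫ z, g z ∂ν := by
    intro ν hν'
    rw [ProbabilityTheory.cond, integral_smul_measure, ENNReal.toReal_inv, smul_eq_mul, measureReal_def]
    congr 1
    refine setIntegral_eq_integral_of_ae_compl_eq_zero ?_
    filter_upwards [hν'] with z hz hz'
    exact hgε z hz (not_lt.1 hz')
  rw [h3 _ ((ae_powerMeasure_pos α).mono fun z hz => hz.le), powerMeasure_real_Ioi hα hε,
    mul_comm, mul_inv_cancel_left₀ (by positivity)] at h2
  refine h2.congr' ?_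
  filter_upwards [eventually_ge_atTop 1] with x hx
  have hτ1 : ∀ᵐ z ∂τ x, 0 ≤ z := by
    refine (ae_map_iff (measurable_div_real _).aemeasurable measurableSet_Ici).2 ?_
    filter_upwards [hρ] with t ht
    exact div_nonneg ht (hm x).le
  rw [h3 _ hτ1, hτ, max_eq_left hx]
  have h4 : ∫ z, g z ∂τ x = ∫ t, g (t / x) ∂ρ := by
    simp only [τ, max_eq_left hx]
    rw [integral_map (measurable_div_real _).aemeasurable hg.aestronglyMeasurable]
  rw [h4]
  have h5 := (h.tail_pos x).ne'
  have h6 := (h.tail_pos (ε * x)).ne'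
  field_simp

end Vague

/-- A limit is identified by approximations whose error vanishes in the iterated limit. -/
lemma tendsto_of_approx {ι : Type*} {l : Filter ι} {F : ι → ℝ} {L : ℝ} {A E : ℕ → ι → ℝ}
    {a e : ℕ → ℝ} (hA : ∀ M, Tendsto (A M) l (𝓝 (a M))) (ha : Tendsto a atTop (𝓝 L))
    (hE : ∀ M, Tendsto (E M) l (𝓝 (e M))) (he : Tendsto e atTop (𝓝 0))
    (h : ∀ M, ∀ᶠ x in l, |F x - A M x| ≤ E M x) : Tendsto F l (𝓝 L) := by
  rw [Metric.tendsto_nhds]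
  intro ε hε
  have h1 := Metric.tendsto_nhds.1 ha (ε / 3) (by positivity)
  have h2 : ∀ᶠ M in atTop, e M < ε / 3 := he.eventually (gt_mem_nhds (by positivity))
  obtain ⟨M, hM1, hM2⟩ := (h1.and h2).exists
  have h3 := Metric.tendsto_nhds.1 (hA M) (ε / 3 - dist (a M) L) (by linarith)
  filter_upwards [h3, (hE M).eventually (gt_mem_nhds hM2), h M] with x hx1 hx2 hx3
  have h4 : dist (F x) (A M x) < ε / 3 := by rw [Real.dist_eq]; linarith
  linarith [dist_triangle (F x) (A M x) L, dist_triangle (A M x) (a M) L]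

/-! ### Tails of products of two independent variables -/

section Laws

variable {ρ σ τ : Measure ℝ} {α β : ℝ}

/-- The tail of the product of independent variables with laws `σ` and `ρ`. -/
noncomputable def prodTail (σ ρ : Measure ℝ) (x : ℝ) : ℝ := (σ.prod ρ).real {q | x < q.1 * q.2}

/-- The part of the tail of the product on which both factors exceed `M`. -/
noncomputable def jointTail (σ ρ : Measure ℝ) (M x : ℝ) : ℝ :=
  (σ.prod ρ).real {q | x < q.1 * q.2 ∧ M < q.1 ∧ M < q.2}

lemma measurableSet_lt_mul (x : ℝ) : MeasurableSet {q : ℝ × ℝ | x < q.1 * q.2} :=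
  measurableSet_lt measurable_const (measurable_fst.mul measurable_snd)

lemma prod_real_apply [IsFiniteMeasure σ] [IsFiniteMeasure ρ] {s : Set (ℝ × ℝ)}
    (hs : MeasurableSet s) : (σ.prod ρ).real s = ∫ v, ρ.real (Prod.mk v ⁻¹' s) ∂σ := by
  rw [measureReal_def, Measure.prod_apply hs, ← integral_toReal]
  · rfl
  · exact (measurable_measure_prodMk_left hs).aemeasurable
  · exact Eventually.of_forall fun v => measure_lt_top _ _

lemma prodTail_eq_integral (σ ρ : Measure ℝ) [IsFiniteMeasure σ] [IsFiniteMeasure ρ] (x : ℝ) :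
    prodTail σ ρ x = ∫ v, scaledTail ρ v x ∂σ :=
  prod_real_apply (measurableSet_lt_mul x)

lemma prodTail_nonneg (σ ρ : Measure ℝ) (x : ℝ) : 0 ≤ prodTail σ ρ x := measureReal_nonneg

lemma jointTail_nonneg (σ ρ : Measure ℝ) (M x : ℝ) : 0 ≤ jointTail σ ρ M x := measureReal_nonneg

lemma prodTail_restrict (σ ρ : Measure ℝ) [IsFiniteMeasure σ] [IsFiniteMeasure ρ] (x M : ℝ) :
    prodTail (σ.restrict (Iic M)) ρ x = (σ.prod ρ).real {q | x < q.1 * q.2 ∧ q.1 ≤ M} := by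
  unfold prodTail
  have := Measure.prod_restrict (μ := σ) (ν := ρ) (Iic M) univ
  rw [Measure.restrict_univ] at this
  rw [this, measureReal_restrict_apply (measurableSet_lt_mul x)]
  congr 1
  ext q
  simp

lemma ae_prod_nonneg [IsFiniteMeasure σ] [IsFiniteMeasure ρ] (hσ : ∀ᵐ v ∂σ, 0 ≤ v)
    (hρ : ∀ᵐ v ∂ρ, 0 ≤ v) : ∀ᵐ q ∂(σ.prod ρ), 0 ≤ q.1 ∧ 0 ≤ q.2 :=
  (Measure.quasiMeasurePreserving_fst.ae hσ).and (Measure.quasiMeasurePreserving_snd.ae hρ)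

/-- If both factors are at most M, the product is at most M² ≤ x. So exactly one of three cases
occurs: the first factor is at most M, the second is, or both exceed M. -/
lemma prodTail_eq_add [IsFiniteMeasure σ] [IsFiniteMeasure ρ] (hσ : ∀ᵐ v ∂σ, 0 ≤ v)
    (hρ : ∀ᵐ v ∂ρ, 0 ≤ v) {M x : ℝ} (hx : M * M ≤ x) :
    prodTail σ ρ x = prodTail (σ.restrict (Iic M)) ρ x + prodTail (ρ.restrict (Iic M)) σ x +
      jointTail σ ρ M x := by
  have hm := measurableSet_lt_mul x
  have m1 : MeasurableSet {q : ℝ × ℝ | x < q.1 * q.2 ∧ q.1 ≤ M} :=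
    hm.inter (measurableSet_le measurable_fst measurable_const)
  have h2 : prodTail (ρ.restrict (Iic M)) σ x =
      (σ.prod ρ).real {q | x < q.1 * q.2 ∧ q.2 ≤ M} := by
    rw [prodTail_restrict, ← Measure.prod_swap, map_measureReal_apply measurable_swap m1]
    congr 1
    ext q
    simp [mul_comm]
  have m2 : MeasurableSet {q : ℝ × ℝ | x < q.1 * q.2 ∧ q.2 ≤ M} :=
    hm.inter (measurableSet_le measurable_snd measurable_const)
  have m3 : MeasurableSet {q : ℝ × ℝ | x < q.1 * q.2 ∧ M < q.1 ∧ M < q.2} :=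
    hm.inter ((measurableSet_lt measurable_const measurable_fst).inter
      (measurableSet_lt measurable_const measurable_snd))
  rw [h2, prodTail_restrict]
  unfold prodTail jointTail
  rw [← integral_indicator_one hm, ← integral_indicator_one m1, ← integral_indicator_one m2,
    ← integral_indicator_one m3, ← integral_add, ← integral_add]
  · refine integral_congr_ae ?_
    filter_upwards [ae_prod_nonneg hσ hρ] with q hq
    simp only [indicator_apply, mem_ofPred_eq, Pi.one_apply]
    by_cases h0 : x < q.1 * q.2
    · by_cases h1 : q.1 ≤ M
      · have h3 : ¬ q.2 ≤ M := fun h3 => absurd h0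
          (not_lt.2 ((mul_le_mul h1 h3 hq.2 (hq.1.trans h1)).trans hx))
        simp [h0, h1, h3, not_lt.2 h1]
      · by_cases h3 : q.2 ≤ M
        · simp [h0, h1, h3, not_lt.2 h3]
        · simp [h0, h1, h3, not_le.1 h1, not_le.1 h3]
    · simp [h0]
  all_goals first
    | exact (integrable_const (1 : ℝ)).indicator (by assumption)
    | exact ((integrable_const (1 : ℝ)).indicator (by assumption)).add
        ((integrable_const (1 : ℝ)).indicator (by assumption))

/-- In this form σ enters only through its tail, so a comparison of tails carries over to joint
tails. -/
lemma jointTail_eq_integral [IsFiniteMeasure σ] [IsFiniteMeasure ρ] {M x : ℝ} (hM : 0 ≤ M) :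
    jointTail σ ρ M x = ∫ v in Ioi M, tail σ (max M (x / v)) ∂ρ := by
  have m3 : MeasurableSet {q : ℝ × ℝ | x < q.1 * q.2 ∧ M < q.1 ∧ M < q.2} :=
    (measurableSet_lt_mul x).inter ((measurableSet_lt measurable_const measurable_fst).inter
      (measurableSet_lt measurable_const measurable_snd))
  unfold jointTail
  rw [← Measure.prod_swap, map_measureReal_apply measurable_swap m3,
    prod_real_apply (measurable_swap m3), ← integral_indicator measurableSet_Ioi]
  refine integral_congr_ae (Eventually.of_forall fun v => ?_)
  by_cases hv : M < v
  · rw [indicator_of_mem (show v ∈ Ioi M from hv)]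
    refine congrArg σ.real (Set.ext fun u => ?_)
    simp [hv, div_lt_iff₀ (hM.trans_lt hv), and_comm]
  · rw [indicator_of_notMem (show v ∉ Ioi M from hv)]
    have : Prod.mk v ⁻¹' (Prod.swap ⁻¹' {q : ℝ × ℝ | x < q.1 * q.2 ∧ M < q.1 ∧ M < q.2}) = ∅ := by
      ext u; simp [hv]
    simp only [this, measureReal_empty]

lemma measurable_tail_max (σ : Measure ℝ) [IsFiniteMeasure σ] (M x : ℝ) :
    Measurable fun v => tail σ (max M (x / v)) :=
  (tail_antitone σ).measurable.comp (measurable_const.max (measurable_const.div measurable_id))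

lemma jointTail_le_of_tail_le [IsProbabilityMeasure σ] [IsProbabilityMeasure ρ] {D : ℝ}
    (hD : ∀ x, tail σ x ≤ D * tail ρ x) {M x : ℝ} (hM : 0 ≤ M) :
    jointTail σ ρ M x ≤ D * jointTail ρ ρ M x := by
  have hi : ∀ μ : Measure ℝ, [IsProbabilityMeasure μ] →
      Integrable (fun v => tail μ (max M (x / v))) (ρ.restrict (Ioi M)) := fun μ _ =>
    Integrable.of_bound (measurable_tail_max μ M x).aestronglyMeasurable 1
      (Eventually.of_forall fun v => by
        rw [Real.norm_of_nonneg (tail_nonneg _ _)]; exact tail_le_one _ _)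
  rw [jointTail_eq_integral hM, jointTail_eq_integral hM, ← integral_const_mul]
  exact integral_mono (hi σ) ((hi ρ).const_mul D) fun v => hD _

lemma tail_mconv [IsFiniteMeasure σ] [IsFiniteMeasure ρ] (x : ℝ) :
    tail (σ ∗ₘ ρ) x = prodTail σ ρ x := by
  unfold tail prodTail Measure.mconv
  have hm : Measurable fun q : ℝ × ℝ => q.1 * q.2 := measurable_fst.mul measurable_snd
  rw [map_measureReal_apply hm measurableSet_Ioi]
  rfl

lemma RVTail.tendsto_prodTail [IsProbabilityMeasure ρ] [IsProbabilityMeasure σ]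
    (h : RVTail ρ α) (hβ : α < β) {k : ℝ}
    (hσ : Tendsto (fun x => tail σ x / tail ρ x) atTop (𝓝 k)) [IsFiniteMeasure τ]
    (hτ0 : ∀ᵐ v ∂τ, 0 ≤ v) (hτ : Integrable (fun v => max 1 v ^ β) τ) :
    Tendsto (fun x => prodTail τ σ x / tail ρ x) atTop (𝓝 (k * ∫ v, v ^ α ∂τ)) := by
  simp_rw [prodTail_eq_integral]
  exact h.breiman hβ hσ hτ0 hτ

lemma integrable_max_rpow_restrict_Iic (τ : Measure ℝ) [IsFiniteMeasure τ] (hβ : 0 ≤ β) (M : ℝ) :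
    Integrable (fun v => max 1 v ^ β) (τ.restrict (Iic M)) := by
  refine Integrable.of_bound (by fun_prop) (max 1 M ^ β) ?_
  filter_upwards [ae_restrict_mem measurableSet_Iic] with v hv
  rw [Real.norm_of_nonneg (by positivity)]
  exact Real.rpow_le_rpow (by positivity) (max_le_max_left _ hv) hβ

/-- A factor truncated at M is bounded, so Breiman's lemma applies with no moment assumption on τ.
-/
lemma RVTail.tendsto_prodTail_restrict [IsProbabilityMeasure ρ] [IsProbabilityMeasure σ]
    (h : RVTail ρ α) {k : ℝ} (hσ : Tendsto (fun x => tail σ x / tail ρ x) atTop (𝓝 k))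
    [IsFiniteMeasure τ] (hτ0 : ∀ᵐ v ∂τ, 0 ≤ v) (M : ℝ) :
    Tendsto (fun x => prodTail (τ.restrict (Iic M)) σ x / tail ρ x) atTop
      (𝓝 (k * ∫ v in Iic M, v ^ α ∂τ)) :=
  h.tendsto_prodTail (lt_add_one α) hσ (ae_restrict_of_ae hτ0)
    (integrable_max_rpow_restrict_Iic τ (by linarith [h.index_pos]) M)

/-- Comparison of tails implies comparison of integrals of monotone functions. -/
lemma integral_le_of_tail_le {π : Measure ℝ} [IsProbabilityMeasure ρ] [IsProbabilityMeasure π]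
    {K x₀ B : ℝ} (hK : 0 ≤ K) (ht : ∀ x ≥ x₀, K * tail ρ x ≤ tail π x) {H : ℝ → ℝ}
    (hmono : Monotone H) (hcont : Continuous H) (h0 : ∀ x, 0 ≤ H x) (hB : ∀ x, H x ≤ B) :
    K * (∫ z, H z ∂ρ - H x₀) ≤ ∫ z, H z ∂π := by
  -- Each superlevel set of `f` at a positive height is empty or an open upper half-line to the
  -- right of x₀, where the tails are comparable; the layer-cake formula then integrates the
  -- comparison.
  let f : ℝ → ℝ := fun z => max (H z - H x₀) 0
  have hfc : Continuous f := by fun_prop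
  have hf0 : ∀ z, 0 ≤ f z := fun z => le_max_right _ _
  have hfi : ∀ μ : Measure ℝ, [IsProbabilityMeasure μ] → Integrable f μ := fun μ _ =>
    Integrable.of_bound hfc.aestronglyMeasurable B (Eventually.of_forall fun z => by
      rw [Real.norm_of_nonneg (hf0 z)]
      exact max_le (by linarith [hB z, h0 x₀]) ((h0 z).trans (hB z)))
  have hHi : ∀ μ : Measure ℝ, [IsProbabilityMeasure μ] → Integrable H μ := fun μ _ =>
    Integrable.of_bound hcont.aestronglyMeasurable B (Eventually.of_forall fun z => by
      rw [Real.norm_of_nonneg (h0 z)]; exact hB z)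
  have hU : ∀ t > 0, K * ρ.real {z | t < f z} ≤ π.real {z | t < f z} := by
    intro t ht0
    set U := {z | t < f z} with hUdef
    have hUx : ∀ z ∈ U, x₀ < z := by
      intro z hz
      by_contra hzx
      have h1 := hmono (not_lt.1 hzx)
      have h2 : f z = 0 := max_eq_right (by linarith)
      have h3 : t < f z := hz
      linarith
    rcases U.eq_empty_or_nonempty with hne | hne
    · simp [hne]
    have hbdd : BddBelow U := ⟨x₀, fun z hz => (hUx z hz).le⟩
    have hUI : U = Ioi (sInf U) := by
      ext z
      constructor
      · intro hz
        have hopen : IsOpen U := isOpen_lt continuous_const hfc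
        obtain ⟨r, hr, hrU⟩ := Metric.isOpen_iff.1 hopen z hz
        have h1 : z - r / 2 ∈ U := hrU (by
          rw [Metric.mem_ball, Real.dist_eq, abs_lt]; constructor <;> linarith)
        have h2 := csInf_le hbdd h1
        simp only [mem_Ioi]; linarith
      · intro hz
        obtain ⟨u, hu, huz⟩ := exists_lt_of_csInf_lt hne hz
        have h3 : t < f u := hu
        exact h3.trans_le (max_le_max_right _ (sub_le_sub_right (hmono huz.le) _))
    rw [hUI]
    exact ht _ (le_csInf hne fun z hz => (hUx z hz).le)
  have hcake : K * ∫ z, f z ∂ρ ≤ ∫ z, f z ∂π := by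
    rw [(hfi ρ).integral_eq_integral_meas_lt (Eventually.of_forall hf0),
      (hfi π).integral_eq_integral_meas_lt (Eventually.of_forall hf0), ← integral_const_mul]
    have hint : ∀ μ : Measure ℝ, [IsProbabilityMeasure μ] →
        IntegrableOn (fun t => μ.real {z | t < f z}) (Ioi 0) := by
      intro μ _
      have hle : ∀ t ∈ Ioi (0 : ℝ), μ.real {z | t < f z} ≤ (Ioc 0 B).indicator 1 t := by
        intro t ht
        by_cases htB : t ≤ B
        · rw [indicator_of_mem (show t ∈ Ioc 0 B from ⟨ht, htB⟩)]
          exact measureReal_le_one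
        · have : {z | t < f z} = ∅ := by
            ext z
            simp only [mem_ofPred_eq, mem_empty_iff_false, iff_false, not_lt]
            exact (max_le (by linarith [hB z, h0 x₀]) ((h0 z).trans (hB z))).trans
              (not_le.1 htB).le
          rw [this, measureReal_empty]
          exact indicator_nonneg (fun _ _ => zero_le_one) _
      have hanti : Antitone fun t => μ.real {z | t < f z} := fun s t hst =>
        measureReal_mono fun z hz => lt_of_le_of_lt hst hz
      refine Integrable.mono' (g := (Ioc (0 : ℝ) B).indicator 1) ?_
        hanti.measurable.aestronglyMeasurable ?_
      · exact ((integrable_indicator_iff measurableSet_Ioc).2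
          (integrableOn_const (by simp))).integrableOn
      · filter_upwards [ae_restrict_mem measurableSet_Ioi] with t ht
        rw [Real.norm_of_nonneg measureReal_nonneg]
        exact hle t ht
    exact setIntegral_mono_on ((hint ρ).const_mul K) (hint π) measurableSet_Ioi fun t ht => hU t ht
  calc K * (∫ z, H z ∂ρ - H x₀) ≤ K * ∫ z, f z ∂ρ := by
        gcongr
        have h1 : ∫ z, (H z - H x₀) ∂ρ = ∫ z, H z ∂ρ - H x₀ := by
          rw [integral_sub (hHi ρ) (integrable_const _)]; simp
        rw [← h1]
        exact integral_mono ((hHi ρ).sub (integrable_const _)) (hfi ρ) fun z => le_max_left _ _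
    _ ≤ ∫ z, f z ∂π := hcake
    _ ≤ ∫ z, H z ∂π := integral_mono (hfi π) (hHi π) fun z =>
        max_le (by linarith [h0 x₀]) (h0 z)

end Laws

/-! ### Convolution equivalence: the moment of order α, the constant, and multiple products -/

section ConvolutionEquivalence

variable {ρ σ : Measure ℝ} {α : ℝ}

/-- Truncation to the interval `[1, R]`. -/
noncomputable def clampOne (R z : ℝ) : ℝ := min (max z 1) R

lemma continuous_clampOne (R : ℝ) : Continuous (clampOne R) := by unfold clampOne; fun_prop

lemma monotone_clampOne (R : ℝ) : Monotone (clampOne R) := fun _ _ h =>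
  min_le_min_right _ (max_le_max_right _ h)

lemma one_le_clampOne {R : ℝ} (hR : 1 ≤ R) (z : ℝ) : 1 ≤ clampOne R z :=
  le_min (le_max_right _ _) hR

lemma clampOne_le (R z : ℝ) : clampOne R z ≤ R := min_le_right _ _

/-- Truncation destroys multiplicativity but keeps submultiplicativity on [1, ∞), and only an upper
bound for moments of the product is needed. -/
lemma clampOne_mul_le {R z w : ℝ} (hR : 1 ≤ R) (hz : 1 ≤ z) (hw : 1 ≤ w) :
    clampOne R (z * w) ≤ clampOne R z * clampOne R w := by
  have h1 := one_le_clampOne hR z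
  have h2 := one_le_clampOne hR w
  rcases le_total R z with h | h
  · have : clampOne R z = R := min_eq_right (h.trans (le_max_left _ _))
    rw [this]
    exact (clampOne_le _ _).trans (le_mul_of_one_le_right (by linarith) h2)
  rcases le_total R w with h' | h'
  · have : clampOne R w = R := min_eq_right (h'.trans (le_max_left _ _))
    rw [this]
    exact (clampOne_le _ _).trans (le_mul_of_one_le_left (by linarith) h1)
  · have e1 : clampOne R z = z := by rw [clampOne, max_eq_left hz, min_eq_left h]
    have e2 : clampOne R w = w := by rw [clampOne, max_eq_left hw, min_eq_left h']
    rw [e1, e2, clampOne, max_eq_left (one_le_mul_of_one_le_of_one_le hz hw)]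
    exact min_le_left _ _

lemma integrable_clampOne_rpow [IsFiniteMeasure ρ] {R s : ℝ} (hR : 1 ≤ R) (hs : 0 ≤ s) :
    Integrable (fun z => clampOne R z ^ s) ρ := by
  refine Integrable.of_bound ((continuous_clampOne R).rpow_const
    fun z => Or.inr hs).aestronglyMeasurable (R ^ s) (Eventually.of_forall fun z => ?_)
  have h0 : 0 ≤ clampOne R z := zero_le_one.trans (one_le_clampOne hR z)
  rw [Real.norm_of_nonneg (by positivity)]
  exact Real.rpow_le_rpow h0 (clampOne_le _ _) hs

/-- The difference equals u^α (u^ε - 1), a product of two nonnegative nondecreasing factors on [1,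
∞). -/
lemma rpow_add_sub_mono {α ε u w : ℝ} (hα : 0 ≤ α) (hε : 0 ≤ ε) (hu : 1 ≤ u) (huw : u ≤ w) :
    u ^ (α + ε) - u ^ α ≤ w ^ (α + ε) - w ^ α := by
  have hu0 : 0 < u := by linarith
  have hw0 : 0 < w := by linarith
  have e : ∀ v : ℝ, 0 < v → v ^ (α + ε) - v ^ α = v ^ α * (v ^ ε - 1) := fun v hv => by
    rw [Real.rpow_add hv]; ring
  rw [e u hu0, e w hw0]
  have h1 : 1 ≤ u ^ ε := Real.one_le_rpow hu hε
  exact mul_le_mul (Real.rpow_le_rpow hu0.le huw hα)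
    (sub_le_sub_right (Real.rpow_le_rpow hu0.le huw hε) _) (by linarith) (by positivity)

/-- The quadratic inequality for exponentially tilted truncated moments. -/
lemma tilted_moment_inequality [IsProbabilityMeasure ρ] (hα : 0 ≤ α)
    (hρ : ∀ᵐ z ∂ρ, 1 ≤ z) (hi : Integrable (fun z => z ^ α) ρ) {δ x₀ : ℝ} (hδ : 0 ≤ δ)
    (hx₀ : 1 ≤ x₀)
    (ht : ∀ x ≥ x₀, (2 * ∫ z, z ^ α ∂ρ + δ) * tail ρ x ≤ prodTail ρ ρ x)
    {R ε : ℝ} (hR : 1 ≤ R) (hε : 0 ≤ ε) :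
    δ * (∫ z, clampOne R z ^ (α + ε) ∂ρ - ∫ z, clampOne R z ^ α ∂ρ) ≤
      (∫ z, clampOne R z ^ (α + ε) ∂ρ - ∫ z, clampOne R z ^ α ∂ρ) ^ 2 +
        (2 * ∫ z, z ^ α ∂ρ + δ) * (x₀ ^ (α + ε) - x₀ ^ α) := by
  set m := ∫ z, z ^ α ∂ρ with hm
  have hm0 : 0 ≤ m := integral_nonneg_of_ae (by
    filter_upwards [hρ] with z hz
    have : 0 ≤ z := by linarith
    positivity)
  set b := clampOne R
  have hb1 : ∀ z, 1 ≤ b z := one_le_clampOne hR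
  let H : ℝ → ℝ := fun z => b z ^ (α + ε) - b z ^ α
  have hiε := integrable_clampOne_rpow (ρ := ρ) hR (add_nonneg hα hε)
  have hiα := integrable_clampOne_rpow (ρ := ρ) hR hα
  set I := ∫ z, b z ^ (α + ε) ∂ρ
  set J := ∫ z, b z ^ α ∂ρ
  have hHint : ∫ z, H z ∂ρ = I - J := integral_sub hiε hiα
  have hHmono : Monotone H := fun z w h =>
    rpow_add_sub_mono hα hε (hb1 z) (monotone_clampOne R h)
  have hHcont : Continuous H :=
    ((continuous_clampOne R).rpow_const fun _ => Or.inr (add_nonneg hα hε)).sub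
      ((continuous_clampOne R).rpow_const fun _ => Or.inr hα)
  have hH0 : ∀ z, 0 ≤ H z := fun z => by
    have := rpow_add_sub_mono hα hε le_rfl (hb1 z)
    rwa [Real.one_rpow, Real.one_rpow, sub_self] at this
  have hHB : ∀ z, H z ≤ R ^ (α + ε) - R ^ α := fun z =>
    rpow_add_sub_mono hα hε (hb1 z) (clampOne_le _ _)
  let π : Measure ℝ := ρ ∗ₘ ρ
  have hπ : IsProbabilityMeasure π :=
    Measure.isProbabilityMeasure_map (measurable_fst.mul measurable_snd).aemeasurable
  have h1 := integral_le_of_tail_le (ρ := ρ) (π := π) (K := 2 * m + δ) (x₀ := x₀) (by positivity)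
    (fun x hx => (ht x hx).trans_eq (tail_mconv x).symm) hHmono hHcont hH0 hHB
  have hbJ : J ≤ m := by
    refine integral_mono_ae hiα hi ?_
    filter_upwards [hρ] with z hz
    have h2 : b z ≤ z := (min_le_left _ _).trans_eq (max_eq_left hz)
    exact Real.rpow_le_rpow (zero_le_one.trans (hb1 z)) h2 hα
  have hGnn : 0 ≤ I - J := hHint ▸ integral_nonneg hH0
  -- Submultiplicativity of the truncation and monotonicity of u^(α+ε) - u^α bound H(z w) by a
  -- difference of two products, whose integrals factorize.
  have h2 : ∫ z, H z ∂π ≤ I ^ 2 - J ^ 2 := by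
    have hmeas : Measurable fun q : ℝ × ℝ => q.1 * q.2 := measurable_fst.mul measurable_snd
    have e1 : ∫ z, H z ∂π = ∫ q, H (q.1 * q.2) ∂(ρ.prod ρ) :=
      integral_map hmeas.aemeasurable hHcont.aestronglyMeasurable
    have e2 : I ^ 2 - J ^ 2 = ∫ q, (b q.1 ^ (α + ε) * b q.2 ^ (α + ε) - b q.1 ^ α * b q.2 ^ α)
        ∂(ρ.prod ρ) := by
      rw [integral_sub (hiε.mul_prod hiε) (hiα.mul_prod hiα),
        integral_prod_mul (fun z => b z ^ (α + ε)) (fun z => b z ^ (α + ε)),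
        integral_prod_mul (fun z => b z ^ α) (fun z => b z ^ α)]
      ring
    rw [e1, e2]
    refine integral_mono_ae ?_ ((hiε.mul_prod hiε).sub (hiα.mul_prod hiα)) ?_
    · refine Integrable.of_bound (hHcont.comp (by fun_prop)).aestronglyMeasurable
        (R ^ (α + ε) - R ^ α) (Eventually.of_forall fun q => ?_)
      rw [Real.norm_of_nonneg (hH0 _)]; exact hHB _
    · have hae : ∀ᵐ q ∂(ρ.prod ρ), 1 ≤ q.1 ∧ 1 ≤ q.2 :=
        (Measure.quasiMeasurePreserving_fst.ae hρ).and (Measure.quasiMeasurePreserving_snd.ae hρ)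
      filter_upwards [hae] with q hq
      have h3 := rpow_add_sub_mono hα hε (hb1 (q.1 * q.2)) (clampOne_mul_le hR hq.1 hq.2)
      have p1 : 0 ≤ b q.1 := zero_le_one.trans (hb1 _)
      have p2 : 0 ≤ b q.2 := zero_le_one.trans (hb1 _)
      rw [Real.mul_rpow p1 p2, Real.mul_rpow p1 p2] at h3
      exact h3
  have h3 : H x₀ ≤ x₀ ^ (α + ε) - x₀ ^ α :=
    rpow_add_sub_mono hα hε (hb1 x₀) ((min_le_left _ _).trans_eq (max_eq_left hx₀))
  rw [hHint] at h1
  have h4 : (2 * m + δ) * H x₀ ≤ (2 * m + δ) * (x₀ ^ (α + ε) - x₀ ^ α) := by gcongr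
  -- With G = I - J one has I² - J² = G² + 2 J G. As J ≤ m, the term 2 m G on the left absorbs 2 J G
  -- and leaves δ G.
  nlinarith

/-- Suppose c > 2 m and let δ be half the excess. For each truncation R the increment G(ε) of the
moments from order α to α + ε is continuous, starts at zero, and satisfies δ G ≤ G² + small, so it
cannot reach δ/2. The bound is uniform in R, while R^(α+ε) times the tail at R is unbounded: a
contradiction. -/
lemma RVTail.prodTail_constant_le [IsProbabilityMeasure ρ] (h : RVTail ρ α)
    (hρ : ∀ᵐ z ∂ρ, 1 ≤ z) (hi : Integrable (fun z => z ^ α) ρ) {c : ℝ}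
    (hc : Tendsto (fun x => prodTail ρ ρ x / tail ρ x) atTop (𝓝 c)) :
    c ≤ 2 * ∫ z, z ^ α ∂ρ := by
  by_contra! hlt
  have hα := h.index_pos
  set m := ∫ z, z ^ α ∂ρ with hm
  set δ := (c - 2 * m) / 2 with hδdef
  have hδ : 0 < δ := by rw [hδdef]; linarith
  obtain ⟨x₁, hx₁⟩ := eventually_atTop.1 (hc.eventually (lt_mem_nhds (a := 2 * m + δ)
    (by rw [hδdef]; linarith)))
  set x₀ := max x₁ 1
  have hx₀ : 1 ≤ x₀ := le_max_right _ _
  have hx0 : (0 : ℝ) < x₀ := by linarith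
  have ht : ∀ x ≥ x₀, (2 * m + δ) * tail ρ x ≤ prodTail ρ ρ x := fun x hx => by
    have := hx₁ x ((le_max_left _ _).trans hx)
    rw [lt_div_iff₀ (h.tail_pos _)] at this
    exact this.le
  have hk : Tendsto (fun ε : ℝ => (2 * m + δ) * (x₀ ^ (α + ε) - x₀ ^ α)) (𝓝[>] 0) (𝓝 0) := by
    have hcont : Continuous fun ε : ℝ => (2 * m + δ) * (x₀ ^ (α + ε) - x₀ ^ α) := by
      have : Continuous fun ε : ℝ => x₀ ^ (α + ε) :=
        Real.continuous_const_rpow hx0.ne' |>.comp (continuous_const.add continuous_id)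
      fun_prop
    have := hcont.tendsto 0
    simp only [add_zero, sub_self, mul_zero] at this
    exact this.mono_left nhdsWithin_le_nhds
  -- The threshold δ²/8 excludes the value δ/2 for G: the inequality would read δ²/2 ≤ δ²/4 + δ²/8.
  obtain ⟨ε₀, hε₀, hε₀pos⟩ := ((hk.eventually (gt_mem_nhds
    (show (0 : ℝ) < δ ^ 2 / 8 by positivity))).and self_mem_nhdsWithin).exists
  have hε₀pos : 0 < ε₀ := hε₀pos
  have hm0 : 0 ≤ m := integral_nonneg_of_ae (by
    filter_upwards [hρ] with z hz
    have : 0 ≤ z := by linarith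
    positivity)
  have bound : ∀ R ≥ 1, ∫ z, clampOne R z ^ (α + ε₀) ∂ρ ≤ m + δ / 2 := by
    intro R hR
    let G : ℝ → ℝ := fun ε => ∫ z, clampOne R z ^ (α + ε) ∂ρ - ∫ z, clampOne R z ^ α ∂ρ
    have hG0 : G 0 = 0 := by simp [G]
    have hbp : ∀ z, 0 < clampOne R z := fun z => zero_lt_one.trans_le (one_le_clampOne hR z)
    have hGc : ContinuousOn G (Icc 0 ε₀) := by
      refine ContinuousOn.sub ?_ continuousOn_const
      refine continuousOn_of_dominated (bound := fun _ => R ^ (α + ε₀)) ?_ ?_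
        (integrable_const _) ?_
      · exact fun ε hε =>
          (integrable_clampOne_rpow hR (add_nonneg hα.le hε.1)).aestronglyMeasurable
      · refine fun ε hε => Eventually.of_forall fun z => ?_
        rw [Real.norm_of_nonneg (Real.rpow_nonneg (hbp z).le _)]
        exact (Real.rpow_le_rpow (hbp z).le (clampOne_le _ _) (add_nonneg hα.le hε.1)).trans
          (Real.rpow_le_rpow_of_exponent_le hR (by linarith [hε.2]))
      · exact Eventually.of_forall fun z =>
          (Real.continuous_const_rpow (hbp z).ne' |>.comp
            (continuous_const.add continuous_id)).continuousOn
    have hGle : G ε₀ ≤ δ / 2 := by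
      by_contra! hgt
      obtain ⟨ε, hε, hGε⟩ := intermediate_value_Icc hε₀pos.le hGc
        (show δ / 2 ∈ Icc (G 0) (G ε₀) from ⟨by rw [hG0]; positivity, hgt.le⟩)
      have h1 := tilted_moment_inequality hα.le hρ hi hδ.le hx₀ ht hR hε.1
      change δ * G ε ≤ G ε ^ 2 + _ at h1
      have h2 : (2 * m + δ) * (x₀ ^ (α + ε) - x₀ ^ α) ≤
          (2 * m + δ) * (x₀ ^ (α + ε₀) - x₀ ^ α) := by
        have := Real.rpow_le_rpow_of_exponent_le hx₀ (show α + ε ≤ α + ε₀ by linarith [hε.2])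
        gcongr
      rw [hGε] at h1
      nlinarith
    have hJ : ∫ z, clampOne R z ^ α ∂ρ ≤ m := by
      refine integral_mono_ae (integrable_clampOne_rpow hR hα.le) hi ?_
      filter_upwards [hρ] with z hz
      exact Real.rpow_le_rpow (hbp z).le ((min_le_left _ _).trans_eq (max_eq_left hz)) hα.le
    have : ∫ z, clampOne R z ^ (α + ε₀) ∂ρ = G ε₀ + ∫ z, clampOne R z ^ α ∂ρ := by simp [G]
    linarith
  have hgrow := h.tendsto_rpow_mul_tail (β := α + ε₀) (by linarith)
  obtain ⟨R, hR1, hR2⟩ := ((hgrow.eventually (eventually_gt_atTop (m + δ / 2))).and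
    (eventually_ge_atTop 1)).exists
  refine absurd (bound R hR2) (not_le.2 (hR1.trans_le ?_))
  -- Markov's inequality for the truncated moment at its truncation level.
  have e : R ^ (α + ε₀) * tail ρ R = ∫ z, (Ioi R).indicator (fun _ => R ^ (α + ε₀)) z ∂ρ := by
    rw [integral_indicator_const _ measurableSet_Ioi, smul_eq_mul, mul_comm]; rfl
  rw [e]
  refine integral_mono ((integrable_const _).indicator measurableSet_Ioi)
    (integrable_clampOne_rpow hR2 (by linarith)) fun z => ?_
  by_cases hz : z ∈ Ioi R
  · have : clampOne R z = R := min_eq_right (hz.le.trans (le_max_left _ _))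
    simp [indicator_of_mem hz, this]
  · rw [indicator_of_notMem hz]
    exact Real.rpow_nonneg (zero_le_one.trans (one_le_clampOne hR2 z)) _

/-- Discard the event that both factors exceed M; by Breiman's lemma each of the two remaining
pieces contributes one truncated moment. -/
lemma RVTail.two_mul_truncated_moment_le [IsProbabilityMeasure ρ] (h : RVTail ρ α)
    (hρ : ∀ᵐ z ∂ρ, 0 ≤ z) {c : ℝ}
    (hc : Tendsto (fun x => prodTail ρ ρ x / tail ρ x) atTop (𝓝 c)) (M : ℝ) :
    2 * ∫ z in Iic M, z ^ α ∂ρ ≤ c := by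
  have h1 := h.tendsto_prodTail_restrict h.tendsto_self hρ M
  rw [one_mul] at h1
  refine le_of_tendsto_of_tendsto (h1.const_mul 2) hc ?_
  filter_upwards [eventually_ge_atTop (M * M)] with x hx
  rw [prodTail_eq_add hρ hρ hx, add_div, add_div]
  have := div_nonneg (jointTail_nonneg ρ ρ M x) (tail_nonneg ρ x)
  linarith

lemma tendsto_setIntegral_Iic_nat {μ : Measure ℝ} {f : ℝ → ℝ} (hf : Integrable f μ) :
    Tendsto (fun M : ℕ => ∫ z in Iic (M : ℝ), f z ∂μ) atTop (𝓝 (∫ z, f z ∂μ)) :=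
  (aecover_Iic tendsto_natCast_atTop_atTop).integral_tendsto_of_countably_generated hf

lemma RVTail.integrable_rpow_of_prodTail [IsProbabilityMeasure ρ] (h : RVTail ρ α)
    (hρ : ∀ᵐ z ∂ρ, 0 ≤ z) {c : ℝ}
    (hc : Tendsto (fun x => prodTail ρ ρ x / tail ρ x) atTop (𝓝 c)) :
    Integrable (fun z => z ^ α) ρ := by
  have hα := h.index_pos
  refine (aecover_Iic (μ := ρ) (tendsto_natCast_atTop_atTop (R := ℝ))).integrable_of_integral_norm_bounded
    (c / 2) (fun M => ?_) (Eventually.of_forall fun M => ?_)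
  · refine (integrable_max_rpow_restrict_Iic ρ hα.le M).mono' (by fun_prop) ?_
    filter_upwards [ae_restrict_of_ae hρ] with z hz
    rw [Real.norm_of_nonneg (by positivity)]
    exact Real.rpow_le_rpow hz (le_max_right _ _) hα.le
  · have h1 := h.two_mul_truncated_moment_le hρ hc M
    have h2 : ∫ z in Iic (M : ℝ), ‖z ^ α‖ ∂ρ = ∫ z in Iic (M : ℝ), z ^ α ∂ρ :=
      integral_congr_ae (by
        filter_upwards [ae_restrict_of_ae hρ] with z hz
        exact Real.norm_of_nonneg (by positivity))
    rw [h2]; linarith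

/-- If the tail of the product is equivalent to a multiple of the tail, the constant is twice the
moment of order `α`. -/
lemma RVTail.prodTail_constant_eq [IsProbabilityMeasure ρ] (h : RVTail ρ α)
    (hρ : ∀ᵐ z ∂ρ, 1 ≤ z) {c : ℝ}
    (hc : Tendsto (fun x => prodTail ρ ρ x / tail ρ x) atTop (𝓝 c)) :
    c = 2 * ∫ z, z ^ α ∂ρ := by
  have hρ0 : ∀ᵐ z ∂ρ, 0 ≤ z := hρ.mono fun z hz => zero_le_one.trans hz
  have hi := h.integrable_rpow_of_prodTail hρ0 hc
  refine le_antisymm (h.prodTail_constant_le hρ hi hc) ?_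
  exact le_of_tendsto ((tendsto_setIntegral_Iic_nat hi).const_mul 2)
    (Eventually.of_forall fun M => h.two_mul_truncated_moment_le hρ0 hc M)

/-- The joint piece is what the two truncated pieces leave of `c`. When `c` is twice the full
moment, this limit vanishes as M grows: two factors are not large together. -/
lemma RVTail.tendsto_jointTail [IsProbabilityMeasure ρ] (h : RVTail ρ α)
    (hρ : ∀ᵐ z ∂ρ, 0 ≤ z) {c : ℝ}
    (hc : Tendsto (fun x => prodTail ρ ρ x / tail ρ x) atTop (𝓝 c)) (M : ℝ) :
    Tendsto (fun x => jointTail ρ ρ M x / tail ρ x) atTop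
      (𝓝 (c - 2 * ∫ z in Iic M, z ^ α ∂ρ)) := by
  have h1 := h.tendsto_prodTail_restrict h.tendsto_self hρ M
  rw [one_mul] at h1
  refine (hc.sub (h1.const_mul 2)).congr' ?_
  filter_upwards [eventually_ge_atTop (M * M)] with x hx
  rw [prodTail_eq_add hρ hρ hx]
  ring

/-- The law of the product of `q` independent variables with law `ρ`. -/
noncomputable def powLaw (ρ : Measure ℝ) : ℕ → Measure ℝ
  | 0 => Measure.dirac 1
  | q + 1 => powLaw ρ q ∗ₘ ρ

lemma isProbabilityMeasure_mconv [IsProbabilityMeasure σ] [IsProbabilityMeasure ρ] :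
    IsProbabilityMeasure (σ ∗ₘ ρ) :=
  Measure.isProbabilityMeasure_map (measurable_fst.mul measurable_snd).aemeasurable

instance [IsProbabilityMeasure ρ] (q : ℕ) : IsProbabilityMeasure (powLaw ρ q) := by
  induction q with
  | zero => exact Measure.dirac.isProbabilityMeasure
  | succ q ih => exact isProbabilityMeasure_mconv

lemma ae_mconv_nonneg [IsProbabilityMeasure σ] [IsProbabilityMeasure ρ] (hσ : ∀ᵐ z ∂σ, 0 ≤ z)
    (hρ : ∀ᵐ z ∂ρ, 0 ≤ z) : ∀ᵐ z ∂(σ ∗ₘ ρ), 0 ≤ z := by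
  refine (ae_map_iff (measurable_fst.mul measurable_snd).aemeasurable measurableSet_Ici).2 ?_
  filter_upwards [ae_prod_nonneg hσ hρ] with q hq
  exact mul_nonneg hq.1 hq.2

lemma ae_powLaw_nonneg [IsProbabilityMeasure ρ] (hρ : ∀ᵐ z ∂ρ, 0 ≤ z) (q : ℕ) :
    ∀ᵐ z ∂powLaw ρ q, 0 ≤ z := by
  induction q with
  | zero => exact (ae_dirac_iff measurableSet_Ici).2 zero_le_one
  | succ q ih => exact ae_mconv_nonneg ih hρ

lemma integral_mconv_rpow [IsProbabilityMeasure σ] [IsProbabilityMeasure ρ]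
    (hσ : ∀ᵐ z ∂σ, 0 ≤ z) (hρ : ∀ᵐ z ∂ρ, 0 ≤ z) (s : ℝ) :
    ∫ z, z ^ s ∂(σ ∗ₘ ρ) = (∫ z, z ^ s ∂σ) * ∫ z, z ^ s ∂ρ := by
  have hm : Measurable fun q : ℝ × ℝ => q.1 * q.2 := measurable_fst.mul measurable_snd
  rw [Measure.mconv, integral_map hm.aemeasurable (by fun_prop), ← integral_prod_mul]
  refine integral_congr_ae ?_
  filter_upwards [ae_prod_nonneg hσ hρ] with q hq
  exact Real.mul_rpow hq.1 hq.2

lemma integrable_mconv_rpow [IsProbabilityMeasure σ] [IsProbabilityMeasure ρ]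
    (hσ : ∀ᵐ z ∂σ, 0 ≤ z) (hρ : ∀ᵐ z ∂ρ, 0 ≤ z) {s : ℝ} (h1 : Integrable (fun z => z ^ s) σ)
    (h2 : Integrable (fun z => z ^ s) ρ) : Integrable (fun z => z ^ s) (σ ∗ₘ ρ) := by
  have hm : Measurable fun q : ℝ × ℝ => q.1 * q.2 := measurable_fst.mul measurable_snd
  rw [Measure.mconv, integrable_map_measure (by fun_prop) hm.aemeasurable]
  refine (h1.mul_prod h2).congr ?_
  filter_upwards [ae_prod_nonneg hσ hρ] with q hq
  exact (Real.mul_rpow hq.1 hq.2).symm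

lemma integrable_powLaw_rpow [IsProbabilityMeasure ρ] (hρ : ∀ᵐ z ∂ρ, 0 ≤ z) {s : ℝ}
    (h : Integrable (fun z => z ^ s) ρ) (q : ℕ) : Integrable (fun z => z ^ s) (powLaw ρ q) := by
  induction q with
  | zero => exact integrable_dirac (by simp)
  | succ q ih => exact integrable_mconv_rpow (ae_powLaw_nonneg hρ q) hρ ih h

lemma integral_powLaw_rpow [IsProbabilityMeasure ρ] (hρ : ∀ᵐ z ∂ρ, 0 ≤ z) (s : ℝ) (q : ℕ) :
    ∫ z, z ^ s ∂(powLaw ρ q) = (∫ z, z ^ s ∂ρ) ^ q := by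
  induction q with
  | zero => simp [powLaw]
  | succ q ih => rw [powLaw, integral_mconv_rpow (ae_powLaw_nonneg hρ q) hρ, ih, pow_succ]

/-- Tails of products of convolution equivalent variables. -/
lemma RVTail.tendsto_tail_powLaw [IsProbabilityMeasure ρ] (h : RVTail ρ α)
    (hρ : ∀ᵐ z ∂ρ, 1 ≤ z) {c : ℝ}
    (hc : Tendsto (fun x => prodTail ρ ρ x / tail ρ x) atTop (𝓝 c)) (q : ℕ) :
    Tendsto (fun x => tail (powLaw ρ q) x / tail ρ x) atTop
      (𝓝 (q * (∫ z, z ^ α ∂ρ) ^ (q - 1))) := by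
  have hρ0 : ∀ᵐ z ∂ρ, 0 ≤ z := hρ.mono fun z hz => zero_le_one.trans hz
  have hi := h.integrable_rpow_of_prodTail hρ0 hc
  have hceq := h.prodTail_constant_eq hρ hc
  set m := ∫ z, z ^ α ∂ρ with hm
  induction q with
  | zero =>
    simp only [CharP.cast_eq_zero, zero_mul]
    refine tendsto_const_nhds.congr' ?_
    filter_upwards [eventually_ge_atTop 1] with x hx
    have : tail (powLaw ρ 0) x = 0 := by
      rw [powLaw, tail, measureReal_def, Measure.dirac_apply' _ measurableSet_Ioi]
      simp [not_lt.2 hx]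
    rw [this, zero_div]
  | succ q ih =>
    obtain ⟨D, hD, HD⟩ := h.exists_tail_le ih
    set σ := powLaw ρ q with hσ
    set k := (q : ℝ) * m ^ (q - 1) with hk
    have hσ0 : ∀ᵐ z ∂σ, 0 ≤ z := ae_powLaw_nonneg hρ0 q
    -- The two terms stand for the last factor being large and for one of the first q being large.
    -- The case q = 0 is separate because `q - 1` is truncated subtraction.
    have hconst : ((q + 1 : ℕ) : ℝ) * m ^ (q + 1 - 1) = 1 * m ^ q + k * m := by
      rcases q with _ | q
      · simp [hk]
      · simp only [hk, Nat.add_sub_cancel]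
        push_cast
        ring
    rw [hconst]
    simp_rw [powLaw, tail_mconv]
    have hσm : ∫ z, z ^ α ∂σ = m ^ q := integral_powLaw_rpow hρ0 α q
    have hσi : Integrable (fun z => z ^ α) σ := integrable_powLaw_rpow hρ0 hi q
    -- The error is the joint tail of the q-fold product and one more factor; by the tail comparison
    -- `HD` it is at most `D` times the joint tail of two single factors, which vanishes as M grows.
    refine tendsto_of_approx
      (A := fun M x => prodTail (σ.restrict (Iic M)) ρ x / tail ρ x +
        prodTail (ρ.restrict (Iic M)) σ x / tail ρ x)
      (E := fun M x => D * (jointTail ρ ρ M x / tail ρ x))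
      (fun M => (h.tendsto_prodTail_restrict h.tendsto_self hσ0 M).add
        (h.tendsto_prodTail_restrict ih hρ0 M)) ?_
      (fun M => (h.tendsto_jointTail hρ0 hc M).const_mul D) ?_ ?_
    · rw [← hσm]
      exact ((tendsto_setIntegral_Iic_nat hσi).const_mul 1).add
        ((tendsto_setIntegral_Iic_nat hi).const_mul k)
    · have := ((tendsto_setIntegral_Iic_nat hi).const_mul 2).const_sub c |>.const_mul D
      rwa [hceq, sub_self, mul_zero, ← hceq] at this
    · intro M
      filter_upwards [eventually_ge_atTop ((M : ℝ) * M)] with x hx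
      rw [prodTail_eq_add hσ0 hρ0 hx, add_div, add_div, add_sub_cancel_left,
        abs_of_nonneg (div_nonneg (jointTail_nonneg _ _ _ _) (tail_nonneg _ _)), ← mul_div_assoc]
      exact div_le_div_of_nonneg_right (jointTail_le_of_tail_le HD (Nat.cast_nonneg M))
        (tail_nonneg _ _)

end ConvolutionEquivalence

section Laws

variable {ρ σ : Measure ℝ} {α : ℝ}

/-! ### Passing to `max Y 1` -/

lemma measurable_max_one : Measurable fun y : ℝ => max y 1 := measurable_id.max measurable_const

lemma isProbabilityMeasure_map_max_one [IsProbabilityMeasure ρ] :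
    IsProbabilityMeasure (ρ.map fun y => max y 1) :=
  Measure.isProbabilityMeasure_map measurable_max_one.aemeasurable

lemma ae_map_max_one : ∀ᵐ z ∂(ρ.map fun y => max y 1), 1 ≤ z :=
  (ae_map_iff measurable_max_one.aemeasurable measurableSet_Ici).2
    (Eventually.of_forall fun _ => le_max_right _ _)

lemma tail_map_max_one {x : ℝ} (hx : 1 ≤ x) : tail (ρ.map fun y => max y 1) x = tail ρ x := by
  unfold tail
  rw [map_measureReal_apply measurable_max_one measurableSet_Ioi]
  refine congrArg ρ.real (Set.ext fun u => ?_)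
  simp [not_lt.2 hx]

lemma RVTail.map_max_one [IsProbabilityMeasure ρ] (h : RVTail ρ α) :
    RVTail (ρ.map fun y => max y 1) α := by
  have : IsProbabilityMeasure (ρ.map fun y => max y 1) := isProbabilityMeasure_map_max_one
  refine ⟨h.index_pos, fun x => ?_, fun l hl => ?_⟩
  · refine (h.tail_pos (max x 1)).trans_le ?_
    rw [← tail_map_max_one (le_max_right x 1)]
    exact tail_antitone _ (le_max_left _ _)
  · refine (h.tendsto_ratio l hl).congr' ?_
    filter_upwards [eventually_ge_atTop 1, eventually_ge_atTop l⁻¹] with x hx hx'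
    have : 1 ≤ l * x := by
      rwa [inv_le_iff_one_le_mul₀' hl] at hx'
    rw [tail_map_max_one hx, tail_map_max_one this]

lemma measurableSet_joint (M x : ℝ) :
    MeasurableSet {q : ℝ × ℝ | x < q.1 * q.2 ∧ M < q.1 ∧ M < q.2} :=
  (measurableSet_lt_mul x).inter ((measurableSet_lt measurable_const measurable_fst).inter
    (measurableSet_lt measurable_const measurable_snd))

lemma jointTail_map_max_one [IsProbabilityMeasure ρ] (x : ℝ) :
    jointTail (ρ.map fun y => max y 1) (ρ.map fun y => max y 1) 1 x = jointTail ρ ρ 1 x := by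
  unfold jointTail
  rw [Measure.map_prod_map _ _ measurable_max_one measurable_max_one,
    map_measureReal_apply (measurable_max_one.prodMap measurable_max_one) (measurableSet_joint 1 x)]
  refine congrArg (ρ.prod ρ).real (Set.ext fun q => ?_)
  simp only [mem_preimage, Prod.map, mem_ofPred_eq, lt_max_iff, lt_irrefl, or_false]
  refine and_congr_left fun hq => ?_
  rw [max_eq_left hq.1.le, max_eq_left hq.2.le]

/-- Replacing y by max(y, 1) does not affect the event that both factors exceed 1, and the pieces
truncated at M = 1 converge by Breiman's lemma. The constant may change; only its existence is
needed. -/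
lemma RVTail.tendsto_prodTail_map_max_one [IsProbabilityMeasure ρ] (h : RVTail ρ α)
    (hρ : ∀ᵐ z ∂ρ, 0 ≤ z) {c : ℝ}
    (hc : Tendsto (fun x => prodTail ρ ρ x / tail ρ x) atTop (𝓝 c)) :
    ∃ c', Tendsto (fun x => prodTail (ρ.map fun y => max y 1) (ρ.map fun y => max y 1) x /
      tail (ρ.map fun y => max y 1) x) atTop (𝓝 c') := by
  have hp : IsProbabilityMeasure (ρ.map fun y => max y 1) := isProbabilityMeasure_map_max_one
  have hz : ∀ᵐ z ∂(ρ.map fun y => max y 1), 0 ≤ z := ae_map_max_one.mono fun z hz =>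
    zero_le_one.trans hz
  have h1 := h.tendsto_jointTail hρ hc 1
  have h2 := h.map_max_one.tendsto_prodTail_restrict h.map_max_one.tendsto_self hz 1
  refine ⟨_, ((h2.const_mul 2).add h1).congr' ?_⟩
  filter_upwards [eventually_ge_atTop 1] with x hx
  rw [prodTail_eq_add hz hz (M := 1) (by linarith), jointTail_map_max_one, tail_map_max_one hx]
  ring

/-! ### Products of variables with infinite moment of order `α` -/

/-- Truncating the ρ-factor at M, Breiman's lemma bounds the ratio from below by the truncated
moment of order α of ρ, and these moments are unbounded in M. -/
lemma RVTail.tendsto_prodTail_div_atTop [IsProbabilityMeasure ρ] [IsProbabilityMeasure σ]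
    (h : RVTail σ α) (hσ : ∀ᵐ z ∂σ, 0 ≤ z) (hρ : ∀ᵐ z ∂ρ, 0 ≤ z)
    (hi : ¬ Integrable (fun z => z ^ α) ρ) :
    Tendsto (fun x => prodTail σ ρ x / tail σ x) atTop atTop := by
  have hα := h.index_pos
  rw [tendsto_atTop]
  intro B
  obtain ⟨M, hM⟩ : ∃ M : ℕ, B < ∫ z in Iic (M : ℝ), z ^ α ∂ρ := by
    by_contra! hcon
    refine hi ((aecover_Iic (μ := ρ)
      (tendsto_natCast_atTop_atTop (R := ℝ))).integrable_of_integral_norm_bounded B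
        (fun M => ?_) (Eventually.of_forall fun M => ?_))
    · refine (integrable_max_rpow_restrict_Iic ρ hα.le M).mono' (by fun_prop) ?_
      filter_upwards [ae_restrict_of_ae hρ] with z hz
      rw [Real.norm_of_nonneg (by positivity)]
      exact Real.rpow_le_rpow hz (le_max_right _ _) hα.le
    · refine le_trans (le_of_eq ?_) (hcon M)
      refine integral_congr_ae ?_
      filter_upwards [ae_restrict_of_ae hρ] with z hz
      exact Real.norm_of_nonneg (by positivity)
  have h1 := h.tendsto_prodTail_restrict h.tendsto_self hρ M
  rw [one_mul] at h1
  filter_upwards [h1.eventually (lt_mem_nhds hM), eventually_ge_atTop ((M : ℝ) * M)] with x hx hxM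
  refine hx.le.trans (div_le_div_of_nonneg_right ?_ (tail_nonneg _ _))
  rw [prodTail_eq_add hσ hρ hxM]
  have h2 := jointTail_nonneg σ ρ M x
  have h3 := prodTail_nonneg (σ.restrict (Iic (M : ℝ))) ρ x
  linarith

lemma RVTail.tail_mconv_pos [IsProbabilityMeasure ρ] [IsProbabilityMeasure σ]
    (h : RVTail σ α) (h' : RVTail ρ α) (x : ℝ) : 0 < tail (σ ∗ₘ ρ) x := by
  rw [tail_mconv]
  set s := max x 1
  have h1 : (σ.prod ρ).real (Ioi s ×ˢ Ioi s) = tail σ s * tail ρ s := measureReal_prod_prod _ _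
  refine (mul_pos (h.tail_pos s) (h'.tail_pos s)).trans_le ?_
  rw [← h1]
  refine measureReal_mono fun q hq => ?_
  have hs : 1 ≤ s := le_max_right _ _
  have hxs : x ≤ s := le_max_left _ _
  have q1 : s < q.1 := hq.1
  have q2 : s < q.2 := hq.2
  have : x < q.1 * q.2 := by nlinarith
  exact this

/-- Condition on the factor u with law σ. As long as u ≤ x / v, the tail of ρ is evaluated at x / u
≥ v, where its ratio at l is close to the limit. The remaining u have probability of the order of
the tail of σ at x, which is negligible by `hr`. -/
lemma RVTail.mconv [IsProbabilityMeasure ρ] [IsProbabilityMeasure σ]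
    (h : RVTail σ α) (h' : RVTail ρ α) (hσ : ∀ᵐ z ∂σ, 0 ≤ z)
    (hr : Tendsto (fun x => tail σ x / prodTail σ ρ x) atTop (𝓝 0)) :
    RVTail (σ ∗ₘ ρ) α := by
  refine ⟨h.index_pos, h.tail_mconv_pos h', fun l hl => ?_⟩
  simp_rw [tail_mconv]
  have hpos : ∀ x, 0 < prodTail σ ρ x := fun x => by
    rw [← tail_mconv]; exact h.tail_mconv_pos h' x
  have hv : ∀ M : ℕ, ∃ v > 0, ∀ w ≥ v,
      |tail ρ (l * w) - l ^ (-α) * tail ρ w| ≤ 1 / ((M : ℝ) + 1) * tail ρ w := by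
    intro M
    obtain ⟨v, hv⟩ := eventually_atTop.1 ((Metric.tendsto_nhds.1 (h'.tendsto_ratio l hl))
      (1 / ((M : ℝ) + 1)) (by positivity))
    refine ⟨max v 1, by positivity, fun w hw => ?_⟩
    have h1 := hv w ((le_max_left _ _).trans hw)
    have h2 := h'.tail_pos w
    rw [Real.dist_eq, div_sub' h2.ne', abs_div, abs_of_pos h2, div_lt_iff₀ h2] at h1
    rw [mul_comm (l ^ (-α))]
    exact h1.le
  choose v hv0 hv using hv
  refine tendsto_of_approx (A := fun _ _ => l ^ (-α)) (a := fun _ => l ^ (-α))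
    (E := fun M x => 1 / ((M : ℝ) + 1) + (1 + l ^ (-α)) *
      ((tail σ ((v M)⁻¹ * x) / tail σ x) * (tail σ x / prodTail σ ρ x)))
    (e := fun M => 1 / ((M : ℝ) + 1) + (1 + l ^ (-α)) * ((v M)⁻¹ ^ (-α) * 0))
    (fun _ => tendsto_const_nhds) tendsto_const_nhds
    (fun M => tendsto_const_nhds.add
      (((h.tendsto_ratio _ (inv_pos.2 (hv0 M))).mul hr).const_mul _)) ?_ ?_
  · simp only [mul_zero, add_zero]
    exact tendsto_one_div_add_atTop_nhds_zero_nat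
  intro M
  filter_upwards [eventually_ge_atTop 0] with x hx
  have hl0 : 0 ≤ l ^ (-α) := by positivity
  have hle1 : ∀ u y, scaledTail ρ u y ≤ 1 := fun u y => measureReal_le_one
  have key : ∀ᵐ u ∂σ, |scaledTail ρ u (l * x) - l ^ (-α) * scaledTail ρ u x| ≤
      1 / ((M : ℝ) + 1) * scaledTail ρ u x +
        (Ioi ((v M)⁻¹ * x)).indicator (fun _ => 1 + l ^ (-α)) u := by
    filter_upwards [hσ] with u hu
    by_cases hux : (v M)⁻¹ * x < u
    · rw [indicator_of_mem (show u ∈ Ioi ((v M)⁻¹ * x) from hux)]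
      have a1 := hle1 u (l * x)
      have a2 := hle1 u x
      have a3 := scaledTail_nonneg ρ u (l * x)
      have a4 := scaledTail_nonneg ρ u x
      have a5 : 0 ≤ 1 / ((M : ℝ) + 1) * scaledTail ρ u x := by positivity
      have a6 := mul_le_of_le_one_right hl0 a2
      have a7 := mul_nonneg hl0 a4
      rw [abs_le]; constructor <;> linarith
    · rw [indicator_of_notMem (show u ∉ Ioi ((v M)⁻¹ * x) from hux), add_zero]
      rcases hu.eq_or_lt with rfl | hu0
      · rw [scaledTail_zero _ (by positivity), scaledTail_zero _ hx]; simp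
      · rw [scaledTail_of_pos _ hu0, scaledTail_of_pos _ hu0, mul_div_assoc]
        refine hv M _ ?_
        rw [ge_iff_le, le_div_iff₀ hu0]
        have := not_lt.1 hux
        rwa [le_inv_mul_iff₀ (hv0 M)] at this
  have hint : ∀ y, Integrable (fun u => scaledTail ρ u y) σ := fun y =>
    Integrable.of_bound (measurable_scaledTail ρ y).aestronglyMeasurable 1
      (Eventually.of_forall fun u => by
        rw [Real.norm_of_nonneg (scaledTail_nonneg _ _ _)]; exact hle1 u y)
  have hI : |prodTail σ ρ (l * x) - l ^ (-α) * prodTail σ ρ x| ≤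
      1 / ((M : ℝ) + 1) * prodTail σ ρ x + (1 + l ^ (-α)) * tail σ ((v M)⁻¹ * x) := by
    rw [prodTail_eq_integral, prodTail_eq_integral, ← integral_const_mul,
      ← integral_sub (hint _) ((hint _).const_mul _)]
    refine (abs_integral_le_integral_abs).trans ((integral_mono_ae
      (((hint _).sub ((hint _).const_mul _)).abs)
      (((hint x).const_mul _).add ((integrable_const _).indicator measurableSet_Ioi)) key).trans
        (le_of_eq ?_))
    rw [integral_add' ((hint x).const_mul _) ((integrable_const _).indicator measurableSet_Ioi),
      integral_const_mul, integral_indicator_const _ measurableSet_Ioi, smul_eq_mul,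
      mul_comm (1 + l ^ (-α))]
    rfl
  have p := hpos x
  have q := h.tail_pos x
  rw [div_sub' p.ne', abs_div, abs_of_pos p, div_le_iff₀ p, mul_comm (prodTail σ ρ x) (l ^ (-α))]
  refine hI.trans (le_of_eq ?_)
  field_simp

lemma powLaw_one [IsProbabilityMeasure ρ] : powLaw ρ 1 = ρ := Measure.dirac_one_mconv ρ

/-- The two claims share one induction: regular variation of a power makes the ratio of consecutive
tails vanish, and this in turn gives regular variation of the next power. -/
lemma RVTail.powLaw_aux [IsProbabilityMeasure ρ] (h : RVTail ρ α) (hρ : ∀ᵐ z ∂ρ, 0 ≤ z)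
    (hi : ¬ Integrable (fun z => z ^ α) ρ) (q : ℕ) : RVTail (powLaw ρ (q + 1)) α ∧
    Tendsto (fun x => tail (powLaw ρ q) x / tail (powLaw ρ (q + 1)) x) atTop (𝓝 0) := by
  induction q with
  | zero =>
    refine ⟨by rw [zero_add, powLaw_one]; exact h, tendsto_const_nhds.congr' ?_⟩
    filter_upwards [eventually_ge_atTop 1] with x hx
    have : tail (powLaw ρ 0) x = 0 := by
      rw [powLaw, tail, measureReal_def, Measure.dirac_apply' _ measurableSet_Ioi]
      simp [not_lt.2 hx]
    rw [this, zero_div]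
  | succ q ih =>
    have h1 := ih.1.tendsto_prodTail_div_atTop (ae_powLaw_nonneg hρ _) hρ hi
    have h2 : Tendsto (fun x => tail (powLaw ρ (q + 1)) x / prodTail (powLaw ρ (q + 1)) ρ x)
        atTop (𝓝 0) := h1.inv_tendsto_atTop.congr fun x => inv_div _ _
    refine ⟨ih.1.mconv h (ae_powLaw_nonneg hρ _) h2, ?_⟩
    refine h2.congr fun x => ?_
    rw [← tail_mconv]
    rfl

lemma RVTail.powLaw [IsProbabilityMeasure ρ] (h : RVTail ρ α) (hρ : ∀ᵐ z ∂ρ, 0 ≤ z)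
    (hi : ¬ Integrable (fun z => z ^ α) ρ) {q : ℕ} (hq : q ≠ 0) : RVTail (powLaw ρ q) α := by
  obtain ⟨q, rfl⟩ := Nat.exists_eq_succ_of_ne_zero hq
  exact (h.powLaw_aux hρ hi q).1

lemma RVTail.tail_powLaw_isLittle [IsProbabilityMeasure ρ] (h : RVTail ρ α) (hρ : ∀ᵐ z ∂ρ, 0 ≤ z)
    (hi : ¬ Integrable (fun z => z ^ α) ρ) {r q : ℕ} (hrq : r < q) :
    Tendsto (fun x => tail (_root_.powLaw ρ r) x / tail (_root_.powLaw ρ q) x) atTop (𝓝 0) := by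
  induction q with
  | zero => omega
  | succ q ih =>
    have h1 := (h.powLaw_aux hρ hi q).2
    rcases (Nat.lt_succ_iff.1 hrq).eq_or_lt with rfl | hlt
    · exact h1
    have h2 := (ih hlt).mul h1
    rw [mul_zero] at h2
    have hpos := (h.powLaw hρ hi (show q ≠ 0 by omega)).tail_pos
    refine h2.congr fun x => ?_
    rw [div_mul_div_cancel₀ (hpos x).ne']

/-! ### Moments of order below the index -/

/-- The upper counterpart of Potter's bound: doubling the argument eventually gains a factor 2^(-s),
as s < α. The constant (2 x₀)^s absorbs the rounding to dyadic points and the range x ≤ x₀. -/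
lemma RVTail.exists_tail_le_rpow [IsProbabilityMeasure ρ] (h : RVTail ρ α) {s : ℝ} (hs0 : 0 ≤ s)
    (hs : s < α) : ∃ C > 0, ∀ x ≥ 1, tail ρ x ≤ C * x ^ (-s) := by
  have h2 : (2 : ℝ) ^ (-α) < 2 ^ (-s) := Real.rpow_lt_rpow_of_exponent_lt (by norm_num) (by linarith)
  obtain ⟨x₁, hx₁⟩ := eventually_atTop.1
    ((h.tendsto_ratio 2 two_pos).eventually (gt_mem_nhds h2))
  set x₀ := max x₁ 1
  have hx₀ : 1 ≤ x₀ := le_max_right _ _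
  have hx0 : 0 < x₀ := by linarith
  have hk : ∀ k : ℕ, tail ρ (2 ^ k * x₀) ≤ ((2 : ℝ) ^ k) ^ (-s) := by
    intro k
    induction k with
    | zero => simpa using tail_le_one ρ x₀
    | succ k ih =>
      have h1 : x₀ ≤ 2 ^ k * x₀ := le_mul_of_one_le_left hx0.le (one_le_pow₀ (by norm_num))
      have h3 := (hx₁ (2 ^ k * x₀) ((le_max_left _ _).trans h1)).le
      rw [div_le_iff₀ (h.tail_pos _)] at h3
      calc tail ρ (2 ^ (k + 1) * x₀) = tail ρ (2 * (2 ^ k * x₀)) := by ring_nf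
        _ ≤ 2 ^ (-s) * tail ρ (2 ^ k * x₀) := h3
        _ ≤ 2 ^ (-s) * ((2 : ℝ) ^ k) ^ (-s) := by gcongr
        _ = _ := by rw [← Real.mul_rpow (by norm_num) (by positivity), pow_succ']
  refine ⟨(2 * x₀) ^ s, by positivity, fun x hx => ?_⟩
  have hxp : 0 < x := by linarith
  have e : (2 * x₀) ^ s * x ^ (-s) = (x / (2 * x₀)) ^ (-s) := by
    rw [Real.div_rpow hxp.le (by positivity), Real.rpow_neg (by positivity : 0 ≤ 2 * x₀)]
    field_simp
  rw [e]
  rcases le_total x₀ x with hxx | hxx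
  · obtain ⟨k, hk1, hk2⟩ := exists_nat_pow_near ((one_le_div hx0).2 hxx) (one_lt_two : (1 : ℝ) < 2)
    rw [le_div_iff₀ hx0] at hk1
    refine (tail_antitone ρ hk1).trans ((hk k).trans ?_)
    refine Real.rpow_le_rpow_of_nonpos (by positivity) ?_ (by linarith)
    rw [pow_succ, div_lt_iff₀ hx0] at hk2
    rw [div_le_iff₀ (by positivity)]
    linarith
  · refine (tail_le_one _ _).trans (Real.one_le_rpow_of_pos_of_le_one_of_nonpos (by positivity) ?_
      (by linarith))
    rw [div_le_one (by positivity)]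
    linarith

/-- Moments of order below the index are finite. -/
lemma RVTail.integrable_rpow_of_lt [IsProbabilityMeasure ρ] (h : RVTail ρ α)
    {s : ℝ} (hs0 : 0 ≤ s) (hs : s < α) : Integrable (fun z => max 1 z ^ s) ρ := by
  rcases hs0.eq_or_lt with rfl | hspos
  · simp
  obtain ⟨γ, hsγ, hγα⟩ := exists_between hs
  obtain ⟨C, hC, H⟩ := h.exists_tail_le_rpow (hspos.trans hsγ).le hγα
  refine ⟨by fun_prop, ?_⟩
  rw [hasFiniteIntegral_iff_ofReal (Eventually.of_forall fun z => by positivity),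
    lintegral_rpow_eq_lintegral_meas_lt_mul ρ (Eventually.of_forall fun z => by positivity)
      (by fun_prop) hspos]
  refine ENNReal.mul_lt_top ENNReal.ofReal_lt_top ?_
  rw [← Ioc_union_Ioi_eq_Ioi (zero_le_one' ℝ)]
  refine (lintegral_union_le _ _ _).trans_lt (ENNReal.add_lt_top.2 ⟨?_, ?_⟩)
  · have h1 : IntegrableOn (fun t : ℝ => t ^ (s - 1)) (Ioc 0 1) :=
      (intervalIntegrable_iff_integrableOn_Ioc_of_le zero_le_one).1
        (intervalIntegral.intervalIntegrable_rpow' (by linarith))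
    refine lt_of_le_of_lt ?_ h1.lintegral_lt_top
    refine lintegral_mono fun t => ?_
    exact mul_le_of_le_one_left bot_le prob_le_one
  · have h1 : IntegrableOn (fun t : ℝ => C * t ^ (-γ + (s - 1))) (Ioi 1) :=
      (integrableOn_Ioi_rpow_of_lt (by linarith) one_pos).const_mul C
    refine lt_of_le_of_lt (setLIntegral_mono' measurableSet_Ioi fun t ht => ?_) h1.lintegral_lt_top
    have ht1 : (1 : ℝ) < t := ht
    have ht0 : 0 < t := by linarith
    have h2 : ρ {a | t < max 1 a} = ENNReal.ofReal (tail ρ t) := by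
      rw [tail, measureReal_def, ENNReal.ofReal_toReal (measure_ne_top _ _)]
      refine congrArg ρ (Set.ext fun a => ?_)
      simp [not_lt.2 ht1.le]
    rw [h2, ← ENNReal.ofReal_mul (tail_nonneg _ _)]
    refine ENNReal.ofReal_le_ofReal ?_
    rw [Real.rpow_add ht0, ← mul_assoc]
    have := H t ht1.le
    gcongr

end Laws

/-! ### Test functions and the vector form of Breiman's lemma -/

section Vector

/-- Test functions for vague convergence of nonnegative vectors away from the origin: bounded,
continuous, vanishing near the origin, and stable when small coordinates are set to zero. -/
structure IsTest {n : ℕ} (φ : (Fin n → ℝ) → ℝ) : Prop where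
  continuous : Continuous φ
  bounded : ∃ K, ∀ v, |φ v| ≤ K
  vanish : ∃ ε > 0, ∀ v, (∀ i, 0 ≤ v i ∧ v i ≤ ε) → φ v = 0
  modulus : ∀ δ > 0, ∃ η > 0, ∀ u v,
    (∀ i, 0 ≤ v i ∧ (u i = v i ∨ (u i = 0 ∧ v i ≤ η))) → |φ u - φ v| ≤ δ

variable {Ω : Type*} [MeasurableSpace Ω] {P : Measure Ω} {n : ℕ} {α β : ℝ}

/-- The map `(ω, z) ↦ z W(ω)`. -/
def scaleVec (W : Ω → Fin n → ℝ) (q : Ω × ℝ) : Fin n → ℝ := fun i => q.2 * W q.1 i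

lemma measurable_scaleVec {W : Ω → Fin n → ℝ} (hW : Measurable W) : Measurable (scaleVec W) :=
  measurable_pi_lambda _ fun i =>
    measurable_snd.mul ((measurable_pi_apply i).comp (hW.comp measurable_fst))

lemma powerMeasure_lt_mul (hα : 0 < α) {r w : ℝ} (hr : 0 < r) (hw : 0 ≤ w) :
    powerMeasure α {z | r < z * w} = ENNReal.ofReal ((w / r) ^ α) := by
  rcases hw.eq_or_lt with rfl | hw0
  · simp [not_lt.2 hr.le, Real.zero_rpow hα.ne']
  · have : {z | r < z * w} = Ioi (r / w) := by
      ext z; simp [div_lt_iff₀ hw0]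
    rw [this, powerMeasure_Ioi hα (by positivity), Real.rpow_neg (by positivity),
      ← Real.inv_rpow (by positivity), inv_div]

lemma prod_powerMeasure_lt_mul [IsProbabilityMeasure P] (hα : 0 < α) {r : ℝ} (hr : 0 < r)
    {f : Ω → ℝ} (hf : Measurable f) (hf0 : ∀ ω, 0 ≤ f ω) :
    (P.prod (powerMeasure α)) {q | r < q.2 * f q.1} = ∫⁻ ω, ENNReal.ofReal ((f ω / r) ^ α) ∂P := by
  have hs : MeasurableSet {q : Ω × ℝ | r < q.2 * f q.1} :=
    measurableSet_lt measurable_const (measurable_snd.mul (hf.comp measurable_fst))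
  rw [Measure.prod_apply hs]
  exact lintegral_congr fun ω => powerMeasure_lt_mul hα hr (hf0 ω)

lemma prod_powerMeasure_real_lt_mul [IsProbabilityMeasure P] (hα : 0 < α) {r : ℝ} (hr : 0 < r)
    {f : Ω → ℝ} (hf : Measurable f) (hf0 : ∀ ω, 0 ≤ f ω) (hi : Integrable (fun ω => f ω ^ α) P) :
    (P.prod (powerMeasure α)) {q | r < q.2 * f q.1} ≠ ∞ ∧
    (P.prod (powerMeasure α)).real {q | r < q.2 * f q.1} = r ^ (-α) * ∫ ω, f ω ^ α ∂P := by
  have h1 : ∫⁻ ω, ENNReal.ofReal ((f ω / r) ^ α) ∂P =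
      ENNReal.ofReal (r ^ (-α) * ∫ ω, f ω ^ α ∂P) := by
    rw [← integral_const_mul, ofReal_integral_eq_lintegral_ofReal (hi.const_mul _)
      (Eventually.of_forall fun ω => by have := hf0 ω; positivity)]
    refine lintegral_congr fun ω => ?_
    rw [Real.div_rpow (hf0 ω) hr.le, Real.rpow_neg hr.le, div_eq_inv_mul]
  have h2 : 0 ≤ ∫ ω, f ω ^ α ∂P := integral_nonneg fun ω => Real.rpow_nonneg (hf0 ω) _
  rw [measureReal_def, prod_powerMeasure_lt_mul hα hr hf hf0, h1,
    ENNReal.toReal_ofReal (by positivity)]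
  exact ⟨ENNReal.ofReal_ne_top, rfl⟩

lemma ae_prod_powerMeasure_pos [IsProbabilityMeasure P] (α : ℝ) :
    ∀ᵐ q ∂(P.prod (powerMeasure α)), 0 < q.2 :=
  Measure.quasiMeasurePreserving_snd.ae (ae_powerMeasure_pos α)

/-- The function is bounded and vanishes unless some z W_i exceeds ε, an event of finite mass ε^(-α)
E W_i^α although ν itself is infinite. -/
lemma IsTest.integrable [IsProbabilityMeasure P] {φ : (Fin n → ℝ) → ℝ} (hφ : IsTest φ)
    (hα : 0 < α) {W : Ω → Fin n → ℝ} (hW : Measurable W) (hW0 : ∀ ω i, 0 ≤ W ω i)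
    (hi : ∀ i, Integrable (fun ω => W ω i ^ α) P) :
    Integrable (fun q => φ (scaleVec W q)) (P.prod (powerMeasure α)) := by
  obtain ⟨K, hK⟩ := hφ.bounded
  obtain ⟨ε, hε, hv⟩ := hφ.vanish
  have hWi : ∀ i, Measurable fun ω => W ω i := fun i => (measurable_pi_apply i).comp hW
  have hms : ∀ i, MeasurableSet {q : Ω × ℝ | ε < q.2 * W q.1 i} := fun i =>
    measurableSet_lt measurable_const (measurable_snd.mul ((hWi i).comp measurable_fst))
  refine Integrable.mono' (g := fun q => ∑ i : Fin n,
    {q : Ω × ℝ | ε < q.2 * W q.1 i}.indicator (fun _ => K) q) ?_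
    (hφ.continuous.measurable.comp (measurable_scaleVec hW)).aestronglyMeasurable ?_
  · refine integrable_finsetSum _ fun i _ => ?_
    rw [integrable_indicator_iff (hms i)]
    exact integrableOn_const
      (prod_powerMeasure_real_lt_mul hα hε (hWi i) (fun ω => hW0 ω i) (hi i)).1
  · have hK0 : 0 ≤ K := (abs_nonneg _).trans (hK 0)
    filter_upwards [ae_prod_powerMeasure_pos α] with q hq
    by_cases h : ∃ i, ε < q.2 * W q.1 i
    · obtain ⟨i, hi⟩ := h
      refine (hK _).trans ?_
      refine le_trans (le_of_eq ?_) (Finset.single_le_sum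
        (fun j _ => indicator_nonneg (fun _ _ => hK0) _) (Finset.mem_univ i))
      rw [indicator_of_mem (show q ∈ {q : Ω × ℝ | ε < q.2 * W q.1 i} from hi)]
    · push Not at h
      rw [show φ (scaleVec W q) = 0 from hv _ fun i => ⟨mul_nonneg hq.le (hW0 _ i), h i⟩, norm_zero]
      exact Finset.sum_nonneg fun j _ => indicator_nonneg (fun _ _ => hK0) _

/-- The vector version of Breiman's lemma. -/
lemma IsTest.breiman [IsProbabilityMeasure P] {φ : (Fin n → ℝ) → ℝ} (hφ : IsTest φ)
    {T : Ω → ℝ} {W : Ω → Fin n → ℝ} (hT : Measurable T) (hW : Measurable W)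
    (hT0 : ∀ ω, 0 ≤ T ω) (hW0 : ∀ ω i, 0 ≤ W ω i) (hTW : IndepFun T W P)
    (h : RVTail (P.map T) α) (hβ : α < β) (hi : ∀ i, Integrable (fun ω => max 1 (W ω i) ^ β) P) :
    Tendsto (fun x => (∫ ω, φ (fun i => x⁻¹ * (T ω * W ω i)) ∂P) / tail (P.map T) x) atTop
      (𝓝 (∫ q, φ (scaleVec W q) ∂(P.prod (powerMeasure α)))) := by
  obtain ⟨K, hK⟩ := hφ.bounded
  obtain ⟨ε, hε, hv⟩ := hφ.vanish
  have hα := h.index_pos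
  have hK0 : 0 ≤ K := (abs_nonneg _).trans (hK 0)
  have hWi : ∀ i, Measurable fun ω => W ω i := fun i => (measurable_pi_apply i).comp hW
  set τ := P.map T with hτ
  have hτp : IsProbabilityMeasure τ := Measure.isProbabilityMeasure_map hT.aemeasurable
  have hτ0 : ∀ᵐ t ∂τ, 0 ≤ t := (ae_map_iff hT.aemeasurable measurableSet_Ici).2
    (Eventually.of_forall hT0)
  have hiα : ∀ i, Integrable (fun ω => W ω i ^ α) P := fun i => by
    refine (hi i).mono' ((hWi i).pow_const α).aestronglyMeasurable (Eventually.of_forall fun ω => ?_)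
    rw [Real.norm_of_nonneg (Real.rpow_nonneg (hW0 ω i) _)]
    exact (Real.rpow_le_rpow (hW0 ω i) (le_max_right _ _) hα.le).trans
      (Real.rpow_le_rpow_of_exponent_le (le_max_left _ _) hβ.le)
  rw [integral_prod _ (hφ.integrable hα hW hW0 hiα)]
  have hjm : ∀ x : ℝ, Measurable fun q : Ω × ℝ => φ (fun i => q.2 / x * W q.1 i) := fun x =>
    hφ.continuous.measurable.comp (measurable_pi_lambda _ fun i =>
      (measurable_snd.div_const x).mul ((hWi i).comp measurable_fst))
  have hEq : ∀ x : ℝ, ∫ ω, φ (fun i => x⁻¹ * (T ω * W ω i)) ∂P =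
      ∫ ω, ∫ t, φ (fun i => t / x * W ω i) ∂τ ∂P := by
    intro x
    have hjm' : Measurable fun q : (Fin n → ℝ) × ℝ => φ (fun i => q.2 / x * q.1 i) :=
      hφ.continuous.measurable.comp (measurable_pi_lambda _ fun i =>
        (measurable_snd.div_const x).mul ((measurable_pi_apply i).comp measurable_fst))
    have h1 : P.map (fun ω => (W ω, T ω)) = (P.map W).prod τ :=
      (indepFun_iff_map_prod_eq_prod_map_map hW.aemeasurable hT.aemeasurable).1 hTW.symm
    have hWp : IsProbabilityMeasure (P.map W) := Measure.isProbabilityMeasure_map hW.aemeasurable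
    calc ∫ ω, φ (fun i => x⁻¹ * (T ω * W ω i)) ∂P
        = ∫ q, φ (fun i => q.2 / x * q.1 i) ∂(P.map (fun ω => (W ω, T ω))) := by
          rw [integral_map (hW.prodMk hT).aemeasurable hjm'.aestronglyMeasurable]
          refine integral_congr_ae (Eventually.of_forall fun ω => ?_)
          simp only [div_eq_mul_inv]
          congr 1
          ext i
          ring
      _ = ∫ w, ∫ t, φ (fun i => t / x * w i) ∂τ ∂(P.map W) := by
          rw [h1, integral_prod]
          exact Integrable.of_bound hjm'.aestronglyMeasurable K (Eventually.of_forall fun q => hK _)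
      _ = _ := integral_map hW.aemeasurable
          (hjm'.stronglyMeasurable.integral_prod_right').aestronglyMeasurable
  have hdiv : ∀ x : ℝ, (∫ ω, φ (fun i => x⁻¹ * (T ω * W ω i)) ∂P) / tail τ x =
      ∫ ω, (∫ t, φ (fun i => t / x * W ω i) ∂τ) / tail τ x ∂P := fun x => by
    rw [hEq, integral_div]
  simp_rw [hdiv]
  obtain ⟨C, hC, H⟩ := h.eventually_scaledTail_le hβ h.tendsto_self
  have hmax : ∀ w : ℝ, 0 ≤ w → max 1 (w / ε) ^ β ≤ (max 1 ε⁻¹) ^ β * max 1 w ^ β := by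
    intro w hw
    rw [← Real.mul_rpow (by positivity) (by positivity)]
    refine Real.rpow_le_rpow (by positivity) (max_le ?_ ?_) (by linarith)
    · exact one_le_mul_of_one_le_of_one_le (le_max_left _ _) (le_max_left _ _)
    · rw [div_eq_inv_mul]
      exact mul_le_mul (le_max_right _ _) (le_max_right _ _) hw (by positivity)
  -- Domination: φ is nonzero only if some coordinate exceeds ε, and a union bound over coordinates
  -- reduces this to scaled tails controlled by Potter's bound. Pointwise in ω it is the
  -- one-dimensional vague convergence.
  refine tendsto_integral_filter_of_dominated_convergence
    (fun ω => ∑ i, K * (C * (max 1 ε⁻¹) ^ β) * max 1 (W ω i) ^ β) ?_ ?_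
    (integrable_finsetSum _ fun i _ => (hi i).const_mul _) ?_
  · exact Eventually.of_forall fun x =>
      ((hjm x).stronglyMeasurable.integral_prod_right'.measurable.div_const _).aestronglyMeasurable
  · filter_upwards [H, eventually_gt_atTop 0] with x hx hx0
    refine Eventually.of_forall fun ω => ?_
    have ht := h.tail_pos x
    rw [norm_div, Real.norm_of_nonneg ht.le, div_le_iff₀ ht]
    have hms : ∀ i, MeasurableSet {t : ℝ | x < W ω i / ε * t} := fun i =>
      measurableSet_lt measurable_const (measurable_const.mul measurable_id)
    have h1 : ∀ᵐ t ∂τ, ‖φ (fun i => t / x * W ω i)‖ ≤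
        ∑ i, {t : ℝ | x < W ω i / ε * t}.indicator (fun _ => K) t := by
      filter_upwards [hτ0] with t ht0
      by_cases hex : ∃ i, x < W ω i / ε * t
      · obtain ⟨i, hi⟩ := hex
        refine (hK _).trans (le_trans (le_of_eq ?_) (Finset.single_le_sum
          (fun j _ => indicator_nonneg (fun _ _ => hK0) _) (Finset.mem_univ i)))
        rw [indicator_of_mem (show t ∈ {t : ℝ | x < W ω i / ε * t} from hi)]
      · push Not at hex
        rw [hv _ fun i => ⟨mul_nonneg (div_nonneg ht0 hx0.le) (hW0 _ i), ?_⟩, norm_zero]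
        · exact Finset.sum_nonneg fun j _ => indicator_nonneg (fun _ _ => hK0) _
        · have := hex i
          rw [div_mul_eq_mul_div, div_le_iff₀ hε] at this
          rw [div_mul_eq_mul_div, div_le_iff₀ hx0]
          linarith
    calc ‖∫ t, φ (fun i => t / x * W ω i) ∂τ‖
        ≤ ∫ t, ∑ i, {t : ℝ | x < W ω i / ε * t}.indicator (fun _ => K) t ∂τ :=
          norm_integral_le_of_norm_le
            (integrable_finsetSum _ fun i _ => (integrable_const _).indicator (hms i)) h1
      _ = ∑ i, scaledTail τ (W ω i / ε) x * K := by
          rw [integral_finsetSum _ fun i _ => (integrable_const _).indicator (hms i)]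
          refine Finset.sum_congr rfl fun i _ => ?_
          rw [integral_indicator_const _ (hms i), smul_eq_mul]
          rfl
      _ ≤ ∑ i, K * (C * (max 1 ε⁻¹) ^ β) * max 1 (W ω i) ^ β * tail τ x := by
          refine Finset.sum_le_sum fun i _ => ?_
          have h2 := hx (W ω i / ε) (div_nonneg (hW0 ω i) hε.le)
          have h3 := hmax (W ω i) (hW0 ω i)
          calc scaledTail τ (W ω i / ε) x * K
              ≤ C * (max 1 ε⁻¹ ^ β * max 1 (W ω i) ^ β) * tail τ x * K := by
                gcongr
                exact h2.trans (by gcongr)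
            _ = _ := by ring
      _ = _ := by rw [Finset.sum_mul]
  · refine Eventually.of_forall fun ω => ?_
    have hcont : Continuous fun z : ℝ => φ (fun i => z * W ω i) :=
      hφ.continuous.comp (by fun_prop)
    -- For z ≤ ε / (1 + ∑ W) every coordinate z W_i is at most ε; the summand 1 keeps the threshold
    -- meaningful when W vanishes.
    have hS : 0 < 1 + ∑ i, W ω i := by
      have := Finset.sum_nonneg fun i (_ : i ∈ Finset.univ) => hW0 ω i
      linarith
    refine h.tendsto_integral hτ0 (g := fun z => φ (fun i => z * W ω i)) hcont
      (fun z => hK _) (div_pos hε hS) fun z hz hz' => hv _ fun i => ⟨mul_nonneg hz (hW0 _ i), ?_⟩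
    rw [le_div_iff₀ hS] at hz'
    have h1 : W ω i ≤ 1 + ∑ i, W ω i := by
      have := Finset.single_le_sum (fun i (_ : i ∈ Finset.univ) => hW0 ω i) (Finset.mem_univ i)
      linarith
    exact (mul_le_mul_of_nonneg_left h1 hz).trans hz'

/-! ### Norm tails -/

lemma Seminorm.exists_le_mul_norm (N : Seminorm ℝ (Fin n → ℝ)) : ∃ D > 0, ∀ v, N v ≤ D * ‖v‖ := by
  refine ⟨∑ i, N (Pi.single i 1) + 1, ?_, fun v => ?_⟩
  · have := Finset.sum_nonneg fun i (_ : i ∈ Finset.univ) => apply_nonneg N (Pi.single (M := fun _ : Fin n => ℝ) i 1)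
    linarith
  · have hv : v = ∑ i, v i • Pi.single (M := fun _ : Fin n => ℝ) i 1 := pi_eq_sum_univ' v
    have h1 : N v ≤ ∑ i, ‖v‖ * N (Pi.single i 1) := by
      conv_lhs => rw [hv]
      refine (Finset.le_sum_of_subadditive N (map_zero N).le (map_add_le_add N) _ _).trans (Finset.sum_le_sum fun i _ => ?_)
      rw [map_smul_eq_mul]
      exact mul_le_mul_of_nonneg_right (norm_le_pi_norm v i) (apply_nonneg _ _)
    rw [← Finset.mul_sum] at h1
    nlinarith [norm_nonneg v]

lemma Seminorm.abs_sub_le (N : Seminorm ℝ (Fin n → ℝ)) (u v : Fin n → ℝ) :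
    |N u - N v| ≤ N (u - v) := by
  rw [abs_le]
  constructor
  · have h1 := map_add_le_add N u (v - u)
    rw [add_sub_cancel, map_sub_rev] at h1
    linarith
  · have h2 := map_add_le_add N v (u - v)
    rw [add_sub_cancel] at h2
    linarith

lemma Seminorm.continuous_pi (N : Seminorm ℝ (Fin n → ℝ)) : Continuous N := by
  obtain ⟨D, hD, h⟩ := N.exists_le_mul_norm
  refine (LipschitzWith.of_dist_le_mul (K := D.toNNReal) fun u v => ?_).continuous
  rw [Real.dist_eq, dist_eq_norm, Real.coe_toNNReal _ hD.le]
  exact (N.abs_sub_le u v).trans (h _)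

/-- A piecewise linear function of the norm rising from `0` to `1` on `[r, r + δ]`. -/
noncomputable def normRamp (N : Seminorm ℝ (Fin n → ℝ)) (r δ : ℝ) (v : Fin n → ℝ) : ℝ :=
  min 1 (max 0 ((N v - r) / δ))

lemma normRamp_nonneg (N : Seminorm ℝ (Fin n → ℝ)) (r δ : ℝ) (v : Fin n → ℝ) :
    0 ≤ normRamp N r δ v := le_min zero_le_one (le_max_left _ _)

lemma normRamp_le_one (N : Seminorm ℝ (Fin n → ℝ)) (r δ : ℝ) (v : Fin n → ℝ) :
    normRamp N r δ v ≤ 1 := min_le_left _ _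

lemma normRamp_eq_zero {N : Seminorm ℝ (Fin n → ℝ)} {r δ : ℝ} (hδ : 0 < δ) {v : Fin n → ℝ}
    (h : N v ≤ r) : normRamp N r δ v = 0 := by
  have : (N v - r) / δ ≤ 0 := div_nonpos_of_nonpos_of_nonneg (by linarith) hδ.le
  rw [normRamp, max_eq_left this, min_eq_right zero_le_one]

lemma normRamp_eq_one {N : Seminorm ℝ (Fin n → ℝ)} {r δ : ℝ} (hδ : 0 < δ) {v : Fin n → ℝ}
    (h : r + δ ≤ N v) : normRamp N r δ v = 1 := by
  have : 1 ≤ (N v - r) / δ := by rw [one_le_div hδ]; linarith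
  rw [normRamp, max_eq_right (by linarith), min_eq_left this]

lemma isTest_normRamp (N : Seminorm ℝ (Fin n → ℝ)) {r δ : ℝ} (hr : 0 < r) (hδ : 0 < δ) :
    IsTest (normRamp N r δ) := by
  obtain ⟨D, hD, h⟩ := N.exists_le_mul_norm
  refine ⟨?_, ⟨1, fun v => ?_⟩, ⟨r / D, by positivity, fun v hv => ?_⟩, fun δ' hδ' => ?_⟩
  · have := N.continuous_pi
    unfold normRamp
    fun_prop
  · rw [abs_of_nonneg (normRamp_nonneg _ _ _ _)]; exact normRamp_le_one _ _ _ _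
  · refine normRamp_eq_zero hδ ((h v).trans ?_)
    rw [mul_comm, ← le_div_iff₀ hD]
    refine (pi_norm_le_iff_of_nonneg (by positivity)).2 fun i => ?_
    rw [Real.norm_of_nonneg (hv i).1]
    exact (hv i).2
  · refine ⟨δ' * δ / D, by positivity, fun u v huv => ?_⟩
    have h1 : ‖u - v‖ ≤ δ' * δ / D := by
      refine (pi_norm_le_iff_of_nonneg (by positivity)).2 fun i => ?_
      rw [Pi.sub_apply]
      rcases (huv i).2 with he | ⟨he, hle⟩
      · rw [he, sub_self, norm_zero]; positivity
      · rw [he, zero_sub, norm_neg, Real.norm_of_nonneg (huv i).1]; exact hle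
    have h2 : |N u - N v| ≤ δ' * δ := by
      refine (N.abs_sub_le u v).trans ((h _).trans ?_)
      rw [le_div_iff₀ hD] at h1
      linarith
    unfold normRamp
    refine (abs_min_sub_min_le_max _ _ _ _).trans ?_
    rw [sub_self, abs_zero]
    refine max_le hδ'.le ((abs_max_sub_max_le_max _ _ _ _).trans ?_)
    rw [sub_self, abs_zero]
    refine max_le hδ'.le ?_
    rw [← sub_div, sub_sub_sub_cancel_right, abs_div, abs_of_pos hδ, div_le_iff₀ hδ]
    exact h2

end Vector

/-! ### Convergence on test functions and the tail of the norm -/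

section Limit

variable {Ω : Type*} [MeasurableSpace Ω] {P : Measure Ω} {n : ℕ} {α : ℝ}

/-- Vague convergence of the law of `x⁻¹ X`, normalized by `h x`, tested on `IsTest` functions,
with limit the sum of the images of `P ⊗ ν_α` under `(ω, z) ↦ z W(ω)`. -/
structure VectorLimit {ι : Type*} (P : Measure Ω) (X : Ω → Fin n → ℝ) (α : ℝ) (h : ℝ → ℝ)
    (s : Finset ι) (W : ι → Ω → Fin n → ℝ) : Prop where
  index_pos : 0 < α
  measurable_X : Measurable X
  measurable_W : ∀ a, Measurable (W a)
  nonneg_W : ∀ a ω i, 0 ≤ W a ω i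
  integrable_W : ∀ a i, Integrable (fun ω => W a ω i ^ α) P
  pos : ∀ᶠ x in atTop, 0 < h x
  tendsto : ∀ φ : (Fin n → ℝ) → ℝ, IsTest φ →
    Tendsto (fun x => (∫ ω, φ (fun i => x⁻¹ * X ω i) ∂P) / h x) atTop
      (𝓝 (∑ a ∈ s, ∫ q, φ (scaleVec (W a) q) ∂(P.prod (powerMeasure α))))
  nondegenerate : ∃ a ∈ s, P {ω | W a ω ≠ 0} ≠ 0

variable {ι : Type*} {X : Ω → Fin n → ℝ} {h : ℝ → ℝ} {s : Finset ι} {W : ι → Ω → Fin n → ℝ}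

lemma norm_rpow_le_sum {w : Fin n → ℝ} (hα : 0 < α) : ‖w‖ ^ α ≤ ∑ i, |w i| ^ α := by
  have h0 : 0 ≤ ∑ i, |w i| ^ α := Finset.sum_nonneg fun i _ => by positivity
  have h1 : ‖w‖ ≤ (∑ i, |w i| ^ α) ^ α⁻¹ := by
    refine (pi_norm_le_iff_of_nonneg (by positivity)).2 fun i => ?_
    rw [Real.norm_eq_abs, Real.le_rpow_inv_iff_of_pos (abs_nonneg _) h0 hα]
    exact Finset.single_le_sum (f := fun i => |w i| ^ α) (fun j _ => by positivity)
      (Finset.mem_univ i)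
  exact (Real.le_rpow_inv_iff_of_pos (norm_nonneg _) h0 hα).1 h1

lemma VectorLimit.integrable_norm (L : VectorLimit P X α h s W) (N : Seminorm ℝ (Fin n → ℝ))
    (a : ι) : Integrable (fun ω => N (W a ω) ^ α) P := by
  obtain ⟨D, hD, hN⟩ := N.exists_le_mul_norm
  have hα := L.index_pos
  refine Integrable.mono' (g := fun ω => D ^ α * ∑ i, W a ω i ^ α)
    ((integrable_finsetSum _ fun i _ => L.integrable_W a i).const_mul _)
    ((N.continuous_pi.measurable.comp (L.measurable_W a)).pow_const α).aestronglyMeasurable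
    (Eventually.of_forall fun ω => ?_)
  rw [Real.norm_of_nonneg (Real.rpow_nonneg (apply_nonneg _ _) _)]
  have h1 := norm_rpow_le_sum (w := W a ω) hα
  simp_rw [abs_of_nonneg (L.nonneg_W a ω _)] at h1
  calc N (W a ω) ^ α ≤ (D * ‖W a ω‖) ^ α := Real.rpow_le_rpow (apply_nonneg _ _) (hN _) hα.le
    _ = D ^ α * ‖W a ω‖ ^ α := Real.mul_rpow hD.le (norm_nonneg _)
    _ ≤ _ := by gcongr

/-- The mass given by the limit to the complement of the unit ball. -/
noncomputable def normMass (P : Measure Ω) (α : ℝ) (s : Finset ι) (W : ι → Ω → Fin n → ℝ)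
    (N : Seminorm ℝ (Fin n → ℝ)) : ℝ := ∑ a ∈ s, ∫ ω, N (W a ω) ^ α ∂P

lemma VectorLimit.normMass_pos (L : VectorLimit P X α h s W) {N : Seminorm ℝ (Fin n → ℝ)}
    (hN : ∀ v, N v = 0 → v = 0) : 0 < normMass P α s W N := by
  obtain ⟨a, ha, hne⟩ := L.nondegenerate
  have h0 : ∀ a ω, 0 ≤ N (W a ω) ^ α := fun a ω => Real.rpow_nonneg (apply_nonneg _ _) _
  refine Finset.sum_pos' (fun b _ => integral_nonneg (h0 b)) ⟨a, ha, ?_⟩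
  rw [integral_pos_iff_support_of_nonneg (h0 a) (L.integrable_norm N a)]
  refine pos_iff_ne_zero.2 fun hz => hne (measure_mono_null (fun ω hω => ?_) hz)
  have h1 : N (W a ω) ≠ 0 := fun h2 => hω (hN _ h2)
  exact (Real.rpow_pos_of_pos (lt_of_le_of_ne (apply_nonneg _ _) (Ne.symm h1)) α).ne'

/-- For z > 0 one has N(z W) = z N(W), which reduces the mass to a one-dimensional power tail with
random scale. -/
lemma VectorLimit.measure_norm_lt (L : VectorLimit P X α h s W) [IsProbabilityMeasure P]
    (N : Seminorm ℝ (Fin n → ℝ)) {r : ℝ} (hr : 0 < r) (a : ι) :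
    (P.prod (powerMeasure α)) {q | r < N (scaleVec (W a) q)} ≠ ∞ ∧
    (P.prod (powerMeasure α)).real {q | r < N (scaleVec (W a) q)} =
      r ^ (-α) * ∫ ω, N (W a ω) ^ α ∂P := by
  have h1 := prod_powerMeasure_real_lt_mul (P := P) L.index_pos hr
    (N.continuous_pi.measurable.comp (L.measurable_W a)) (fun ω => apply_nonneg N _)
    (L.integrable_norm N a)
  have h2 : ({q | r < N (scaleVec (W a) q)} : Set (Ω × ℝ)) =ᵐ[P.prod (powerMeasure α)]
      {q | r < q.2 * N (W a q.1)} := by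
    filter_upwards [ae_prod_powerMeasure_pos (P := P) α] with q hq
    have h3 : N (scaleVec (W a) q) = q.2 * N (W a q.1) := by
      have : scaleVec (W a) q = q.2 • W a q.1 := rfl
      rw [this, map_smul_eq_mul, Real.norm_of_nonneg hq.le]
    refine propext ?_
    change r < N (scaleVec (W a) q) ↔ r < q.2 * N (W a q.1)
    rw [h3]
  rw [measure_congr h2, measureReal_congr h2]
  exact h1

lemma VectorLimit.integral_normRamp_bounds (L : VectorLimit P X α h s W) [IsProbabilityMeasure P]
    (N : Seminorm ℝ (Fin n → ℝ)) {r δ : ℝ} (hr : 0 < r) (hδ : 0 < δ) :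
    (r + δ) ^ (-α) * normMass P α s W N ≤
      ∑ a ∈ s, ∫ q, normRamp N r δ (scaleVec (W a) q) ∂(P.prod (powerMeasure α)) ∧
    ∑ a ∈ s, ∫ q, normRamp N r δ (scaleVec (W a) q) ∂(P.prod (powerMeasure α)) ≤
      r ^ (-α) * normMass P α s W N := by
  have hms : ∀ (r : ℝ) (a : ι), MeasurableSet {q : Ω × ℝ | r < N (scaleVec (W a) q)} := fun r a =>
    measurableSet_lt measurable_const
      (N.continuous_pi.measurable.comp (measurable_scaleVec (L.measurable_W a)))
  have hint : ∀ {r : ℝ}, 0 < r → ∀ a, Integrable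
      ({q : Ω × ℝ | r < N (scaleVec (W a) q)}.indicator (fun _ => (1 : ℝ)))
      (P.prod (powerMeasure α)) := fun hr a =>
    (integrable_indicator_iff (hms _ a)).2 (integrableOn_const (L.measure_norm_lt N hr a).1)
  have hval : ∀ {r : ℝ}, 0 < r → ∀ a,
      ∫ q, {q : Ω × ℝ | r < N (scaleVec (W a) q)}.indicator (fun _ => (1 : ℝ)) q
        ∂(P.prod (powerMeasure α)) = r ^ (-α) * ∫ ω, N (W a ω) ^ α ∂P := fun hr a => by
    rw [integral_indicator_const _ (hms _ a), smul_eq_mul, mul_one, (L.measure_norm_lt N hr a).2]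
  have hri : ∀ a, Integrable (fun q => normRamp N r δ (scaleVec (W a) q))
      (P.prod (powerMeasure α)) := fun a =>
    (isTest_normRamp N hr hδ).integrable L.index_pos (L.measurable_W a) (L.nonneg_W a)
      (L.integrable_W a)
  unfold normMass
  rw [Finset.mul_sum, Finset.mul_sum]
  constructor
  · refine Finset.sum_le_sum fun a _ => ?_
    rw [← hval (add_pos hr hδ) a]
    refine integral_mono (hint (add_pos hr hδ) a) (hri a) fun q => ?_
    refine indicator_le' (f := fun _ => (1 : ℝ))
      (s := {q : Ω × ℝ | r + δ < N (scaleVec (W a) q)}) (fun q hq => ?_) (fun q _ => normRamp_nonneg _ _ _ _) q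
    exact (normRamp_eq_one hδ (le_of_lt hq)).ge
  · refine Finset.sum_le_sum fun a _ => ?_
    rw [← hval hr a]
    refine integral_mono (hri a) (hint hr a) fun q => ?_
    by_cases hq : r < N (scaleVec (W a) q)
    · rw [indicator_of_mem (show q ∈ {q : Ω × ℝ | r < N (scaleVec (W a) q)} from hq)]
      exact normRamp_le_one _ _ _ _
    · simp only [normRamp_eq_zero hδ (not_lt.1 hq)]
      exact indicator_nonneg (fun _ _ => zero_le_one) _

/-- The indicator of N > 1 is not continuous; it is squeezed between the ramps on [1, 1 + d] and [1
- d, 1]. Their limits both tend to κ as d → 0, since the limit gives mass r^(-α) κ to N > r. -/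
lemma VectorLimit.tendsto_norm_tail (L : VectorLimit P X α h s W) [IsProbabilityMeasure P]
    (N : Seminorm ℝ (Fin n → ℝ)) :
    Tendsto (fun x => P.real {ω | x < N (X ω)} / h x) atTop (𝓝 (normMass P α s W N)) := by
  have hα := L.index_pos
  -- The denominator M + 2 makes 1 - d M positive at M = 0 as well.
  let d : ℕ → ℝ := fun M => 1 / ((M : ℝ) + 2)
  have hd0 : ∀ M, 0 < d M := fun M => by positivity
  have hd1 : ∀ M, 0 < 1 - d M := fun M => by
    have : d M < 1 := by
      rw [div_lt_one (by positivity)]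
      have : (0 : ℝ) ≤ M := Nat.cast_nonneg M
      linarith
    linarith
  have hdt : Tendsto d atTop (𝓝 0) :=
    tendsto_const_nhds.div_atTop (tendsto_atTop_add_const_right _ _ tendsto_natCast_atTop_atTop)
  set κ := normMass P α s W N
  let Lim : ℝ → ℝ → ℝ := fun r δ =>
    ∑ a ∈ s, ∫ q, normRamp N r δ (scaleVec (W a) q) ∂(P.prod (powerMeasure α))
  have hpow : ∀ g : ℕ → ℝ, Tendsto g atTop (𝓝 1) →
      Tendsto (fun M => g M ^ (-α) * κ) atTop (𝓝 κ) := fun g hg => by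
    have h1 := (hg.rpow_const (p := -α) (Or.inl one_ne_zero)).mul_const κ
    rwa [Real.one_rpow, one_mul] at h1
  have hlow : Tendsto (fun M => Lim 1 (d M)) atTop (𝓝 κ) := by
    refine tendsto_of_tendsto_of_tendsto_of_le_of_le
      (hpow (fun M => 1 + d M) (by simpa using hdt.const_add 1)) tendsto_const_nhds
      (fun M => (L.integral_normRamp_bounds N one_pos (hd0 M)).1) (fun M => ?_)
    have := (L.integral_normRamp_bounds N one_pos (hd0 M)).2
    rwa [Real.one_rpow, one_mul] at this
  have hupp : Tendsto (fun M => Lim (1 - d M) (d M)) atTop (𝓝 κ) := by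
    refine tendsto_of_tendsto_of_tendsto_of_le_of_le tendsto_const_nhds
      (hpow (fun M => 1 - d M) (by simpa using hdt.const_sub 1))
      (fun M => ?_) (fun M => (L.integral_normRamp_bounds N (hd1 M) (hd0 M)).2)
    have := (L.integral_normRamp_bounds N (hd1 M) (hd0 M)).1
    rwa [sub_add_cancel, Real.one_rpow, one_mul] at this
  refine tendsto_of_approx
    (A := fun M x => (∫ ω, normRamp N 1 (d M) (fun i => x⁻¹ * X ω i) ∂P) / h x)
    (E := fun M x => (∫ ω, normRamp N (1 - d M) (d M) (fun i => x⁻¹ * X ω i) ∂P) / h x -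
      (∫ ω, normRamp N 1 (d M) (fun i => x⁻¹ * X ω i) ∂P) / h x)
    (fun M => L.tendsto _ (isTest_normRamp N one_pos (hd0 M))) hlow
    (fun M => (L.tendsto _ (isTest_normRamp N (hd1 M) (hd0 M))).sub
      (L.tendsto _ (isTest_normRamp N one_pos (hd0 M)))) ?_ ?_
  · have := hupp.sub hlow
    rwa [sub_self] at this
  intro M
  filter_upwards [L.pos, eventually_gt_atTop 0] with x hx hx0
  have hXm : Measurable fun ω => (fun i => x⁻¹ * X ω i : Fin n → ℝ) :=
    measurable_pi_lambda _ fun i =>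
      measurable_const.mul ((measurable_pi_apply i).comp L.measurable_X)
  have hms : MeasurableSet {ω | x < N (X ω)} :=
    measurableSet_lt measurable_const (N.continuous_pi.measurable.comp L.measurable_X)
  have hri : ∀ r δ : ℝ, 0 < r → 0 < δ →
      Integrable (fun ω => normRamp N r δ (fun i => x⁻¹ * X ω i)) P := fun r δ hr hδ =>
    Integrable.of_bound ((isTest_normRamp N hr hδ).continuous.measurable.comp
      hXm).aestronglyMeasurable 1 (Eventually.of_forall fun ω => by
        rw [Real.norm_of_nonneg (normRamp_nonneg _ _ _ _)]; exact normRamp_le_one _ _ _ _)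
  have hNX : ∀ ω, N (fun i => x⁻¹ * X ω i) = x⁻¹ * N (X ω) := fun ω => by
    have : (fun i => x⁻¹ * X ω i) = x⁻¹ • X ω := rfl
    rw [this, map_smul_eq_mul, Real.norm_of_nonneg (by positivity)]
  have hPe : P.real {ω | x < N (X ω)} =
      ∫ ω, {ω | x < N (X ω)}.indicator (fun _ => (1 : ℝ)) ω ∂P := by
    rw [integral_indicator_const _ hms, smul_eq_mul, mul_one]
  have h1 : ∫ ω, normRamp N 1 (d M) (fun i => x⁻¹ * X ω i) ∂P ≤ P.real {ω | x < N (X ω)} := by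
    rw [hPe]
    refine integral_mono (hri _ _ one_pos (hd0 M)) ((integrable_const _).indicator hms) fun ω => ?_
    by_cases hω : x < N (X ω)
    · rw [indicator_of_mem (show ω ∈ {ω | x < N (X ω)} from hω)]
      exact normRamp_le_one _ _ _ _
    · have : N (fun i => x⁻¹ * X ω i) ≤ 1 := by
        rw [hNX, inv_mul_le_iff₀ hx0, mul_one]; exact not_lt.1 hω
      simp only [normRamp_eq_zero (hd0 M) this]
      exact indicator_nonneg (fun _ _ => zero_le_one) _
  have h2 : P.real {ω | x < N (X ω)} ≤
      ∫ ω, normRamp N (1 - d M) (d M) (fun i => x⁻¹ * X ω i) ∂P := by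
    rw [hPe]
    refine integral_mono ((integrable_const _).indicator hms) (hri _ _ (hd1 M) (hd0 M)) fun ω => ?_
    by_cases hω : x < N (X ω)
    · rw [indicator_of_mem (show ω ∈ {ω | x < N (X ω)} from hω)]
      refine (normRamp_eq_one (hd0 M) ?_).ge
      rw [sub_add_cancel, hNX, le_inv_mul_iff₀ hx0, mul_one]
      exact le_of_lt hω
    · rw [indicator_of_notMem (show ω ∉ {ω | x < N (X ω)} from hω)]
      exact normRamp_nonneg _ _ _ _
  rw [← sub_div, ← sub_div, abs_of_nonneg (div_nonneg (by linarith) hx.le)]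
  exact div_le_div_of_nonneg_right (by linarith) hx.le

/-! ### The compactified space -/

lemma continuous_coe_pi : Continuous fun v : Fin n → ℝ => (fun i => (v i : EReal)) :=
  continuous_pi fun i => continuous_coe_real_ereal.comp (continuous_apply i)

lemma coe_zero_pi : (fun i => (((0 : Fin n → ℝ) i : ℝ) : EReal)) = 0 := by
  ext i; simp

lemma exists_pos_forall_notMem_of_isClosed {S : Set (Fin n → EReal)} (hS : IsClosed S)
    (h0 : (0 : Fin n → EReal) ∉ S) :
    ∃ ε > 0, ∀ v : Fin n → ℝ, (∀ i, 0 ≤ v i ∧ v i ≤ ε) → (fun i => (v i : EReal)) ∉ S := by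
  have h1 : (fun v : Fin n → ℝ => (fun i => (v i : EReal))) ⁻¹' Sᶜ ∈ 𝓝 (0 : Fin n → ℝ) := by
    refine continuous_coe_pi.continuousAt.preimage_mem_nhds ?_
    rw [coe_zero_pi]
    exact hS.isOpen_compl.mem_nhds h0
  obtain ⟨r, hr, hball⟩ := Metric.mem_nhds_iff.1 h1
  refine ⟨r / 2, by positivity, fun v hv => hball ?_⟩
  rw [mem_ball_zero_iff]
  refine lt_of_le_of_lt ((pi_norm_le_iff_of_nonneg (by positivity)).2 fun i => ?_) (half_lt_self hr)
  rw [Real.norm_of_nonneg (hv i).1]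
  exact (hv i).2

lemma isOpen_punctured : IsOpen {v : Fin n → EReal | v ≠ 0} := isOpen_ne

/-- The compact support misses the origin, which gives vanishing near zero. The extension by zero is
continuous on a compact space, hence bounded and uniformly continuous, and uniform continuity gives
the stability under deleting small coordinates. -/
lemma isTest_extend {f : PuncturedSpace n → ℝ} (hf : Continuous f) (hc : HasCompactSupport f) :
    IsTest fun v : Fin n → ℝ => Function.extend Subtype.val f 0 (fun i => (v i : EReal)) := by
  set F : (Fin n → EReal) → ℝ := Function.extend Subtype.val f 0 with hF
  have hFc : Continuous F :=
    HasCompactSupport.continuous_extend_zero (U := {v : Fin n → EReal | v ≠ 0})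
      isOpen_punctured hf hc
  have hSc : IsClosed (Subtype.val '' tsupport f : Set (Fin n → EReal)) :=
    (hc.isCompact.image continuous_subtype_val).isClosed
  have hS0 : (0 : Fin n → EReal) ∉ (Subtype.val '' tsupport f : Set (Fin n → EReal)) := by
    rintro ⟨v, -, hv⟩; exact v.2 hv
  have hFS : ∀ v, v ∉ (Subtype.val '' tsupport f : Set (Fin n → EReal)) → F v = 0 := by
    intro v hv
    by_cases h0 : v = 0
    · rw [hF, Function.extend_apply' _ _ _ (by rintro ⟨w, hw⟩; exact w.2 (hw.trans h0))]
      rfl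
    · have h1 : F v = f ⟨v, h0⟩ := Subtype.val_injective.extend_apply f 0 ⟨v, h0⟩
      rw [h1]
      exact image_eq_zero_of_notMem_tsupport fun h2 => hv ⟨_, h2, rfl⟩
  obtain ⟨ε, hε, hv⟩ := exists_pos_forall_notMem_of_isClosed hSc hS0
  refine ⟨hFc.comp continuous_coe_pi, ?_, ⟨ε, hε, fun v hv' => hFS _ (hv v hv')⟩, fun δ hδ => ?_⟩
  · obtain ⟨K, hK⟩ := (isCompact_univ.bddAbove_image (f := fun v => |F v|)
      (hFc.abs.continuousOn))
    exact ⟨K, fun v => hK ⟨_, mem_univ _, rfl⟩⟩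
  · let _ : MetricSpace EReal := TopologicalSpace.metrizableSpaceMetric EReal
    have huc : UniformContinuous F := CompactSpace.uniformContinuous_of_continuous hFc
    obtain ⟨r, hr, hru⟩ := Metric.uniformContinuous_iff.1 huc δ hδ
    have h1 : (fun x : ℝ => (x : EReal)) ⁻¹' Metric.ball (0 : EReal) r ∈ 𝓝 (0 : ℝ) :=
      continuous_coe_real_ereal.continuousAt.preimage_mem_nhds
        (by simpa using Metric.ball_mem_nhds (0 : EReal) hr)
    obtain ⟨η, hη, hball⟩ := Metric.mem_nhds_iff.1 h1
    refine ⟨η / 2, by positivity, fun u v huv => ?_⟩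
    have h2 : dist (fun i => (u i : EReal)) (fun i => (v i : EReal)) < r := by
      refine (dist_pi_lt_iff hr).2 fun i => ?_
      rcases (huv i).2 with he | ⟨he, hle⟩
      · rw [he, dist_self]; exact hr
      · rw [he, dist_comm]
        refine hball (show v i ∈ Metric.ball (0 : ℝ) η from ?_)
        rw [mem_ball_zero_iff, Real.norm_of_nonneg (huv i).1]
        linarith
    have h3 := hru h2
    rw [Real.dist_eq] at h3
    exact h3.le

lemma integral_comap_punctured (l : Measure (Fin n → EReal)) (f : PuncturedSpace n → ℝ) :
    ∫ v, f v ∂(l.comap Subtype.val) = ∫ v, Function.extend Subtype.val f 0 v ∂l := by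
  have h1 : ∀ v : PuncturedSpace n, f v = Function.extend Subtype.val f 0 v.1 := fun v =>
    (Subtype.val_injective.extend_apply f 0 v).symm
  have h2 := integral_subtype_comap (μ := l) (s := {v : Fin n → EReal | v ≠ 0})
    isOpen_punctured.measurableSet (Function.extend Subtype.val f 0)
  calc ∫ v, f v ∂(l.comap Subtype.val)
      = ∫ v : PuncturedSpace n, Function.extend Subtype.val f 0 v.1 ∂(l.comap Subtype.val) :=
        integral_congr_ae (Eventually.of_forall h1)
    _ = ∫ v in {v : Fin n → EReal | v ≠ 0}, Function.extend Subtype.val f 0 v ∂l := h2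
    _ = _ := setIntegral_eq_integral_of_forall_compl_eq_zero fun v hv => by
        have hv0 : v = 0 := not_not.1 hv
        rw [Function.extend_apply' _ _ _ (by rintro ⟨w, hw⟩; exact w.2 (hw.trans hv0))]
        rfl

lemma measurable_coe_pi : Measurable fun v : Fin n → ℝ => (fun i => (v i : EReal)) :=
  continuous_coe_pi.measurable

/-! ### The power measure -/

/-- These measures are infinite near zero, so uniqueness is checked on the half-lines (1 / (k + 1),
∞), where they are finite and determined by their tails. -/
lemma eq_powerMeasure {ν : Measure ℝ} (hα : 0 < α) (h0 : ν (Iic 0) = 0)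
    (h : ∀ c > 0, ν (Ioi c) = ENNReal.ofReal (c ^ (-α))) : ν = powerMeasure α := by
  have hU : (⋃ k : ℕ, Ioi (1 / ((k : ℝ) + 1))) = Ioi (0 : ℝ) := by
    ext z
    simp only [mem_iUnion, mem_Ioi]
    exact ⟨fun ⟨k, hk⟩ => lt_trans (by positivity) hk, fun hz => exists_nat_one_div_lt hz⟩
  have hr : ν.restrict (Ioi 0) = (powerMeasure α).restrict (Ioi 0) := by
    rw [← hU, Measure.restrict_iUnion_congr]
    intro k
    set ε := 1 / ((k : ℝ) + 1)
    have hε : 0 < ε := by positivity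
    have hfin : ∀ μ : Measure ℝ, (∀ c > 0, μ (Ioi c) = ENNReal.ofReal (c ^ (-α))) →
        IsFiniteMeasure (μ.restrict (Ioi ε)) := fun μ hμ =>
      ⟨by rw [Measure.restrict_apply_univ, hμ ε hε]; exact ENNReal.ofReal_lt_top⟩
    have hp : ∀ c > 0, powerMeasure α (Ioi c) = ENNReal.ofReal (c ^ (-α)) := fun c hc =>
      powerMeasure_Ioi hα hc
    have := hfin ν h
    have := hfin _ hp
    refine Measure.ext_of_Iic _ _ fun c => ?_
    rw [Measure.restrict_apply measurableSet_Iic, Measure.restrict_apply measurableSet_Iic]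
    have hI : Iic c ∩ Ioi ε = Ioi ε \ Ioi (max ε c) := by
      ext z
      simp only [mem_inter_iff, mem_Iic, mem_Ioi, Set.mem_sdiff, max_lt_iff, not_and, not_lt]
      exact ⟨fun h => ⟨h.2, fun _ => h.1⟩, fun h => ⟨h.2 h.1, h.1⟩⟩
    have hm : 0 < max ε c := lt_max_of_lt_left hε
    rw [hI, measure_sdiff (Ioi_subset_Ioi (le_max_left _ _)) nullMeasurableSet_Ioi
        (by rw [h _ hm]; exact ENNReal.ofReal_ne_top),
      measure_sdiff (Ioi_subset_Ioi (le_max_left _ _)) nullMeasurableSet_Ioi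
        (by rw [hp _ hm]; exact ENNReal.ofReal_ne_top), h _ hm, h _ hε, hp _ hm, hp _ hε]
  have hself : ∀ μ : Measure ℝ, μ (Iic 0) = 0 → μ.restrict (Ioi 0) = μ := fun μ hμ =>
    Measure.restrict_eq_self_of_ae_mem (by
      rw [ae_iff]
      refine measure_mono_null (fun z hz => ?_) hμ
      exact not_lt.1 (show ¬ (0 : ℝ) < z from hz))
  rwa [hself _ h0, hself _ (powerMeasure_Iic_zero α)] at hr

lemma map_mul_powerMeasure (hα : 0 < α) {t : ℝ} (ht : 0 < t) :
    (powerMeasure α).map (fun z => t⁻¹ * z) = ENNReal.ofReal (t ^ (-α)) • powerMeasure α := by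
  have hm : Measurable fun z : ℝ => t⁻¹ * z := measurable_const.mul measurable_id
  have hcoef : ENNReal.ofReal (t ^ α) * ENNReal.ofReal (t ^ (-α)) = 1 := by
    rw [← ENNReal.ofReal_mul (by positivity), ← Real.rpow_add ht]; simp
  have h1 : ENNReal.ofReal (t ^ α) • (powerMeasure α).map (fun z => t⁻¹ * z) = powerMeasure α := by
    refine eq_powerMeasure hα ?_ fun c hc => ?_
    · rw [Measure.smul_apply, Measure.map_apply hm measurableSet_Iic]
      have : (fun z => t⁻¹ * z) ⁻¹' Iic 0 = Iic 0 := by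
        ext z; simp [inv_mul_le_iff₀ ht]
      rw [this, powerMeasure_Iic_zero, smul_zero]
    · rw [Measure.smul_apply, Measure.map_apply hm measurableSet_Ioi]
      have : (fun z => t⁻¹ * z) ⁻¹' Ioi c = Ioi (t * c) := by
        ext z; simp [lt_inv_mul_iff₀ ht]
      rw [this, powerMeasure_Ioi hα (by positivity), Real.mul_rpow ht.le hc.le,
        ENNReal.ofReal_mul (by positivity), smul_eq_mul, ← mul_assoc, hcoef, one_mul]
  calc (powerMeasure α).map (fun z => t⁻¹ * z)
      = (ENNReal.ofReal (t ^ α) * ENNReal.ofReal (t ^ (-α))) •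
          (powerMeasure α).map (fun z => t⁻¹ * z) := by rw [hcoef, one_smul]
    _ = ENNReal.ofReal (t ^ (-α)) • (ENNReal.ofReal (t ^ α) •
          (powerMeasure α).map (fun z => t⁻¹ * z)) := by rw [smul_smul, mul_comm]
    _ = _ := by rw [h1]

end Limit

/-! ### The limit measure and regular variation of the vector -/

section Main

variable {Ω : Type*} [MeasurableSpace Ω] {P : Measure Ω} {n : ℕ} {α : ℝ}
  {ι : Type*} {X : Ω → Fin n → ℝ} {h : ℝ → ℝ} {s : Finset ι} {W : ι → Ω → Fin n → ℝ}

/-- The image of `P ⊗ ν_α` under `(ω, z) ↦ z W(ω)` in the compactified space. -/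
noncomputable def limitLaw (P : Measure Ω) (α : ℝ) (W : Ω → Fin n → ℝ) :
    Measure (Fin n → EReal) :=
  (P.prod (powerMeasure α)).map fun q => fun i => ((scaleVec W q i : ℝ) : EReal)

/-- The sum of the limit laws, as a measure on the punctured space. -/
noncomputable def limitSum (P : Measure Ω) (α : ℝ) (s : Finset ι) (W : ι → Ω → Fin n → ℝ) :
    Measure (PuncturedSpace n) :=
  (∑ a ∈ s, limitLaw P α (W a)).comap Subtype.val

lemma measurableEmbedding_punctured :
    MeasurableEmbedding (Subtype.val : PuncturedSpace n → (Fin n → EReal)) :=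
  MeasurableEmbedding.subtype_coe (s := {v : Fin n → EReal | v ≠ 0}) isOpen_punctured.measurableSet

lemma measurable_coe_scaleVec {W : Ω → Fin n → ℝ} (hW : Measurable W) :
    Measurable fun q : Ω × ℝ => fun i => ((scaleVec W q i : ℝ) : EReal) :=
  measurable_coe_pi.comp (measurable_scaleVec hW)

lemma limitSum_apply (B : Set (PuncturedSpace n)) :
    limitSum P α s W B = ∑ a ∈ s, limitLaw P α (W a) (Subtype.val '' B) := by
  rw [limitSum, measurableEmbedding_punctured.comap_apply, Measure.coe_finsetSum, Finset.sum_apply]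

lemma limitLaw_apply [IsProbabilityMeasure P] {W : Ω → Fin n → ℝ} (hW : Measurable W)
    {B : Set (Fin n → EReal)} (hB : MeasurableSet B) :
    limitLaw P α W B =
      ∫⁻ z, P {ω | (fun i => ((z * W ω i : ℝ) : EReal)) ∈ B} ∂(powerMeasure α) := by
  rw [limitLaw, Measure.map_apply (measurable_coe_scaleVec hW) hB,
    Measure.prod_apply_symm (measurable_coe_scaleVec hW hB)]
  rfl

/-- A dilation by t acts on the variable z alone, and the power measure is scaled by t^(-α). -/
lemma limitSum_dilate [IsProbabilityMeasure P] (hα : 0 < α) (hW : ∀ a, Measurable (W a)) {t : ℝ}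
    (ht : 0 < t) {B : Set (PuncturedSpace n)} (hB : MeasurableSet B) :
    limitSum P α s W (dilate t B) = ENNReal.ofReal (t ^ (-α)) * limitSum P α s W B := by
  have htE : ∀ y : EReal, (t : EReal) * (((t⁻¹ : ℝ) : EReal) * y) = y := fun y => by
    rw [← mul_assoc, ← EReal.coe_mul, mul_inv_cancel₀ ht.ne', EReal.coe_one, one_mul]
  have htE' : ∀ y : EReal, ((t⁻¹ : ℝ) : EReal) * ((t : EReal) * y) = y := fun y => by
    rw [← mul_assoc, ← EReal.coe_mul, inv_mul_cancel₀ ht.ne', EReal.coe_one, one_mul]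
  have himg : (Subtype.val '' dilate t B : Set (Fin n → EReal)) =
      (fun v i => ((t⁻¹ : ℝ) : EReal) * v i) ⁻¹' (Subtype.val '' B) := by
    ext v
    constructor
    · rintro ⟨w, ⟨u, hu, huw⟩, rfl⟩
      refine ⟨u, hu, funext fun i => ?_⟩
      change u.1 i = ((t⁻¹ : ℝ) : EReal) * w.1 i
      rw [huw i, htE']
    · rintro ⟨u, hu, huv⟩
      have hv : ∀ i, v i = (t : EReal) * u.1 i := fun i => by
        rw [show u.1 i = ((t⁻¹ : ℝ) : EReal) * v i from congrFun huv i, htE]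
      refine ⟨⟨v, fun h0 => u.2 (funext fun i => ?_)⟩, ⟨u, hu, hv⟩, rfl⟩
      rw [show u.1 i = ((t⁻¹ : ℝ) : EReal) * v i from congrFun huv i, h0]
      simp
  have hBm : MeasurableSet (Subtype.val '' B : Set (Fin n → EReal)) :=
    measurableEmbedding_punctured.measurableSet_image.2 hB
  rw [limitSum_apply, limitSum_apply, Finset.mul_sum]
  refine Finset.sum_congr rfl fun a _ => ?_
  have hm := measurable_coe_scaleVec (hW a)
  have hgm : Measurable fun v : Fin n → EReal => fun i => ((t⁻¹ : ℝ) : EReal) * v i :=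
    measurable_pi_lambda _ fun i => measurable_const.mul (measurable_pi_apply i)
  have hmul : Measurable fun z : ℝ => t⁻¹ * z := measurable_const.mul measurable_id
  have hset : MeasurableSet ((fun (v : Fin n → EReal) i => ((t⁻¹ : ℝ) : EReal) * v i) ⁻¹'
      (Subtype.val '' B : Set (Fin n → EReal))) := hgm hBm
  rw [himg, limitLaw, Measure.map_apply hm hset, Measure.map_apply hm hBm]
  have hpre : (fun q : Ω × ℝ => fun i => ((scaleVec (W a) q i : ℝ) : EReal)) ⁻¹'
      ((fun (v : Fin n → EReal) i => ((t⁻¹ : ℝ) : EReal) * v i) ⁻¹' (Subtype.val '' B)) =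
      Prod.map id (fun z => t⁻¹ * z) ⁻¹'
        ((fun q : Ω × ℝ => fun i => ((scaleVec (W a) q i : ℝ) : EReal)) ⁻¹'
          (Subtype.val '' B)) := by
    ext q
    simp only [mem_preimage, scaleVec, Prod.map, id, ← EReal.coe_mul, mul_assoc]
  rw [hpre, ← Measure.map_apply (measurable_id.prodMap hmul) (hm hBm),
    ← Measure.map_prod_map _ _ measurable_id hmul, Measure.map_id, map_mul_powerMeasure hα ht,
    Measure.prod_smul_right, Measure.smul_apply, smul_eq_mul]

lemma VectorLimit.isFiniteMeasureOnCompacts [IsProbabilityMeasure P]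
    (L : VectorLimit P X α h s W) : IsFiniteMeasureOnCompacts (limitSum P α s W) := by
  refine ⟨fun K hK => ?_⟩
  have hKc : IsClosed (Subtype.val '' K : Set (Fin n → EReal)) :=
    (hK.image continuous_subtype_val).isClosed
  have hK0 : (0 : Fin n → EReal) ∉ (Subtype.val '' K : Set (Fin n → EReal)) := by
    rintro ⟨v, -, hv⟩; exact v.2 hv
  obtain ⟨ε, hε, hv⟩ := exists_pos_forall_notMem_of_isClosed hKc hK0
  rw [limitSum_apply]
  refine ENNReal.sum_lt_top.2 fun a _ => ?_
  rw [limitLaw, Measure.map_apply (measurable_coe_scaleVec (L.measurable_W a)) hKc.measurableSet]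
  have hle : (P.prod (powerMeasure α)) ((fun q => fun i => ((scaleVec (W a) q i : ℝ) : EReal)) ⁻¹'
      (Subtype.val '' K)) ≤ ∑ i, (P.prod (powerMeasure α)) {q | ε < q.2 * W a q.1 i} := by
    refine (measure_mono_ae ?_).trans (measure_iUnion_fintype_le _ _)
    filter_upwards [ae_prod_powerMeasure_pos (P := P) α] with q hq hqK
    by_contra hcon
    have hcon' : ∀ i, ¬ ε < q.2 * W a q.1 i := fun i hi =>
      hcon (mem_iUnion.2 ⟨i, hi⟩)
    exact hv (scaleVec (W a) q)
      (fun i => ⟨mul_nonneg hq.le (L.nonneg_W a _ i), not_lt.1 (hcon' i)⟩) hqK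
  refine hle.trans_lt (ENNReal.sum_lt_top.2 fun i _ => lt_top_iff_ne_top.2 ?_)
  exact (prod_powerMeasure_real_lt_mul L.index_pos hε
    ((measurable_pi_apply i).comp (L.measurable_W a)) (fun ω => L.nonneg_W a ω i)
    (L.integrable_W a i)).1

lemma regular_of_isFiniteMeasureOnCompacts (μ : Measure (PuncturedSpace n))
    [IsFiniteMeasureOnCompacts μ] : μ.Regular := by
  have h1 : LocallyCompactSpace (PuncturedSpace n) := isOpen_punctured.locallyCompactSpace
  have h2 : SecondCountableTopology (PuncturedSpace n) :=
    TopologicalSpace.Subtype.secondCountableTopology {v : Fin n → EReal | v ≠ 0}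
  infer_instance

lemma VectorLimit.limitSum_ne_zero [IsProbabilityMeasure P] (L : VectorLimit P X α h s W) :
    limitSum P α s W ≠ 0 := by
  intro hzero
  obtain ⟨a, ha, hne⟩ := L.nondegenerate
  refine hne ?_
  have h1 : limitSum P α s W univ = 0 := by rw [hzero]; rfl
  rw [limitSum_apply, Finset.sum_eq_zero_iff] at h1
  have h2 := h1 a ha
  have h3 : (Subtype.val '' (univ : Set (PuncturedSpace n)) : Set (Fin n → EReal)) =
      {v | v ≠ 0} := by
    ext v
    exact ⟨fun ⟨w, _, hw⟩ => hw ▸ w.2, fun hv => ⟨⟨v, hv⟩, mem_univ _, rfl⟩⟩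
  rw [h3, limitLaw, Measure.map_apply (measurable_coe_scaleVec (L.measurable_W a))
    isOpen_punctured.measurableSet] at h2
  have h4 : {ω | W a ω ≠ 0} ×ˢ Ioi (1 : ℝ) ⊆
      (fun q => fun i => ((scaleVec (W a) q i : ℝ) : EReal)) ⁻¹' {v | v ≠ 0} := by
    rintro ⟨ω, z⟩ ⟨hω, hz⟩
    have hω : W a ω ≠ 0 := hω
    have hz : 1 < z := hz
    obtain ⟨i, hi⟩ := Function.ne_iff.1 hω
    refine fun h0 => hi ?_
    have h5 : ((z * W a ω i : ℝ) : EReal) = 0 := congrFun h0 i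
    rw [EReal.coe_eq_zero] at h5
    exact (mul_eq_zero.1 h5).resolve_left (by linarith)
  have h5 := measure_mono_null h4 h2
  rw [Measure.prod_prod, powerMeasure_Ioi L.index_pos one_pos, mul_eq_zero] at h5
  exact h5.resolve_right (by simp)

lemma VectorLimit.integral_limitSum [IsProbabilityMeasure P] (L : VectorLimit P X α h s W)
    {f : PuncturedSpace n → ℝ} (hf : Continuous f) (hc : HasCompactSupport f) :
    ∫ v, f v ∂(limitSum P α s W) = ∑ a ∈ s, ∫ q, Function.extend Subtype.val f 0
      (fun i => ((scaleVec (W a) q i : ℝ) : EReal)) ∂(P.prod (powerMeasure α)) := by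
  have hFc : Continuous (Function.extend Subtype.val f 0 : (Fin n → EReal) → ℝ) :=
    HasCompactSupport.continuous_extend_zero (U := {v : Fin n → EReal | v ≠ 0})
      isOpen_punctured hf hc
  have hint : ∀ a ∈ s, Integrable (Function.extend Subtype.val f 0 : (Fin n → EReal) → ℝ)
      (limitLaw P α (W a)) := fun a _ =>
    (integrable_map_measure hFc.measurable.aestronglyMeasurable
      (measurable_coe_scaleVec (L.measurable_W a)).aemeasurable).2
      ((isTest_extend hf hc).integrable L.index_pos (L.measurable_W a) (L.nonneg_W a)
        (L.integrable_W a))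
  rw [limitSum, integral_comap_punctured, integral_finsetSum_measure hint]
  exact Finset.sum_congr rfl fun a _ => integral_map
    (measurable_coe_scaleVec (L.measurable_W a)).aemeasurable hFc.measurable.aestronglyMeasurable

lemma integral_scaledLaw (hX : Measurable X) {f : PuncturedSpace n → ℝ} (hf : Continuous f)
    (hc : HasCompactSupport f) (x : ℝ) :
    ∫ v, f v ∂(scaledLaw P X x) =
      ∫ ω, Function.extend Subtype.val f 0 (fun i => ((x⁻¹ * X ω i : ℝ) : EReal)) ∂P := by
  have hFc : Continuous (Function.extend Subtype.val f 0 : (Fin n → EReal) → ℝ) :=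
    HasCompactSupport.continuous_extend_zero (U := {v : Fin n → EReal | v ≠ 0})
      isOpen_punctured hf hc
  have hm : Measurable fun ω => fun i => ((x⁻¹ * X ω i : ℝ) : EReal) :=
    measurable_coe_pi.comp (measurable_pi_lambda _ fun i =>
      measurable_const.mul ((measurable_pi_apply i).comp hX))
  rw [scaledLaw, integral_comap_punctured, integral_map hm.aemeasurable
    hFc.measurable.aestronglyMeasurable]

/-- A vector limit in the sense of `VectorLimit` is regular variation of the vector. -/
theorem VectorLimit.regularlyVarying [IsProbabilityMeasure P] (L : VectorLimit P X α h s W)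
    (N : Seminorm ℝ (Fin n → ℝ)) (hN : ∀ v, N v = 0 → v = 0) :
    ∃ μ : Measure (PuncturedSpace n), RegularlyVaryingVector P X α N μ ∧
      ∃ c : ℝ≥0, 0 < c ∧ ∀ B : Set (Fin n → EReal), MeasurableSet B → 0 ∉ closure B →
        μ (Subtype.val ⁻¹' B) = c * ∑ a ∈ s,
          ∫⁻ z, P {ω | (fun i => ((z * W a ω i : ℝ) : EReal)) ∈ B} ∂(powerMeasure α) := by
  have hκ := L.normMass_pos hN
  set κ := normMass P α s W N
  have hκ' : (0 : ℝ) < κ⁻¹ := inv_pos.2 hκ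
  -- κ is the limit of P(N X > x) / h x, so κ⁻¹ converts the normalization by h into that by the
  -- norm.
  set c : ℝ≥0 := ⟨κ⁻¹, hκ'.le⟩ with hc
  have hc0 : 0 < c := hκ'
  have hfc := L.isFiniteMeasureOnCompacts
  have hfc' : IsFiniteMeasureOnCompacts (c • limitSum P α s W) :=
    ⟨fun K hK => by
      rw [Measure.smul_apply]
      exact ENNReal.mul_lt_top ENNReal.coe_lt_top hK.measure_lt_top⟩
  refine ⟨c • limitSum P α s W, ⟨L.index_pos, ?_, regular_of_isFiniteMeasureOnCompacts _, ?_, ?_⟩,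
    c, hc0, ?_⟩
  · intro h0
    have h1 : limitSum P α s W = c⁻¹ • (c • limitSum P α s W) := by
      rw [smul_smul, inv_mul_cancel₀ hc0.ne', one_smul]
    exact L.limitSum_ne_zero (by rw [h1, h0, smul_zero])
  · intro t ht B hB
    rw [Measure.smul_apply, Measure.smul_apply, limitSum_dilate L.index_pos L.measurable_W ht hB]
    exact mul_left_comm _ _ _
  · intro f hf hcs
    have h1 := (L.tendsto_norm_tail N).inv₀ hκ.ne'
    have h2 := h1.mul (L.tendsto _ (isTest_extend hf hcs))
    rw [← L.integral_limitSum hf hcs] at h2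
    have h3 : ∫ v, f v ∂(c • limitSum P α s W) = κ⁻¹ * ∫ v, f v ∂(limitSum P α s W) :=
      integral_smul_nnreal_measure f c
    rw [h3]
    refine h2.congr' ?_
    filter_upwards [L.pos] with x hx
    rw [integral_smul_measure, integral_scaledLaw L.measurable_X hf hcs, ENNReal.toReal_inv,
      smul_eq_mul, inv_div, ← measureReal_def]
    field_simp
  · intro B hB hB0
    have himg : (Subtype.val '' (Subtype.val ⁻¹' B : Set (PuncturedSpace n)) :
        Set (Fin n → EReal)) = B := by
      ext v
      constructor
      · rintro ⟨w, hw, rfl⟩; exact hw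
      · intro hv
        exact ⟨⟨v, fun h0 => hB0 (subset_closure (h0 ▸ hv))⟩, hv, rfl⟩
    rw [Measure.smul_apply, limitSum_apply, himg]
    refine congrArg (fun y => (c : ℝ≥0∞) * y) (Finset.sum_congr rfl fun a _ => ?_)
    exact limitLaw_apply (L.measurable_W a) hB

end Main

/-! ### Independent samples and moments of monomials -/

section Sample

variable {Ω : Type*} [MeasurableSpace Ω] {P : Measure Ω} {n p : ℕ} {α β : ℝ} {ρ : Measure ℝ}
  {Y : Fin p → Ω → ℝ} {a : Fin n → Fin p → ℝ}

/-- Independent nonnegative random variables with common law `ρ`. -/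
structure IIDSample (P : Measure Ω) (Y : Fin p → Ω → ℝ) (ρ : Measure ℝ) : Prop where
  measurable : ∀ j, Measurable (Y j)
  nonneg : ∀ j ω, 0 ≤ Y j ω
  indep : iIndepFun Y P
  law : ∀ j, P.map (Y j) = ρ

lemma IIDSample.comp (I : IIDSample P Y ρ) {g : ℝ → ℝ} (hg : Measurable g)
    (hg0 : ∀ y, 0 ≤ y → 0 ≤ g y) : IIDSample P (fun j ω => g (Y j ω)) (ρ.map g) where
  measurable j := hg.comp (I.measurable j)
  nonneg j ω := hg0 _ (I.nonneg j ω)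
  indep := I.indep.comp (fun _ => g) fun _ => hg
  law j := by rw [← I.law j, Measure.map_map hg (I.measurable j)]; rfl

lemma IIDSample.ae_nonneg (I : IIDSample P Y ρ) (j : Fin p) : ∀ᵐ y ∂ρ, 0 ≤ y := by
  rw [← I.law j]
  exact (ae_map_iff (I.measurable j).aemeasurable measurableSet_Ici).2
    (Eventually.of_forall (I.nonneg j))

lemma IIDSample.measurable_prod (I : IIDSample P Y ρ) (A : Finset (Fin p)) :
    Measurable fun ω => ∏ j ∈ A, Y j ω := Finset.measurable_fun_prod A fun j _ => I.measurable j

lemma IIDSample.prod_nonneg (I : IIDSample P Y ρ) (A : Finset (Fin p)) (ω : Ω) :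
    0 ≤ ∏ j ∈ A, Y j ω := Finset.prod_nonneg fun j _ => I.nonneg j ω

lemma IIDSample.map_prod [IsProbabilityMeasure P] (I : IIDSample P Y ρ) (A : Finset (Fin p)) :
    P.map (fun ω => ∏ j ∈ A, Y j ω) = powLaw ρ A.card := by
  induction A using Finset.induction_on with
  | empty => simp [powLaw, Measure.map_const]
  | insert k A hk ih =>
    have h1 : (fun ω => ∏ j ∈ insert k A, Y j ω) = (∏ j ∈ A, Y j) * Y k := by
      ext ω; simp [Finset.prod_insert hk, mul_comm]
    have h2 : (∏ j ∈ A, Y j) = fun ω => ∏ j ∈ A, Y j ω := by ext ω; simp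
    have hp : IsProbabilityMeasure (P.map (Y k)) :=
      Measure.isProbabilityMeasure_map (I.measurable k).aemeasurable
    rw [h1, (I.indep.indepFun_finsetProd_of_notMem I.measurable hk).map_mul_eq_map_mconv_map
      (h2 ▸ I.measurable_prod A) (I.measurable k), I.law k, h2, ih,
      Finset.card_insert_of_notMem hk, powLaw]

lemma IIDSample.indepFun_compl (I : IIDSample P Y ρ) (A : Finset (Fin p)) {E : Type*}
    [MeasurableSpace E] {G : (↥(Aᶜ) → ℝ) → E} (hG : Measurable G) :
    IndepFun (fun ω => ∏ j ∈ A, Y j ω) (fun ω => G fun k => Y k ω) P := by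
  have h1 := (I.indep.indepFun_finset A Aᶜ disjoint_compl_right I.measurable).comp
    (φ := fun y : ↥A → ℝ => ∏ j, y j) (ψ := G)
    (Finset.measurable_fun_prod _ fun j _ => measurable_pi_apply j) hG
  have h2 : (fun ω => ∏ j ∈ A, Y j ω) = (fun y : ↥A → ℝ => ∏ j, y j) ∘ fun ω (j : A) => Y j ω := by
    ext ω
    exact (Finset.prod_coe_sort A fun j => Y j ω).symm
  rw [h2]
  exact h1

lemma integrable_prod_of_iIndepFun [IsProbabilityMeasure P] {Z : Fin p → Ω → ℝ}
    (hZ : iIndepFun Z P) (hm : ∀ j, Measurable (Z j)) (A : Finset (Fin p))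
    (hi : ∀ j ∈ A, Integrable (Z j) P) : Integrable (fun ω => ∏ j ∈ A, Z j ω) P := by
  induction A using Finset.induction_on with
  | empty => simp
  | insert k A hk ih =>
    have h1 : (fun ω => ∏ j ∈ insert k A, Z j ω) = (∏ j ∈ A, Z j) * Z k := by
      ext ω; simp [Finset.prod_insert hk, mul_comm]
    have h2 : (∏ j ∈ A, Z j) = fun ω => ∏ j ∈ A, Z j ω := by ext ω; simp
    rw [h1]
    exact (hZ.indepFun_finsetProd_of_notMem hm hk).integrable_mul
      (h2 ▸ ih fun j hj => hi j (Finset.mem_insert_of_mem hj)) (hi k (Finset.mem_insert_self _ _))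

/-- At β = α the inequalities are strict, so each persists slightly to the right of α, and there are
finitely many. Exponents below one thus leave room for a moment beyond the index. -/
lemma exists_moment_exponent {κ : Type*} [Finite κ] (hα : 0 < α) (e : κ → ℝ) :
    ∃ β > α, ∀ k, e k < 1 → e k * β < α := by
  have h1 : ∀ k, ∀ᶠ β in 𝓝[>] α, e k < 1 → e k * β < α := by
    intro k
    by_cases hk : e k < 1
    · have h2 : Tendsto (fun β => e k * β) (𝓝[>] α) (𝓝 (e k * α)) :=
        ((continuous_const.mul continuous_id).tendsto α).mono_left nhdsWithin_le_nhds
      filter_upwards [h2.eventually (gt_mem_nhds (show e k * α < α by nlinarith))] with β hβ _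
        using hβ
    · exact Eventually.of_forall fun β h => absurd h hk
  obtain ⟨β, hβ, h⟩ := ((eventually_mem_nhdsWithin (a := α) (s := Ioi α)).and
    (eventually_all.2 h1)).exists
  exact ⟨β, hβ, h⟩

lemma max_one_prod_rpow_le {e y : Fin p → ℝ} (he : ∀ k, 0 ≤ e k) (hy : ∀ k, 0 ≤ y k) (hβ : 0 ≤ β)
    (A : Finset (Fin p)) :
    max 1 (∏ k ∈ A, y k ^ e k) ^ β ≤ ∏ k ∈ A, max 1 (y k) ^ (e k * β) := by
  have h1 : ∀ k, 1 ≤ max 1 (y k) ^ e k := fun k => Real.one_le_rpow (le_max_left _ _) (he k)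
  have h2 : max 1 (∏ k ∈ A, y k ^ e k) ≤ ∏ k ∈ A, max 1 (y k) ^ e k :=
    max_le (Finset.prod_induction _ (fun z => (1 : ℝ) ≤ z)
        (fun _ _ => one_le_mul_of_one_le_of_one_le) le_rfl fun k _ => h1 k)
      (Finset.prod_le_prod (fun k _ => Real.rpow_nonneg (hy k) _) fun k _ =>
        Real.rpow_le_rpow (hy k) (le_max_right _ _) (he k))
  calc max 1 (∏ k ∈ A, y k ^ e k) ^ β ≤ (∏ k ∈ A, max 1 (y k) ^ e k) ^ β :=
        Real.rpow_le_rpow (by positivity) h2 hβ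
    _ = ∏ k ∈ A, (max 1 (y k) ^ e k) ^ β :=
        (Real.finsetProd_rpow _ _ (fun k _ => by positivity) _).symm
    _ = _ := Finset.prod_congr rfl fun k _ => (Real.rpow_mul (by positivity) _ _).symm

/-- Only moments of the single variables below the index are involved; they are finite, and
independence multiplies them. -/
lemma IIDSample.integrable_max_prod_rpow [IsProbabilityMeasure P] [IsProbabilityMeasure ρ]
    (I : IIDSample P Y ρ) (h : RVTail ρ α) {e : Fin p → ℝ} (he : ∀ k, 0 ≤ e k) (hβ : 0 ≤ β)
    (A : Finset (Fin p)) (heA : ∀ k ∈ A, e k * β < α) :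
    Integrable (fun ω => max 1 (∏ k ∈ A, Y k ω ^ e k) ^ β) P := by
  have hm : ∀ k, Measurable fun ω => max 1 (Y k ω) ^ (e k * β) := fun k =>
    (measurable_const.max (I.measurable k)).pow_const _
  have h1 : Integrable (fun ω => ∏ k ∈ A, max 1 (Y k ω) ^ (e k * β)) P := by
    refine integrable_prod_of_iIndepFun (Z := fun k ω => max 1 (Y k ω) ^ (e k * β)) ?_ hm A
      fun k hk => ?_
    · exact I.indep.comp (fun k y => max 1 y ^ (e k * β)) fun k =>
        (measurable_const.max measurable_id).pow_const _
    · have h2 := h.integrable_rpow_of_lt (mul_nonneg (he k) hβ) (heA k hk)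
      rw [← I.law k] at h2
      exact (integrable_map_measure
        ((measurable_const.max measurable_id).pow_const _).aestronglyMeasurable
        (I.measurable k).aemeasurable).1 h2
  refine h1.mono' ?_ (Eventually.of_forall fun ω => ?_)
  · exact ((measurable_const.max (Finset.measurable_fun_prod A fun k _ =>
      (I.measurable k).pow_const _)).pow_const β).aestronglyMeasurable
  · rw [Real.norm_of_nonneg (by positivity)]
    exact max_one_prod_rpow_le he (fun k => I.nonneg k ω) hβ A

/-! ### The residual factor of the product vector -/

open Classical in
/-- The vector `(1(a_ij = 1 for all j ∈ A) ∏ k ∉ A, y_k ^ a_ik)_i`. -/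
noncomputable def residualVector (a : Fin n → Fin p → ℝ) (A : Finset (Fin p)) (y : Fin p → ℝ) :
    Fin n → ℝ :=
  fun i => if ∀ j ∈ A, a i j = 1 then ∏ k ∈ Aᶜ, y k ^ a i k else 0

lemma residualVector_nonneg {y : Fin p → ℝ} (hy : ∀ k, 0 ≤ y k) (A : Finset (Fin p)) (i : Fin n) :
    0 ≤ residualVector a A y i := by
  unfold residualVector
  split_ifs
  · exact Finset.prod_nonneg fun k _ => Real.rpow_nonneg (hy k) _
  · exact le_rfl

lemma productVector_nonneg {y : Fin p → ℝ} (hy : ∀ k, 0 ≤ y k) (i : Fin n) :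
    0 ≤ productVector a y i := Finset.prod_nonneg fun k _ => Real.rpow_nonneg (hy k) _

lemma prod_mul_residualVector_of_forall {A : Finset (Fin p)} {y : Fin p → ℝ} {i : Fin n}
    (hi : ∀ j ∈ A, a i j = 1) : (∏ j ∈ A, y j) * residualVector a A y i = productVector a y i := by
  rw [residualVector, if_pos hi, productVector, ← Finset.prod_mul_prod_compl A]
  congr 1
  exact Finset.prod_congr rfl fun j hj => by rw [hi j hj, Real.rpow_one]

lemma residualVector_of_not_forall {A : Finset (Fin p)} {y : Fin p → ℝ} {i : Fin n}
    (hi : ¬ ∀ j ∈ A, a i j = 1) : residualVector a A y i = 0 := by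
  rw [residualVector, if_neg hi]

lemma IIDSample.measurable_productVector (I : IIDSample P Y ρ) :
    Measurable fun ω => productVector a fun j => Y j ω :=
  measurable_pi_lambda _ fun _ =>
    Finset.measurable_fun_prod _ fun j _ => (I.measurable j).pow_const _

lemma measurable_residualVector (a : Fin n → Fin p → ℝ) (A : Finset (Fin p)) :
    Measurable (residualVector a A) := by
  refine measurable_pi_lambda _ fun i => ?_
  unfold residualVector
  split_ifs
  · exact Finset.measurable_fun_prod _ fun k _ => (measurable_pi_apply k).pow_const _
  · exact measurable_const

/-- The residual vector as a function of the coordinates outside of `A`. -/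
lemma exists_residualVector_factor (a : Fin n → Fin p → ℝ) (A : Finset (Fin p)) :
    ∃ G : (↥(Aᶜ) → ℝ) → Fin n → ℝ, Measurable G ∧
      ∀ y : Fin p → ℝ, G (fun k => y k) = residualVector a A y := by
  classical
  refine ⟨fun u i => if ∀ j ∈ A, a i j = 1 then ∏ k, u k ^ a i k else 0,
    measurable_pi_lambda _ fun i => ?_, fun y => ?_⟩
  · split_ifs
    · exact Finset.measurable_fun_prod _ fun k _ => (measurable_pi_apply k).pow_const _
    · exact measurable_const
  · ext i
    have h1 := Finset.prod_coe_sort Aᶜ fun k => y k ^ a i k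
    simp only [residualVector, h1]

lemma IIDSample.indepFun_residualVector (I : IIDSample P Y ρ) (A : Finset (Fin p)) :
    IndepFun (fun ω => ∏ j ∈ A, Y j ω) (fun ω => residualVector a A fun j => Y j ω) P := by
  obtain ⟨G, hG, hGe⟩ := exists_residualVector_factor a A
  have h1 : (fun ω => residualVector a A fun j => Y j ω) = fun ω => G fun k => Y k ω :=
    funext fun ω => (hGe fun j => Y j ω).symm
  rw [h1]
  exact I.indepFun_compl A hG

/-- On the event that all variables exceed 1, which has positive probability by independence, the
i-th coordinate is positive. -/
lemma IIDSample.measure_residualVector_ne_zero [IsProbabilityMeasure P] (I : IIDSample P Y ρ)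
    (h : RVTail ρ α) {A : Finset (Fin p)} {i : Fin n} (hi : ∀ j ∈ A, a i j = 1) :
    P {ω | residualVector a A (fun j => Y j ω) ≠ 0} ≠ 0 := by
  have h1 := I.indep.measure_inter_preimage_eq_mul Finset.univ (sets := fun _ => Ioi (1 : ℝ))
    fun _ _ => measurableSet_Ioi
  have h2 : ∀ j, P (Y j ⁻¹' Ioi 1) ≠ 0 := fun j h0 => by
    rw [← Measure.map_apply (I.measurable j) measurableSet_Ioi, I.law j] at h0
    have := h.tail_pos 1
    rw [tail, measureReal_def, h0] at this
    simp at this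
  intro h0
  have h3 : P (⋂ j ∈ (Finset.univ : Finset (Fin p)), Y j ⁻¹' Ioi 1) = 0 := by
    refine measure_mono_null (fun ω hω => ?_) h0
    have hY : ∀ j, 1 < Y j ω := fun j => by
      have := mem_iInter₂.1 hω j (Finset.mem_univ j)
      exact this
    refine fun hz => ?_
    have h4 : residualVector a A (fun j => Y j ω) i = 0 := congrFun hz i
    rw [residualVector, if_pos hi] at h4
    refine (Finset.prod_pos fun k _ => ?_).ne' h4
    have := hY k
    positivity
  rw [h1] at h3
  exact Finset.prod_ne_zero_iff.2 (fun j _ => h2 j) h3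

lemma abs_integral_le_of_indicator [IsProbabilityMeasure P] {f : Ω → ℝ} {B₀ B₁ : Set Ω}
    {c₀ c₁ : ℝ} (hB₀ : MeasurableSet B₀) (hB₁ : MeasurableSet B₁)
    (h : ∀ ω, |f ω| ≤ B₀.indicator (fun _ => c₀) ω + B₁.indicator (fun _ => c₁) ω) :
    |∫ ω, f ω ∂P| ≤ c₀ * P.real B₀ + c₁ * P.real B₁ := by
  have h0 : Integrable (B₀.indicator fun _ => c₀) P := (integrable_const _).indicator hB₀
  have h1 : Integrable (B₁.indicator fun _ => c₁) P := (integrable_const _).indicator hB₁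
  have h2 : ‖∫ ω, f ω ∂P‖ ≤ ∫ ω, (B₀.indicator (fun _ => c₀) + B₁.indicator fun _ => c₁) ω ∂P :=
    norm_integral_le_of_norm_le (h0.add h1) (Eventually.of_forall h)
  rw [integral_add' h0 h1, integral_indicator_const _ hB₀, integral_indicator_const _ hB₁,
    smul_eq_mul, smul_eq_mul, mul_comm, mul_comm _ c₁] at h2
  exact h2

end Sample

/-! ### Infinite moment: comparing monomials and rows -/

section InfiniteMoment

variable {Ω : Type*} [MeasurableSpace Ω] {P : Measure Ω} {n p : ℕ} {α : ℝ} {ρ : Measure ℝ}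
  {Y : Fin p → Ω → ℝ} {a : Fin n → Fin p → ℝ}

lemma RVTail.tendsto_scale {ρ : Measure ℝ} (h : RVTail ρ α) {g : ℝ → ℝ} {l η : ℝ}
    (hg : Tendsto (fun x => g x / tail ρ x) atTop (𝓝 l)) (hη : 0 < η) :
    Tendsto (fun x => g (η * x) / tail ρ x) atTop (𝓝 (l * η ^ (-α))) := by
  have h1 : Tendsto (fun x => g (η * x) / tail ρ (η * x)) atTop (𝓝 l) :=
    hg.comp (tendsto_id.const_mul_atTop hη)
  refine (h1.mul (h.tendsto_ratio η hη)).congr fun x => ?_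
  rw [div_mul_div_cancel₀ (h.tail_pos _).ne']

lemma measureReal_lt_mul_of_indepFun [IsProbabilityMeasure P] {V T : Ω → ℝ} (hV : Measurable V)
    (hT : Measurable T) (hVT : IndepFun V T P) (x : ℝ) :
    P.real {ω | x < V ω * T ω} = prodTail (P.map V) (P.map T) x := by
  unfold prodTail
  rw [← (indepFun_iff_map_prod_eq_prod_map_map hV.aemeasurable hT.aemeasurable).1 hVT,
    map_measureReal_apply (hV.prodMk hT) (measurableSet_lt_mul x)]
  rfl

open Classical in
/-- The tail of a monomial with exponents in `[0, 1]` compared to the tail of a product of `q`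
variables, `q` being at least the number of exponents equal to `1`. -/
lemma IIDSample.tendsto_tail_monomial [IsProbabilityMeasure P] [IsProbabilityMeasure ρ]
    (I : IIDSample P Y ρ) (h : RVTail ρ α) (hρ : ∀ᵐ y ∂ρ, 0 ≤ y)
    (hi : ¬ Integrable (fun z => z ^ α) ρ) {q : ℕ} (hq : q ≠ 0) {e : Fin p → ℝ}
    (he0 : ∀ k, 0 ≤ e k) (he1 : ∀ k, e k ≤ 1)
    (hcard : (Finset.univ.filter fun k => e k = 1).card ≤ q) :
    ∃ l, Tendsto (fun x => P.real {ω | x < ∏ k, Y k ω ^ e k} / tail (powLaw ρ q) x) atTop (𝓝 l) ∧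
      ((Finset.univ.filter fun k => e k = 1).card < q → l = 0) := by
  -- `T` collects the exponents equal to one and has the law of a power. `V` has only exponents
  -- below one, hence a moment beyond the index, and is the light factor in Breiman's lemma.
  set J := Finset.univ.filter fun k => e k = 1 with hJ
  obtain ⟨β, hβ, hβe⟩ := exists_moment_exponent h.index_pos e
  have hβ0 : 0 ≤ β := (h.index_pos.trans hβ).le
  let V : Ω → ℝ := fun ω => ∏ k ∈ Jᶜ, Y k ω ^ e k
  let T : Ω → ℝ := fun ω => ∏ k ∈ J, Y k ω
  have hVm : Measurable V := Finset.measurable_fun_prod _ fun k _ => (I.measurable k).pow_const _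
  have hTm : Measurable T := I.measurable_prod J
  have hV0 : ∀ ω, 0 ≤ V ω := fun ω =>
    Finset.prod_nonneg fun k _ => Real.rpow_nonneg (I.nonneg k ω) _
  have hind : IndepFun V T P := by
    have h1 := I.indepFun_compl J (G := fun u : ↥(Jᶜ) → ℝ => ∏ k, u k ^ e k)
      (Finset.measurable_fun_prod _ fun k _ => (measurable_pi_apply k).pow_const _)
    have h2 : V = fun ω => (fun u : ↥(Jᶜ) → ℝ => ∏ k, u k ^ e k) fun k => Y k ω :=
      funext fun ω => (Finset.prod_coe_sort Jᶜ fun k => Y k ω ^ e k).symm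
    rw [h2]
    exact h1.symm
  have hprod : ∀ ω, ∏ k, Y k ω ^ e k = V ω * T ω := fun ω => by
    rw [← Finset.prod_compl_mul_prod J]
    congr 1
    refine Finset.prod_congr rfl fun k hk => ?_
    rw [(Finset.mem_filter.1 hk).2, Real.rpow_one]
  simp_rw [hprod, measureReal_lt_mul_of_indepFun hVm hTm hind]
  have hlaw : P.map T = powLaw ρ J.card := I.map_prod J
  rw [hlaw]
  have hq' := h.powLaw hρ hi hq
  have hVp : IsProbabilityMeasure (P.map V) := Measure.isProbabilityMeasure_map hVm.aemeasurable
  have hVnn : ∀ᵐ v ∂(P.map V), 0 ≤ v :=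
    (ae_map_iff hVm.aemeasurable measurableSet_Ici).2 (Eventually.of_forall hV0)
  have hVi : Integrable (fun v => max 1 v ^ β) (P.map V) := by
    refine (integrable_map_measure
      ((measurable_const.max measurable_id).pow_const _).aestronglyMeasurable
      hVm.aemeasurable).2 ?_
    refine I.integrable_max_prod_rpow h he0 hβ0 Jᶜ fun k hk => hβe k ?_
    have : e k ≠ 1 := fun h1 => (Finset.mem_compl.1 hk) (Finset.mem_filter.2 ⟨Finset.mem_univ _, h1⟩)
    exact lt_of_le_of_ne (he1 k) this
  rcases hcard.eq_or_lt with heq | hlt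
  · rw [heq]
    exact ⟨_, hq'.tendsto_prodTail hβ hq'.tendsto_self hVnn hVi, fun h1 => absurd h1 (lt_irrefl _)⟩
  · refine ⟨_, hq'.tendsto_prodTail hβ (h.tail_powLaw_isLittle hρ hi hlt) hVnn hVi, fun _ => ?_⟩
    rw [zero_mul]

open Classical in
/-- The columns on which a row is equal to `1`. -/
noncomputable def fullColumns (a : Fin n → Fin p → ℝ) (i : Fin n) : Finset (Fin p) :=
  Finset.univ.filter fun j => a i j = 1

lemma mem_fullColumns {i : Fin n} {j : Fin p} : j ∈ fullColumns a i ↔ a i j = 1 := by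
  simp [fullColumns]

lemma filter_eq_fullColumns (i : Fin n) [DecidablePred fun k => a i k = 1] :
    (Finset.univ.filter fun k => a i k = 1) = fullColumns a i := by
  ext k
  simp [mem_fullColumns]

lemma card_fullColumns_le (i : Fin n) : (fullColumns a i).card ≤ pEff a 1 := by
  unfold pEff
  exact Finset.le_sup (f := fun i => (fullColumns a i).card) (Finset.mem_univ i)

/-- A set of `pEff` columns on which row i equals one exhausts all such columns of that row, by
maximality of `pEff`. So each row supports at most one member of `PEff`. -/
lemma mem_PEff {A : Finset (Fin p)} :
    A ∈ PEff a 1 ↔ A.card = pEff a 1 ∧ ∃ i, fullColumns a i = A := by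
  have h1 : A ∈ PEff a 1 ↔ A.card = pEff a 1 ∧ ∃ i, ∀ j ∈ A, a i j = 1 := by simp [PEff]
  rw [h1]
  refine and_congr_right fun hA => exists_congr fun i => ⟨fun h => ?_, ?_⟩
  · refine (Finset.eq_of_subset_of_card_le (fun j hj => mem_fullColumns.2 (h j hj)) ?_).symm
    rw [hA]
    exact card_fullColumns_le i
  · rintro rfl j hj
    exact mem_fullColumns.1 hj

lemma forall_eq_one_iff {A : Finset (Fin p)} (hA : A.card = pEff a 1) {i : Fin n} :
    (∀ j ∈ A, a i j = 1) ↔ fullColumns a i = A := by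
  refine ⟨fun h => ?_, ?_⟩
  · refine (Finset.eq_of_subset_of_card_le (fun j hj => mem_fullColumns.2 (h j hj)) ?_).symm
    rw [hA]
    exact card_fullColumns_le i
  · rintro rfl j hj
    exact mem_fullColumns.1 hj

/-- The product of the factors in `A`, times the residual vector. -/
noncomputable def maskedVector (a : Fin n → Fin p → ℝ) (A : Finset (Fin p)) (y : Fin p → ℝ) :
    Fin n → ℝ := fun i => (∏ j ∈ A, y j) * residualVector a A y i

lemma maskedVector_eq {A : Finset (Fin p)} {y : Fin p → ℝ} {i : Fin n} :
    ((∀ j ∈ A, a i j = 1) ∧ maskedVector a A y i = productVector a y i) ∨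
      ((¬ ∀ j ∈ A, a i j = 1) ∧ maskedVector a A y i = 0) := by
  by_cases hi : ∀ j ∈ A, a i j = 1
  · exact Or.inl ⟨hi, prod_mul_residualVector_of_forall hi⟩
  · exact Or.inr ⟨hi, by rw [maskedVector, residualVector_of_not_forall hi, mul_zero]⟩

lemma abs_sub_sum_le {κ : Type*} {s : Finset κ} {φ : (Fin n → ℝ) → ℝ} {K : ℝ}
    (hK : ∀ v, |φ v| ≤ K) (u : Fin n → ℝ) (w : κ → Fin n → ℝ) :
    |φ u - ∑ A ∈ s, φ (w A)| ≤ (1 + s.card) * K := by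
  calc |φ u - ∑ A ∈ s, φ (w A)| ≤ |φ u| + |∑ A ∈ s, φ (w A)| := abs_sub _ _
    _ ≤ K + ∑ A ∈ s, K := add_le_add (hK _)
        ((Finset.abs_sum_le_sum_abs _ _).trans (Finset.sum_le_sum fun A _ => hK _))
    _ = _ := by rw [Finset.sum_const, nsmul_eq_mul]; ring

/-- Off an exceptional event only one set of columns contributes to a test function. -/
lemma abs_test_sub_sum_maskedVector_le {φ : (Fin n → ℝ) → ℝ} {ε δ η x : ℝ}
    (hv : ∀ v, (∀ i, 0 ≤ v i ∧ v i ≤ ε) → φ v = 0)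
    (hmod : ∀ u v, (∀ i, 0 ≤ v i ∧ (u i = v i ∨ (u i = 0 ∧ v i ≤ η))) → |φ u - φ v| ≤ δ)
    (hε : 0 < ε) (hη : η ≤ ε) (hx : 0 < x) {y : Fin p → ℝ} (hy : ∀ k, 0 ≤ y k)
    (h1 : ∀ i, (fullColumns a i).card < pEff a 1 → productVector a y i ≤ η * x)
    (h2 : ∀ i i', fullColumns a i ≠ fullColumns a i' →
      productVector a y i ≤ η * x ∨ productVector a y i' ≤ η * x) :
    |φ (fun i => x⁻¹ * productVector a y i) -
      ∑ A ∈ PEff a 1, φ (fun i => x⁻¹ * maskedVector a A y i)| ≤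
      {y : Fin p → ℝ | ∃ i, ε * x < productVector a y i}.indicator (fun _ => δ) y := by
  have hX0 : ∀ i, 0 ≤ x⁻¹ * productVector a y i := fun i =>
    mul_nonneg (inv_nonneg.2 hx.le) (productVector_nonneg hy i)
  have hscale : ∀ {i c}, productVector a y i ≤ c * x → x⁻¹ * productVector a y i ≤ c := by
    intro i c h
    rw [inv_mul_le_iff₀ hx, mul_comm]
    exact h
  have hmask0 : ∀ A, (∀ i, (∀ j ∈ A, a i j = 1) → productVector a y i ≤ ε * x) →
      φ (fun i => x⁻¹ * maskedVector a A y i) = 0 := by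
    intro A hA
    refine hv _ fun i => ?_
    rcases maskedVector_eq (a := a) (A := A) (y := y) (i := i) with ⟨hi, he⟩ | ⟨-, he⟩
    · rw [he]; exact ⟨hX0 i, hscale (hA i hi)⟩
    · rw [he, mul_zero]; exact ⟨le_rfl, hε.le⟩
  have hηε : ∀ {i}, productVector a y i ≤ η * x → productVector a y i ≤ ε * x := fun h =>
    h.trans (by gcongr)
  by_cases hbig : ∃ i, ε * x < productVector a y i
  · rw [indicator_of_mem (show y ∈ {y : Fin p → ℝ | ∃ i, ε * x < productVector a y i} from hbig)]
    obtain ⟨i₀, hi₀⟩ := hbig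
    have hi₀' : ¬ productVector a y i₀ ≤ η * x := fun h => absurd (hηε h) (not_le.2 hi₀)
    have hA : fullColumns a i₀ ∈ PEff a 1 := by
      refine mem_PEff.2 ⟨le_antisymm (card_fullColumns_le i₀) (not_lt.1 fun h => hi₀' (h1 _ h)),
        i₀, rfl⟩
    have hcard := (mem_PEff.1 hA).1
    -- Only the column set of the large row survives: by `h2` rows with another column set are below
    -- η x, so masking them is covered by the modulus, and the terms of the other sets vanish.
    rw [Finset.sum_eq_single_of_mem _ hA]
    · rw [abs_sub_comm]
      refine hmod _ _ fun i => ⟨hX0 i, ?_⟩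
      rcases maskedVector_eq (a := a) (A := fullColumns a i₀) (y := y) (i := i)
        with ⟨-, he⟩ | ⟨hi, he⟩
      · exact Or.inl (by rw [he])
      · refine Or.inr ⟨by rw [he, mul_zero], hscale ?_⟩
        exact (h2 i i₀ fun h => hi ((forall_eq_one_iff hcard).2 h)).resolve_right hi₀'
    · intro A hA' hne
      refine hmask0 A fun i hi => hηε ?_
      rw [forall_eq_one_iff (mem_PEff.1 hA').1] at hi
      exact (h2 i i₀ fun h => hne (hi.symm.trans h)).resolve_right hi₀'
  · rw [indicator_of_notMem (show y ∉ {y : Fin p → ℝ | ∃ i, ε * x < productVector a y i} from hbig)]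
    push Not at hbig
    rw [hv _ fun i => ⟨hX0 i, hscale (hbig i)⟩,
      Finset.sum_eq_zero fun A _ => hmask0 A fun i _ => hbig i]
    simp

/-- An average of two exponents at most one equals one only if both do. The intersection of two
distinct sets with at most `pEff` elements has fewer than `pEff`. -/
lemma card_filter_half_add_lt {i i' : Fin n} (ha1 : ∀ i j, a i j ≤ 1)
    (hne : fullColumns a i ≠ fullColumns a i') [DecidablePred fun k => (a i k + a i' k) / 2 = 1] :
    (Finset.univ.filter fun k => (a i k + a i' k) / 2 = 1).card < pEff a 1 := by
  have h1 : (Finset.univ.filter fun k => (a i k + a i' k) / 2 = 1) =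
      fullColumns a i ∩ fullColumns a i' := by
    ext k
    simp only [Finset.mem_filter, Finset.mem_univ, true_and, Finset.mem_inter, mem_fullColumns]
    constructor
    · intro h
      constructor <;> linarith [ha1 i k, ha1 i' k]
    · rintro ⟨h, h'⟩
      rw [h, h']; norm_num
  rw [h1]
  by_contra hcon
  have h2 : (fullColumns a i).card ≤ (fullColumns a i ∩ fullColumns a i').card :=
    (card_fullColumns_le i).trans (not_lt.1 hcon)
  have h3 : (fullColumns a i').card ≤ (fullColumns a i ∩ fullColumns a i').card :=
    (card_fullColumns_le i').trans (not_lt.1 hcon)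
  have e1 := Finset.eq_of_subset_of_card_le Finset.inter_subset_left h2
  have e2 := Finset.eq_of_subset_of_card_le Finset.inter_subset_right h3
  exact hne (e1.symm.trans e2)

/-- The geometric mean of two rows turns the event that both are large into the tail of one
monomial. -/
lemma lt_prod_half_of_lt {i i' : Fin n} {y : Fin p → ℝ} (ha0 : ∀ i j, 0 ≤ a i j)
    (hy : ∀ k, 0 ≤ y k) {c : ℝ} (hc : 0 ≤ c) (h : c < productVector a y i)
    (h' : c < productVector a y i') : c < ∏ k, y k ^ ((a i k + a i' k) / 2) := by
  have h0 : 0 ≤ ∏ k, y k ^ ((a i k + a i' k) / 2) :=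
    Finset.prod_nonneg fun k _ => Real.rpow_nonneg (hy k) _
  have h1 : (∏ k, y k ^ ((a i k + a i' k) / 2)) ^ 2 =
      productVector a y i * productVector a y i' := by
    unfold productVector
    rw [← Finset.prod_pow, ← Finset.prod_mul_distrib]
    refine Finset.prod_congr rfl fun k _ => ?_
    rw [← Real.rpow_add_of_nonneg (hy k) (ha0 _ _) (ha0 _ _), ← Real.rpow_natCast,
      ← Real.rpow_mul (hy k)]
    congr 1
    push_cast
    ring
  refine lt_of_pow_lt_pow_left₀ 2 h0 ?_
  rw [h1, sq]
  exact mul_lt_mul'' h h' hc hc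

end InfiniteMoment

/-! ### Infinite moment: the limit of the product vector -/

section InfiniteMomentLimit

variable {Ω : Type*} [MeasurableSpace Ω] {P : Measure Ω} {n p : ℕ} {α : ℝ} {ρ : Measure ℝ}
  {Y : Fin p → Ω → ℝ} {a : Fin n → Fin p → ℝ}

lemma IIDSample.measurable_maskedVector (I : IIDSample P Y ρ) (A : Finset (Fin p)) :
    Measurable fun ω => maskedVector a A fun j => Y j ω :=
  measurable_pi_lambda _ fun i => (I.measurable_prod A).mul ((measurable_pi_apply i).comp
    ((measurable_residualVector a A).comp (measurable_pi_lambda _ I.measurable)))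

lemma IsTest.integrable_comp [IsProbabilityMeasure P] {φ : (Fin n → ℝ) → ℝ} (hφ : IsTest φ)
    {X : Ω → Fin n → ℝ} (hX : Measurable X) (x : ℝ) :
    Integrable (fun ω => φ fun i => x⁻¹ * X ω i) P := by
  obtain ⟨K, hK⟩ := hφ.bounded
  have hm : Measurable fun ω => (fun i => x⁻¹ * X ω i : Fin n → ℝ) :=
    measurable_pi_lambda _ fun i => measurable_const.mul ((measurable_pi_apply i).comp hX)
  exact Integrable.of_bound (hφ.continuous.measurable.comp hm).aestronglyMeasurable K
    (Eventually.of_forall fun ω => hK _)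

/-- The exceptional event, on which two different sets of columns contribute or a row with few
full columns is large. -/
def exceptionalSet (a : Fin n → Fin p → ℝ) (c : ℝ) : Set (Fin p → ℝ) :=
  (⋃ i : {i : Fin n // (fullColumns a i).card < pEff a 1}, {y | c < ∏ k, y k ^ a i k}) ∪
  ⋃ q : {q : Fin n × Fin n // fullColumns a q.1 ≠ fullColumns a q.2},
    {y | c < ∏ k, y k ^ ((a q.1.1 k + a q.1.2 k) / 2)}

lemma measurableSet_monomial_lt (e : Fin p → ℝ) (c : ℝ) :
    MeasurableSet {y : Fin p → ℝ | c < ∏ k, y k ^ e k} :=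
  measurableSet_lt measurable_const
    (Finset.measurable_fun_prod _ fun k _ => (measurable_pi_apply k).pow_const _)

lemma measurableSet_exceptionalSet (c : ℝ) : MeasurableSet (exceptionalSet a c) :=
  (MeasurableSet.iUnion fun _ => measurableSet_monomial_lt _ _).union
    (MeasurableSet.iUnion fun _ => measurableSet_monomial_lt _ _)

-- Every monomial in the union has fewer than `pEff` exponents equal to one, so each tail is
-- negligible, and there are finitely many of them.
open Classical in
lemma IIDSample.tendsto_exceptionalSet [IsProbabilityMeasure P] [IsProbabilityMeasure ρ]
    (I : IIDSample P Y ρ) (h : RVTail ρ α) (hρ : ∀ᵐ y ∂ρ, 0 ≤ y)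
    (hi : ¬ Integrable (fun z => z ^ α) ρ) (ha0 : ∀ i j, 0 ≤ a i j) (ha1 : ∀ i j, a i j ≤ 1)
    (hq : pEff a 1 ≠ 0) {η : ℝ} (hη : 0 < η) :
    Tendsto (fun x => P.real {ω | (fun j => Y j ω) ∈ exceptionalSet a (η * x)} /
      tail (powLaw ρ (pEff a 1)) x) atTop (𝓝 0) := by
  set H := tail (powLaw ρ (pEff a 1)) with hH
  have hRV := h.powLaw hρ hi hq
  have hone : ∀ e : Fin p → ℝ, (∀ k, 0 ≤ e k) → (∀ k, e k ≤ 1) →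
      (Finset.univ.filter fun k => e k = 1).card < pEff a 1 →
      Tendsto (fun x => P.real {ω | η * x < ∏ k, Y k ω ^ e k} / H x) atTop (𝓝 0) := by
    intro e he0 he1 hc
    obtain ⟨l, hl, hl0⟩ := I.tendsto_tail_monomial h hρ hi hq he0 he1 hc.le
    rw [hl0 hc] at hl
    have := hRV.tendsto_scale hl hη
    rwa [zero_mul] at this
  have h1 : Tendsto (fun x =>
      ∑ i : {i : Fin n // (fullColumns a i).card < pEff a 1},
        P.real {ω | η * x < ∏ k, Y k ω ^ a i k} / H x +
      ∑ q : {q : Fin n × Fin n // fullColumns a q.1 ≠ fullColumns a q.2},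
        P.real {ω | η * x < ∏ k, Y k ω ^ ((a q.1.1 k + a q.1.2 k) / 2)} / H x) atTop (𝓝 0) := by
    have e1 := tendsto_finsetSum
      (Finset.univ : Finset {i : Fin n // (fullColumns a i).card < pEff a 1})
      fun i _ => hone (a i) (ha0 i) (ha1 i) (by rw [filter_eq_fullColumns]; exact i.2)
    have e2 := tendsto_finsetSum
      (Finset.univ : Finset {q : Fin n × Fin n // fullColumns a q.1 ≠ fullColumns a q.2})
      fun q _ => hone (fun k => (a q.1.1 k + a q.1.2 k) / 2)
        (fun k => by linarith [ha0 q.1.1 k, ha0 q.1.2 k])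
        (fun k => by linarith [ha1 q.1.1 k, ha1 q.1.2 k]) (card_filter_half_add_lt ha1 q.2)
    have := e1.add e2
    simpa using this
  refine tendsto_of_tendsto_of_tendsto_of_le_of_le tendsto_const_nhds h1
    (fun x => div_nonneg measureReal_nonneg (tail_nonneg _ _)) fun x => ?_
  rw [← Finset.sum_div, ← Finset.sum_div, ← add_div]
  refine div_le_div_of_nonneg_right ?_ (tail_nonneg _ _)
  have hset : {ω | (fun j => Y j ω) ∈ exceptionalSet a (η * x)} =
      (⋃ i : {i : Fin n // (fullColumns a i).card < pEff a 1},
        {ω | η * x < ∏ k, Y k ω ^ a i k}) ∪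
      ⋃ q : {q : Fin n × Fin n // fullColumns a q.1 ≠ fullColumns a q.2},
        {ω | η * x < ∏ k, Y k ω ^ ((a q.1.1 k + a q.1.2 k) / 2)} := by
    ext ω
    simp [exceptionalSet]
  rw [hset]
  exact (measureReal_union_le _ _).trans
    (add_le_add (measureReal_iUnion_fintype_le _) (measureReal_iUnion_fintype_le _))

lemma abs_test_sub_sum_le_indicator {φ : (Fin n → ℝ) → ℝ} {K ε δ η x : ℝ}
    (hK : ∀ v, |φ v| ≤ K) (hv : ∀ v, (∀ i, 0 ≤ v i ∧ v i ≤ ε) → φ v = 0)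
    (hmod : ∀ u v, (∀ i, 0 ≤ v i ∧ (u i = v i ∨ (u i = 0 ∧ v i ≤ η))) → |φ u - φ v| ≤ δ)
    (hδ : 0 ≤ δ) (hε : 0 < ε) (hη0 : 0 ≤ η) (hη : η ≤ ε) (hx : 0 < x) (ha0 : ∀ i j, 0 ≤ a i j)
    {y : Fin p → ℝ} (hy : ∀ k, 0 ≤ y k) :
    |φ (fun i => x⁻¹ * productVector a y i) -
      ∑ A ∈ PEff a 1, φ (fun i => x⁻¹ * maskedVector a A y i)| ≤
      {y : Fin p → ℝ | ∃ i, ε * x < productVector a y i}.indicator (fun _ => δ) y +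
      (exceptionalSet a (η * x)).indicator (fun _ => (1 + (PEff a 1).card) * K) y := by
  have hK0 : 0 ≤ K := (abs_nonneg _).trans (hK 0)
  by_cases hex : y ∈ exceptionalSet a (η * x)
  · rw [indicator_of_mem hex]
    exact (abs_sub_sum_le hK _ _).trans
      (le_add_of_nonneg_left (indicator_nonneg (fun _ _ => hδ) _))
  · rw [indicator_of_notMem hex, add_zero]
    have hnot : y ∉ (⋃ i : {i : Fin n // (fullColumns a i).card < pEff a 1},
        {y : Fin p → ℝ | η * x < ∏ k, y k ^ a i k}) ∧
        y ∉ ⋃ q : {q : Fin n × Fin n // fullColumns a q.1 ≠ fullColumns a q.2},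
          {y : Fin p → ℝ | η * x < ∏ k, y k ^ ((a q.1.1 k + a q.1.2 k) / 2)} :=
      ⟨fun h => hex (Or.inl h), fun h => hex (Or.inr h)⟩
    refine abs_test_sub_sum_maskedVector_le hv hmod hε hη hx hy (fun i hi => ?_)
      fun i i' hne => ?_
    · exact not_lt.1 fun h => hnot.1 (mem_iUnion.2 ⟨⟨i, hi⟩, h⟩)
    · by_contra! hcon
      exact hnot.2 (mem_iUnion.2 ⟨⟨(i, i'), hne⟩,
        lt_prod_half_of_lt ha0 hy (by positivity) hcon.1 hcon.2⟩)

lemma pEff_pos_of_exists (h1 : ∃ i j, a i j = 1) : pEff a 1 ≠ 0 := by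
  obtain ⟨i, j, hij⟩ := h1
  have : 0 < (fullColumns a i).card := Finset.card_pos.2 ⟨j, mem_fullColumns.2 hij⟩
  exact (this.trans_le (card_fullColumns_le i)).ne'

lemma exists_mem_PEff [NeZero n] (a : Fin n → Fin p → ℝ) : ∃ i, fullColumns a i ∈ PEff a 1 := by
  obtain ⟨i, -, hi⟩ := Finset.exists_mem_eq_sup (Finset.univ : Finset (Fin n))
    ⟨0, Finset.mem_univ _⟩ fun i => (fullColumns a i).card
  exact ⟨i, mem_PEff.2 ⟨hi.symm, i, rfl⟩⟩

/-- The limit of the product vector when the moment of order `α` is infinite. -/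
theorem IIDSample.vectorLimit_of_not_integrable [IsProbabilityMeasure P] [IsProbabilityMeasure ρ]
    [NeZero n] (I : IIDSample P Y ρ) (h : RVTail ρ α) (hρ : ∀ᵐ y ∂ρ, 0 ≤ y)
    (hi : ¬ Integrable (fun z => z ^ α) ρ) (ha0 : ∀ i j, 0 ≤ a i j) (ha1 : ∀ i j, a i j ≤ 1)
    (hmax : ∃ i j, a i j = 1) :
    VectorLimit P (fun ω => productVector a fun j => Y j ω) α (tail (powLaw ρ (pEff a 1)))
      (Finset.univ : Finset ↥(PEff a 1)) (fun A ω => residualVector a A.1 fun j => Y j ω) := by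
  have hα := h.index_pos
  have hq := pEff_pos_of_exists hmax
  have hRV := h.powLaw hρ hi hq
  obtain ⟨β, hβ, hβa⟩ := exists_moment_exponent hα fun q : Fin n × Fin p => a q.1 q.2
  have hYm : Measurable fun ω => fun j => Y j ω := measurable_pi_lambda _ I.measurable
  have hWm : ∀ A : Finset (Fin p), Measurable fun ω => residualVector a A fun j => Y j ω :=
    fun A => (measurable_residualVector a A).comp hYm
  have hW0 : ∀ (A : Finset (Fin p)) ω i, 0 ≤ residualVector a A (fun j => Y j ω) i :=
    fun A ω i => residualVector_nonneg (fun k => I.nonneg k ω) A i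
  have hWi : ∀ A ∈ PEff a 1, ∀ i,
      Integrable (fun ω => max 1 (residualVector a A (fun j => Y j ω) i) ^ β) P := by
    intro A hA i
    by_cases hiA : ∀ j ∈ A, a i j = 1
    · simp only [residualVector, if_pos hiA]
      refine I.integrable_max_prod_rpow h (ha0 i) (hα.trans hβ).le Aᶜ fun k hk => hβa (i, k) ?_
      refine lt_of_le_of_ne (ha1 i k) fun h1 => Finset.mem_compl.1 hk ?_
      rw [← (forall_eq_one_iff (mem_PEff.1 hA).1).1 hiA]
      exact mem_fullColumns.2 h1
    · simp [residualVector_of_not_forall hiA]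
  refine ⟨hα, I.measurable_productVector,
    fun A => hWm A.1,
    fun A => hW0 A.1, fun A i => ?_, Eventually.of_forall hRV.tail_pos, fun φ hφ => ?_, ?_⟩
  · refine (hWi A.1 A.2 i).mono' (((measurable_pi_apply i).comp (hWm A.1)).pow_const
      α).aestronglyMeasurable (Eventually.of_forall fun ω => ?_)
    rw [Real.norm_of_nonneg (Real.rpow_nonneg (hW0 A.1 ω i) _)]
    exact (Real.rpow_le_rpow (hW0 A.1 ω i) (le_max_right _ _) hα.le).trans
      (Real.rpow_le_rpow_of_exponent_le (le_max_left _ _) hβ.le)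
  · obtain ⟨K, hK⟩ := hφ.bounded
    obtain ⟨ε, hε, hv⟩ := hφ.vanish
    have hη : ∀ k : ℕ, ∃ η > 0, η ≤ ε ∧ ∀ u v : Fin n → ℝ,
        (∀ i, 0 ≤ v i ∧ (u i = v i ∨ (u i = 0 ∧ v i ≤ η))) →
          |φ u - φ v| ≤ 1 / ((k : ℝ) + 1) := by
      intro k
      obtain ⟨η, hη0, hη⟩ := hφ.modulus (1 / ((k : ℝ) + 1)) (by positivity)
      exact ⟨min η ε, lt_min hη0 hε, min_le_right _ _, fun u v huv => hη u v fun i =>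
        ⟨(huv i).1, (huv i).2.imp_right fun h2 => ⟨h2.1, h2.2.trans (min_le_left _ _)⟩⟩⟩
    choose η hη0 hηε hmod using hη
    set H := tail (powLaw ρ (pEff a 1)) with hH
    have hbr : ∀ A ∈ PEff a 1, Tendsto (fun x =>
        (∫ ω, φ (fun i => x⁻¹ * maskedVector a A (fun j => Y j ω) i) ∂P) / H x) atTop
        (𝓝 (∫ q, φ (scaleVec (fun ω => residualVector a A fun j => Y j ω) q)
          ∂(P.prod (powerMeasure α)))) := by
      intro A hA
      have hlaw : P.map (fun ω => ∏ j ∈ A, Y j ω) = powLaw ρ (pEff a 1) := by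
        rw [I.map_prod, (mem_PEff.1 hA).1]
      have := hφ.breiman (I.measurable_prod A) (hWm A) (I.prod_nonneg A) (hW0 A)
        (I.indepFun_residualVector A) (hlaw.symm ▸ hRV) hβ (hWi A hA)
      rwa [hlaw] at this
    have hB₀ : ∃ l, Tendsto (fun x => (∑ i, P.real {ω | ε * x < productVector a (fun j => Y j ω) i}) / H x)
        atTop (𝓝 l) := by
      choose l hl _ using fun i => I.tendsto_tail_monomial h hρ hi hq (ha0 i) (ha1 i)
        (by rw [filter_eq_fullColumns]; exact card_fullColumns_le i)
      have := tendsto_finsetSum (Finset.univ : Finset (Fin n))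
        fun i _ => hRV.tendsto_scale (hl i) hε
      simp_rw [← Finset.sum_div] at this
      exact ⟨_, this⟩
    obtain ⟨l, hl⟩ := hB₀
    -- The approximating sum does not depend on k; only the tolerance 1 / (k + 1) of the modulus
    -- does. It is paid on an event of probability of order at most `H`, while the exceptional event
    -- is negligible for each fixed k.
    refine tendsto_of_approx
      (A := fun _ x => ∑ A : ↥(PEff a 1),
        (∫ ω, φ (fun i => x⁻¹ * maskedVector a A.1 (fun j => Y j ω) i) ∂P) / H x)
      (E := fun k x => 1 / ((k : ℝ) + 1) *
          ((∑ i, P.real {ω | ε * x < productVector a (fun j => Y j ω) i}) / H x) +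
        (1 + (PEff a 1).card) * K *
          (P.real {ω | (fun j => Y j ω) ∈ exceptionalSet a (η k * x)} / H x))
      (e := fun k => 1 / ((k : ℝ) + 1) * l + (1 + (PEff a 1).card) * K * 0)
      (fun _ => tendsto_finsetSum _ fun A _ => hbr A.1 A.2) tendsto_const_nhds
      (fun k => (hl.const_mul _).add
        ((I.tendsto_exceptionalSet h hρ hi ha0 ha1 hq (hη0 k)).const_mul _)) ?_ ?_
    · have := (tendsto_one_div_add_atTop_nhds_zero_nat (𝕜 := ℝ)).mul_const l
      simpa using this
    · intro k
      filter_upwards [eventually_gt_atTop 0] with x hx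
      have hHx := hRV.tail_pos x
      have hB₀m : MeasurableSet {y : Fin p → ℝ | ∃ i, ε * x < productVector a y i} := by
        have : {y : Fin p → ℝ | ∃ i, ε * x < productVector a y i} =
            ⋃ i, {y | ε * x < ∏ k, y k ^ a i k} := by
          ext y; simp [productVector]
        rw [this]
        exact MeasurableSet.iUnion fun i => measurableSet_monomial_lt _ _
      have h1 := abs_integral_le_of_indicator (P := P)
        (f := fun ω => φ (fun i => x⁻¹ * productVector a (fun j => Y j ω) i) -
          ∑ A ∈ PEff a 1, φ (fun i => x⁻¹ * maskedVector a A (fun j => Y j ω) i))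
        (hYm hB₀m) (hYm (measurableSet_exceptionalSet (a := a) (η k * x)))
        fun ω => abs_test_sub_sum_le_indicator hK hv (hmod k) (by positivity) hε (hη0 k).le
          (hηε k) hx ha0 fun j => I.nonneg j ω
      rw [integral_sub (hφ.integrable_comp I.measurable_productVector x)
        (integrable_finsetSum _ fun A _ => hφ.integrable_comp (I.measurable_maskedVector A) x),
        integral_finsetSum _ fun A _ => hφ.integrable_comp (I.measurable_maskedVector A) x] at h1
      have h2 : P.real ((fun ω j => Y j ω) ⁻¹' {y | ∃ i, ε * x < productVector a y i}) ≤
          ∑ i, P.real {ω | ε * x < productVector a (fun j => Y j ω) i} := by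
        have : (fun ω j => Y j ω) ⁻¹' {y | ∃ i, ε * x < productVector a y i} =
            ⋃ i, {ω | ε * x < productVector a (fun j => Y j ω) i} := by
          ext ω; simp
        rw [this]
        exact measureReal_iUnion_fintype_le _
      rw [← Finset.sum_div, Finset.sum_coe_sort (PEff a 1)
        fun A => ∫ ω, φ (fun i => x⁻¹ * maskedVector a A (fun j => Y j ω) i) ∂P, ← sub_div,
        abs_div, abs_of_pos hHx, div_le_iff₀ hHx, add_mul, mul_assoc _ _ (H x),
        div_mul_cancel₀ _ hHx.ne', mul_assoc _ _ (H x), div_mul_cancel₀ _ hHx.ne']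
      refine h1.trans (add_le_add_left ?_ _)
      exact mul_le_mul_of_nonneg_left h2 (by positivity)
  · obtain ⟨i, hA⟩ := exists_mem_PEff a
    exact ⟨⟨_, hA⟩, Finset.mem_univ _,
      I.measure_residualVector_ne_zero h (i := i) fun j hj => mem_fullColumns.1 hj⟩

end InfiniteMomentLimit

/-! ### Convolution equivalence: one large factor -/

section ConvolutionEquivalentLimit

variable {Ω : Type*} [MeasurableSpace Ω] {P : Measure Ω} {n p : ℕ} {α : ℝ} {ρ : Measure ℝ}
  {Y : Fin p → Ω → ℝ} {a : Fin n → Fin p → ℝ}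

/-- The power with exponent below one has a moment beyond α. Viewed as this light factor times the
constant 1, whose tail is eventually zero, it falls under Breiman's lemma with k = 0. -/
lemma RVTail.tendsto_tail_rpow [IsProbabilityMeasure ρ] (h : RVTail ρ α) {b : ℝ} (hb0 : 0 ≤ b)
    (hb : b < 1) :
    Tendsto (fun x => tail (ρ.map fun z => max 1 z ^ b) x / tail ρ x) atTop (𝓝 0) := by
  obtain ⟨β, hβ, hβb⟩ := exists_moment_exponent h.index_pos fun _ : Unit => b
  have hβ0 : 0 < β := h.index_pos.trans hβ
  have hm : Measurable fun z : ℝ => max 1 z ^ b :=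
    (measurable_const.max measurable_id).pow_const _
  have hp : IsProbabilityMeasure (ρ.map fun z => max 1 z ^ b) :=
    Measure.isProbabilityMeasure_map hm.aemeasurable
  have hdirac : Tendsto (fun x => tail (Measure.dirac 1) x / tail ρ x) atTop (𝓝 0) := by
    refine tendsto_const_nhds.congr' ?_
    filter_upwards [eventually_ge_atTop 1] with x hx
    rw [tail, measureReal_def, Measure.dirac_apply' _ measurableSet_Ioi]
    simp [not_lt.2 hx]
  have h1 : ∀ z : ℝ, 1 ≤ max 1 z ^ b := fun z => Real.one_le_rpow (le_max_left _ _) hb0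
  have h2 := h.tendsto_prodTail (τ := ρ.map fun z => max 1 z ^ b) hβ hdirac
    ((ae_map_iff hm.aemeasurable measurableSet_Ici).2
      (Eventually.of_forall fun z => zero_le_one.trans (h1 z)))
    ((integrable_map_measure
      ((measurable_const.max measurable_id).pow_const _).aestronglyMeasurable hm.aemeasurable).2
      ((h.integrable_rpow_of_lt (mul_nonneg hb0 hβ0.le) (hβb () hb)).congr
        (Eventually.of_forall fun z => by
          simp only [Function.comp_apply, id_eq, max_eq_right (h1 z)]
          rw [Real.rpow_mul (by positivity)])))
  rw [zero_mul] at h2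
  simpa only [← tail_mconv, Measure.mconv_dirac_one] using h2

/-! ### Samples of variables which are at least one -/

lemma prod_eq_mul_prod_compl (z : Fin p → ℝ) (j : Fin p) :
    ∏ k, z k = (∏ k ∈ {j}ᶜ, z k) * z j := by
  rw [← Finset.prod_compl_mul_prod {j}, Finset.prod_singleton]

lemma one_le_prod_of_one_le {z : Fin p → ℝ} (hz : ∀ k, 1 ≤ z k) (A : Finset (Fin p)) :
    1 ≤ ∏ k ∈ A, z k :=
  Finset.prod_induction _ (fun z => (1 : ℝ) ≤ z)
    (fun _ _ => one_le_mul_of_one_le_of_one_le) le_rfl fun k _ => hz k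

/-- Every factor occurs in at least one of the two complementary products, and repeated factors are
at least one. -/
lemma prod_le_mul_prod_compl {z : Fin p → ℝ} (hz : ∀ k, 1 ≤ z k) {j k : Fin p} (hjk : j ≠ k) :
    ∏ l, z l ≤ (∏ l ∈ {j}ᶜ, z l) * ∏ l ∈ {k}ᶜ, z l := by
  have h0 : ∀ l, 0 ≤ z l := fun l => zero_le_one.trans (hz l)
  rw [prod_eq_mul_prod_compl z j]
  refine mul_le_mul_of_nonneg_left ?_ (Finset.prod_nonneg fun l _ => h0 l)
  rw [← Finset.mul_prod_erase _ _ (show j ∈ ({k}ᶜ : Finset (Fin p)) by simpa using hjk)]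
  exact le_mul_of_one_le_right (h0 j) (one_le_prod_of_one_le hz _)

lemma IIDSample.measure_prod_and_compl_le [IsProbabilityMeasure P] [IsProbabilityMeasure ρ]
    (I : IIDSample P Y ρ) (j : Fin p) (M c : ℝ) :
    P.real {ω | c < ∏ k, Y k ω ∧ ∏ k ∈ {j}ᶜ, Y k ω ≤ M} =
      prodTail ((powLaw ρ (p - 1)).restrict (Iic M)) ρ c := by
  have hind : IndepFun (fun ω => ∏ k ∈ {j}ᶜ, Y k ω) (Y j) P := by
    have h1 := I.indepFun_compl {j} (G := fun u : ↥({j}ᶜ : Finset (Fin p)) → ℝ => ∏ k, u k)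
      (Finset.measurable_fun_prod _ fun k _ => measurable_pi_apply k)
    simp only [Finset.prod_singleton] at h1
    have h2 : (fun ω => ∏ k ∈ {j}ᶜ, Y k ω) =
        fun ω => ∏ k : ↥({j}ᶜ : Finset (Fin p)), Y k ω :=
      funext fun ω => (Finset.prod_coe_sort ({j}ᶜ : Finset (Fin p)) fun k => Y k ω).symm
    rw [h2]
    exact h1.symm
  have hm := I.measurable_prod ({j}ᶜ : Finset (Fin p))
  have hcard : ({j}ᶜ : Finset (Fin p)).card = p - 1 := by simp [Finset.card_compl]
  have hms : MeasurableSet {q : ℝ × ℝ | c < q.1 * q.2 ∧ q.1 ≤ M} :=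
    (measurableSet_lt_mul c).inter (measurableSet_le measurable_fst measurable_const)
  rw [prodTail_restrict, ← hcard, ← I.map_prod, ← I.law j,
    ← (indepFun_iff_map_prod_eq_prod_map_map hm.aemeasurable (I.measurable j).aemeasurable).1 hind,
    map_measureReal_apply (hm.prodMk (I.measurable j)) hms]
  refine congrArg P.real (Set.ext fun ω => ?_)
  simp [prod_eq_mul_prod_compl (fun k => Y k ω) j]

/-- The probability that a product is large while no single factor accounts for it. -/
lemma IIDSample.measure_prod_and_forall_le [IsProbabilityMeasure P] [IsProbabilityMeasure ρ]
    (I : IIDSample P Y ρ) (h1 : ∀ j ω, 1 ≤ Y j ω) {M c : ℝ} (hc : M * M ≤ c) :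
    P.real {ω | c < ∏ k, Y k ω ∧ ∀ j, M < ∏ k ∈ {j}ᶜ, Y k ω} ≤
      tail (powLaw ρ p) c - p * prodTail ((powLaw ρ (p - 1)).restrict (Iic M)) ρ c := by
  set D : Fin p → Set Ω := fun j => {ω | c < ∏ k, Y k ω ∧ ∏ k ∈ {j}ᶜ, Y k ω ≤ M} with hD
  set D' : Set Ω := {ω | c < ∏ k, Y k ω ∧ ∀ j, M < ∏ k ∈ {j}ᶜ, Y k ω} with hD'
  have hmc := measurableSet_lt measurable_const (I.measurable_prod Finset.univ) (f := fun _ => c)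
  have hDm : ∀ j, MeasurableSet (D j) := fun j =>
    hmc.inter (measurableSet_le (I.measurable_prod _) measurable_const)
  have htot : tail (powLaw ρ p) c = P.real {ω | c < ∏ k, Y k ω} := by
    have hp := I.map_prod Finset.univ
    rw [Finset.card_univ, Fintype.card_fin] at hp
    rw [← hp, tail, map_measureReal_apply (I.measurable_prod _) measurableSet_Ioi]
    rfl
  -- Two complementary products at most M would force the full product to be at most M² ≤ c.
  have hdisj : Pairwise (Function.onFun Disjoint D) := by
    intro j k hjk
    refine disjoint_left.2 fun ω hj hk => ?_
    have h2 := prod_le_mul_prod_compl (fun l => h1 l ω) hjk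
    have h3 : (∏ l ∈ {j}ᶜ, Y l ω) * ∏ l ∈ {k}ᶜ, Y l ω ≤ M * M :=
      mul_le_mul hj.2 hk.2 (I.prod_nonneg _ ω) ((I.prod_nonneg _ ω).trans hj.2)
    exact absurd hj.1 (not_lt.2 (h2.trans (h3.trans hc)))
  have hdisj' : Disjoint D' (⋃ j, D j) := by
    refine disjoint_left.2 fun ω hω hj => ?_
    obtain ⟨j, hj⟩ := mem_iUnion.1 hj
    exact absurd (hω.2 j) (not_lt.2 hj.2)
  have hsum : ∑ j, P.real (D j) = P.real (⋃ j, D j) :=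
    (measureReal_iUnion_fintype hdisj hDm).symm
  have hle : P.real D' + P.real (⋃ j, D j) ≤ tail (powLaw ρ p) c := by
    rw [htot, ← measureReal_union hdisj' (MeasurableSet.iUnion hDm)]
    refine measureReal_mono (union_subset (fun ω hω => hω.1) (iUnion_subset fun j ω hω => hω.1))
  have hDj : ∀ j, P.real (D j) = prodTail ((powLaw ρ (p - 1)).restrict (Iic M)) ρ c :=
    fun j => I.measure_prod_and_compl_le j M c
  rw [← hsum, Finset.sum_congr rfl fun j _ => hDj j, Finset.sum_const, Finset.card_univ,
    Fintype.card_fin, nsmul_eq_mul] at hle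
  linarith

/-- The defect of the single factor approximation of a product. -/
lemma tendsto_tail_powLaw_sub [IsProbabilityMeasure ρ] (h : RVTail ρ α)
    (hρ : ∀ᵐ z ∂ρ, 1 ≤ z) {c : ℝ}
    (hc : Tendsto (fun x => prodTail ρ ρ x / tail ρ x) atTop (𝓝 c)) (q : ℕ) :
    ∃ r : ℕ → ℝ, Tendsto r atTop (𝓝 0) ∧ ∀ (M : ℕ) {η : ℝ}, 0 < η →
      Tendsto (fun x => (tail (powLaw ρ q) (η * x) -
        q * prodTail ((powLaw ρ (q - 1)).restrict (Iic (M : ℝ))) ρ (η * x)) / tail ρ x) atTop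
        (𝓝 (r M * η ^ (-α))) := by
  have hρ0 : ∀ᵐ z ∂ρ, 0 ≤ z := hρ.mono fun z hz => zero_le_one.trans hz
  have hi := integrable_powLaw_rpow hρ0 (h.integrable_rpow_of_prodTail hρ0 hc) (q - 1)
  have hq := h.tendsto_tail_powLaw hρ hc q
  -- This is q times the part beyond M of the moment of order α of a product of q - 1 factors, so it
  -- vanishes as M grows.
  refine ⟨fun M => q * (∫ z, z ^ α ∂ρ) ^ (q - 1) -
    q * (1 * ∫ v in Iic (M : ℝ), v ^ α ∂powLaw ρ (q - 1)), ?_, fun M η hη => ?_⟩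
  · have h1 := (((tendsto_setIntegral_Iic_nat hi).const_mul 1).const_mul (q : ℝ)).const_sub
      (q * (∫ z, z ^ α ∂ρ) ^ (q - 1))
    rwa [integral_powLaw_rpow hρ0, one_mul, sub_self] at h1
  · have h1 := (h.tendsto_prodTail_restrict h.tendsto_self (ae_powLaw_nonneg hρ0 (q - 1))
      (M : ℝ)).const_mul (q : ℝ)
    refine h.tendsto_scale (g := fun x => tail (powLaw ρ q) x -
      q * prodTail ((powLaw ρ (q - 1)).restrict (Iic (M : ℝ))) ρ x)
      ((hq.sub h1).congr fun x => ?_) hη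
    ring

/-! ### Truncation of the residual vectors -/

/-- The residual vector, on the event that the other factors have product at most `M`. -/
noncomputable def truncatedResidual (a : Fin n → Fin p → ℝ) (M : ℝ) (j : Fin p) (y : Fin p → ℝ) :
    Fin n → ℝ :=
  if ∏ k ∈ {j}ᶜ, max (y k) 1 ≤ M then residualVector a {j} y else 0

lemma prod_rpow_le_prod_max_one {y : Fin p → ℝ} (hy : ∀ k, 0 ≤ y k) {e : Fin p → ℝ}
    (he0 : ∀ k, 0 ≤ e k) (he1 : ∀ k, e k ≤ 1) (A : Finset (Fin p)) :
    ∏ k ∈ A, y k ^ e k ≤ ∏ k ∈ A, max (y k) 1 := by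
  refine Finset.prod_le_prod (fun k _ => Real.rpow_nonneg (hy k) _) fun k _ => ?_
  calc y k ^ e k ≤ max (y k) 1 ^ e k := Real.rpow_le_rpow (hy k) (le_max_left _ _) (he0 k)
    _ ≤ max (y k) 1 ^ (1 : ℝ) := Real.rpow_le_rpow_of_exponent_le (le_max_right _ _) (he1 k)
    _ = _ := Real.rpow_one _

lemma residualVector_le {y : Fin p → ℝ} (hy : ∀ k, 0 ≤ y k) (ha0 : ∀ i j, 0 ≤ a i j)
    (ha1 : ∀ i j, a i j ≤ 1) (A : Finset (Fin p)) (i : Fin n) :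
    residualVector a A y i ≤ ∏ k ∈ Aᶜ, max (y k) 1 := by
  unfold residualVector
  split_ifs
  · exact prod_rpow_le_prod_max_one hy (ha0 i) (ha1 i) _
  · exact Finset.prod_nonneg fun k _ => by positivity

lemma truncatedResidual_nonneg {y : Fin p → ℝ} (hy : ∀ k, 0 ≤ y k) (M : ℝ) (j : Fin p)
    (i : Fin n) : 0 ≤ truncatedResidual a M j y i := by
  unfold truncatedResidual
  split_ifs
  · exact residualVector_nonneg hy _ i
  · exact le_rfl

lemma truncatedResidual_le {y : Fin p → ℝ} (hy : ∀ k, 0 ≤ y k) (ha0 : ∀ i j, 0 ≤ a i j)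
    (ha1 : ∀ i j, a i j ≤ 1) {M : ℝ} (hM : 0 ≤ M) (j : Fin p) (i : Fin n) :
    truncatedResidual a M j y i ≤ M := by
  unfold truncatedResidual
  split_ifs with h
  · exact (residualVector_le hy ha0 ha1 _ i).trans h
  · exact hM

lemma measurable_truncatedResidual (a : Fin n → Fin p → ℝ) (M : ℝ) (j : Fin p) :
    Measurable (truncatedResidual a M j) :=
  Measurable.ite (measurableSet_le (Finset.measurable_fun_prod _ fun k _ =>
    (measurable_pi_apply k).max measurable_const) measurable_const)
    (measurable_residualVector a {j}) measurable_const

lemma IIDSample.indepFun_truncatedResidual (I : IIDSample P Y ρ) (M : ℝ) (j : Fin p) :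
    IndepFun (Y j) (fun ω => truncatedResidual a M j fun k => Y k ω) P := by
  obtain ⟨G, hG, hGe⟩ := exists_residualVector_factor a ({j} : Finset (Fin p))
  have h1 := I.indepFun_compl {j}
    (G := fun u => if ∏ k, max (u k) 1 ≤ M then G u else 0)
    (Measurable.ite (measurableSet_le (Finset.measurable_fun_prod _ fun k _ =>
      (measurable_pi_apply k).max measurable_const) measurable_const) hG measurable_const)
  simp only [Finset.prod_singleton] at h1
  have h2 : (fun ω => truncatedResidual a M j fun k => Y k ω) = fun ω =>
      if ∏ k : ↥({j}ᶜ : Finset (Fin p)), max (Y k ω) 1 ≤ M then G (fun k => Y k ω) else 0 := by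
    ext1 ω
    rw [hGe fun k => Y k ω, Finset.prod_coe_sort ({j}ᶜ : Finset (Fin p)) fun k => max (Y k ω) 1]
    rfl
  rw [h2]
  exact h1

/-- The exceptional event, on which no single factor accounts for a large product, or some factor
is large even with a smaller exponent. -/
def multipleLargeSet (a : Fin n → Fin p → ℝ) (M c : ℝ) : Set (Fin p → ℝ) :=
  {y | c < ∏ k, max (y k) 1 ∧ ∀ j, M < ∏ k ∈ {j}ᶜ, max (y k) 1} ∪
  ⋃ q : {q : Fin n × Fin p // a q.1 q.2 < 1},
    {y | c < max 1 (y q.1.2) ^ a q.1.1 q.1.2 * M}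

lemma measurable_prod_max_one (A : Finset (Fin p)) :
    Measurable fun y : Fin p → ℝ => ∏ k ∈ A, max (y k) 1 :=
  Finset.measurable_fun_prod _ fun k _ => (measurable_pi_apply k).max measurable_const

lemma measurableSet_multipleLargeSet (M c : ℝ) : MeasurableSet (multipleLargeSet a M c) := by
  have h1 : MeasurableSet {y : Fin p → ℝ | ∀ j, M < ∏ k ∈ {j}ᶜ, max (y k) 1} := by
    rw [ofPred_forall]
    exact MeasurableSet.iInter fun j => measurableSet_lt measurable_const (measurable_prod_max_one _)
  exact ((measurableSet_lt measurable_const (measurable_prod_max_one _)).inter h1).union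
    (MeasurableSet.iUnion fun q => measurableSet_lt measurable_const
      (((measurable_const.max (measurable_pi_apply _)).pow_const _).mul_const _))

/-- Off the exceptional set, when the product of the max(y_k, 1) is large, exactly one j has
complementary product at most M. Rows with exponent one at j equal y_j times the residual; the
others are at most max(1, y_j)^(a i j) M ≤ η x and fall under the modulus. For the other indices the
truncated residual is zero. -/
lemma abs_test_sub_sum_truncatedResidual_le {φ : (Fin n → ℝ) → ℝ} {K ε δ η x M : ℝ}
    (hK : ∀ v, |φ v| ≤ K) (hv : ∀ v, (∀ i, 0 ≤ v i ∧ v i ≤ ε) → φ v = 0)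
    (hmod : ∀ u v, (∀ i, 0 ≤ v i ∧ (u i = v i ∨ (u i = 0 ∧ v i ≤ η))) → |φ u - φ v| ≤ δ)
    (hδ : 0 ≤ δ) (hε : 0 < ε) (hη : η ≤ ε) (hx : 0 < x) (hM : 0 ≤ M) (hMx : M * M ≤ η * x)
    (ha0 : ∀ i j, 0 ≤ a i j) (ha1 : ∀ i j, a i j ≤ 1) {y : Fin p → ℝ} (hy : ∀ k, 0 ≤ y k) :
    |φ (fun i => x⁻¹ * productVector a y i) -
      ∑ j, φ (fun i => x⁻¹ * (y j * truncatedResidual a M j y i))| ≤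
      {y : Fin p → ℝ | ε * x < ∏ k, max (y k) 1}.indicator (fun _ => δ) y +
      (multipleLargeSet a M (η * x)).indicator (fun _ => (1 + p) * K) y := by
  have hK0 : 0 ≤ K := (abs_nonneg _).trans (hK 0)
  by_cases hex : y ∈ multipleLargeSet a M (η * x)
  · rw [indicator_of_mem hex]
    have h1 := abs_sub_sum_le (s := Finset.univ) hK (fun i => x⁻¹ * productVector a y i)
      fun j i => x⁻¹ * (y j * truncatedResidual a M j y i)
    rw [Finset.card_univ, Fintype.card_fin] at h1
    exact h1.trans (le_add_of_nonneg_left (indicator_nonneg (fun _ _ => hδ) _))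
  rw [indicator_of_notMem hex, add_zero]
  have hz1 : ∀ k, 1 ≤ max (y k) 1 := fun k => le_max_right _ _
  have hscale : ∀ {t c : ℝ}, t ≤ c * x → x⁻¹ * t ≤ c := fun {t c} h => by
    rwa [inv_mul_le_iff₀ hx, mul_comm]
  have hX0 : ∀ i, 0 ≤ x⁻¹ * productVector a y i := fun i =>
    mul_nonneg (inv_nonneg.2 hx.le) (productVector_nonneg hy i)
  have hX : ∀ i, productVector a y i ≤ ∏ k, max (y k) 1 := fun i =>
    prod_rpow_le_prod_max_one hy (ha0 i) (ha1 i) _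
  have hT0 : ∀ j i, 0 ≤ y j * truncatedResidual a M j y i := fun j i =>
    mul_nonneg (hy j) (truncatedResidual_nonneg hy M j i)
  have hT : ∀ j i, y j * truncatedResidual a M j y i ≤ ∏ k, max (y k) 1 := by
    intro j i
    rw [prod_eq_mul_prod_compl _ j, mul_comm]
    have h1 : truncatedResidual a M j y i ≤ ∏ k ∈ {j}ᶜ, max (y k) 1 := by
      unfold truncatedResidual
      split_ifs
      · exact residualVector_le hy ha0 ha1 _ i
      · exact Finset.prod_nonneg fun k _ => by positivity
    exact mul_le_mul h1 (le_max_left _ _) (hy j) (Finset.prod_nonneg fun k _ => by positivity)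
  by_cases hbig : ε * x < ∏ k, max (y k) 1
  · rw [indicator_of_mem (show y ∈ {y : Fin p → ℝ | ε * x < ∏ k, max (y k) 1} from hbig)]
    have hbig' : η * x < ∏ k, max (y k) 1 := lt_of_le_of_lt (by gcongr) hbig
    obtain ⟨j, hj⟩ : ∃ j, ∏ k ∈ {j}ᶜ, max (y k) 1 ≤ M := by
      by_contra! hcon
      exact hex (Or.inl ⟨hbig', hcon⟩)
    have hTj : truncatedResidual a M j y = residualVector a {j} y := if_pos hj
    rw [Finset.sum_eq_single_of_mem j (Finset.mem_univ j), abs_sub_comm]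
    · refine hmod _ _ fun i => ⟨hX0 i, ?_⟩
      rw [hTj]
      by_cases hi : ∀ k ∈ ({j} : Finset (Fin p)), a i k = 1
      · have h1 := prod_mul_residualVector_of_forall (y := y) hi
        rw [Finset.prod_singleton] at h1
        exact Or.inl (by rw [h1])
      · refine Or.inr ⟨by rw [residualVector_of_not_forall hi, mul_zero, mul_zero], hscale ?_⟩
        have hij : a i j < 1 := lt_of_le_of_ne (ha1 i j) fun h1 => hi fun k hk => by
          rwa [Finset.mem_singleton.1 hk]
        have h1 : max 1 (y j) ^ a i j * M ≤ η * x :=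
          not_lt.1 fun h2 => hex (Or.inr (mem_iUnion.2 ⟨⟨(i, j), hij⟩, h2⟩))
        refine le_trans ?_ h1
        rw [productVector, prod_eq_mul_prod_compl _ j, mul_comm]
        exact mul_le_mul (Real.rpow_le_rpow (hy j) (le_max_right _ _) (ha0 i j))
          ((prod_rpow_le_prod_max_one hy (ha0 i) (ha1 i) _).trans hj)
          (Finset.prod_nonneg fun k _ => Real.rpow_nonneg (hy k) _) (by positivity)
    · intro k _ hkj
      have hk : ¬ ∏ l ∈ {k}ᶜ, max (y l) 1 ≤ M := fun hk => by
        have h1 := prod_le_mul_prod_compl hz1 hkj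
        have h2 := mul_le_mul hk hj (Finset.prod_nonneg fun l _ => by positivity) hM
        exact absurd hbig' (not_lt.2 (h1.trans (h2.trans hMx)))
      have h0 : truncatedResidual a M k y = 0 := if_neg hk
      refine hv _ fun i => ?_
      rw [h0]
      simp [hε.le]
  · rw [indicator_of_notMem (show y ∉ {y : Fin p → ℝ | ε * x < ∏ k, max (y k) 1} from hbig)]
    have hb := not_lt.1 hbig
    rw [hv _ fun i => ⟨hX0 i, hscale ((hX i).trans hb)⟩, Finset.sum_eq_zero fun j _ =>
      hv _ fun i => ⟨mul_nonneg (inv_nonneg.2 hx.le) (hT0 j i), hscale ((hT j i).trans hb)⟩]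
    simp

/-- Truncation leaves the residual unchanged or replaces it by zero, where φ vanishes, so the
untruncated integrand dominates; pointwise the truncation is eventually inactive. -/
lemma IsTest.tendsto_integral_truncatedResidual [IsProbabilityMeasure P]
    {φ : (Fin n → ℝ) → ℝ} (hφ : IsTest φ) (I : IIDSample P Y ρ) (hα : 0 < α) (j : Fin p)
    (hi : ∀ i, Integrable (fun ω => residualVector a {j} (fun k => Y k ω) i ^ α) P) :
    Tendsto (fun M : ℕ => ∫ q, φ (scaleVec (fun ω => truncatedResidual a M j fun k => Y k ω) q)
      ∂(P.prod (powerMeasure α))) atTop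
      (𝓝 (∫ q, φ (scaleVec (fun ω => residualVector a {j} fun k => Y k ω) q)
        ∂(P.prod (powerMeasure α)))) := by
  have hYm : Measurable fun ω => fun k => Y k ω := measurable_pi_lambda _ I.measurable
  have h0 : φ 0 = 0 := by
    obtain ⟨ε, hε, hv⟩ := hφ.vanish
    exact hv 0 fun i => ⟨le_rfl, hε.le⟩
  have hint := hφ.integrable hα ((measurable_residualVector a {j}).comp hYm)
    (fun ω i => residualVector_nonneg (fun k => I.nonneg k ω) _ i) hi
  refine tendsto_integral_of_dominated_convergence _ (fun M => ?_) hint.norm (fun M => ?_) ?_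
  · exact (hφ.continuous.measurable.comp (measurable_scaleVec
      ((measurable_truncatedResidual a M j).comp hYm))).aestronglyMeasurable
  · refine Eventually.of_forall fun q => ?_
    by_cases hq : ∏ k ∈ {j}ᶜ, max (Y k q.1) 1 ≤ M
    · have : truncatedResidual a M j (fun k => Y k q.1) = residualVector a {j} fun k => Y k q.1 :=
        if_pos hq
      have h1 : scaleVec (fun ω => truncatedResidual a M j fun k => Y k ω) q =
          scaleVec (residualVector a {j} ∘ fun ω k => Y k ω) q := by
        ext i
        simp only [scaleVec, Function.comp_apply, this]
      exact (congrArg (fun v => ‖φ v‖) h1).le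
    · have h1 : truncatedResidual a M j (fun k => Y k q.1) = 0 := if_neg hq
      have h2 : scaleVec (fun ω => truncatedResidual a M j fun k => Y k ω) q = 0 := by
        ext i; simp [scaleVec, h1]
      rw [h2, h0, norm_zero]
      exact norm_nonneg _
  · refine Eventually.of_forall fun q => tendsto_const_nhds.congr' ?_
    filter_upwards [eventually_ge_atTop ⌈∏ k ∈ {j}ᶜ, max (Y k q.1) 1⌉₊] with M hM
    have : truncatedResidual a M j (fun k => Y k q.1) = residualVector a {j} fun k => Y k q.1 :=
      if_pos (Nat.ceil_le.1 hM)
    have h1 : scaleVec (fun ω => truncatedResidual a M j fun k => Y k ω) q =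
        scaleVec (fun ω => residualVector a {j} fun k => Y k ω) q := by
      ext i
      simp only [scaleVec, this]
    rw [h1]

/-- An upper bound for the probability of `multipleLargeSet`. -/
noncomputable def multipleLargeBound (a : Fin n → Fin p → ℝ) (ρ : Measure ℝ) (M c : ℝ) : ℝ :=
  (tail (powLaw (ρ.map fun y => max y 1) p) c -
    p * prodTail ((powLaw (ρ.map fun y => max y 1) (p - 1)).restrict (Iic M))
      (ρ.map fun y => max y 1) c) +
  ∑ q : {q : Fin n × Fin p // a q.1 q.2 < 1},
    tail (ρ.map fun z => max 1 z ^ a q.1.1 q.1.2) (M⁻¹ * c)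

lemma IIDSample.measure_multipleLargeSet_le [IsProbabilityMeasure P] [IsProbabilityMeasure ρ]
    (I : IIDSample P Y ρ) {M c : ℝ} (hM : 0 < M) (hc : M * M ≤ c) :
    P.real {ω | (fun k => Y k ω) ∈ multipleLargeSet a M c} ≤ multipleLargeBound a ρ M c := by
  have hp : IsProbabilityMeasure (ρ.map fun y => max y 1) := isProbabilityMeasure_map_max_one
  have J := I.comp measurable_max_one fun y _ => zero_le_one.trans (le_max_right y 1)
  have h1 := J.measure_prod_and_forall_le (fun j ω => le_max_right _ _) hc
  have h2 : ∀ q : {q : Fin n × Fin p // a q.1 q.2 < 1},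
      P.real {ω | c < max 1 (Y q.1.2 ω) ^ a q.1.1 q.1.2 * M} =
        tail (ρ.map fun z => max 1 z ^ a q.1.1 q.1.2) (M⁻¹ * c) := by
    intro q
    have hm : Measurable fun z : ℝ => max 1 z ^ a q.1.1 q.1.2 :=
      (measurable_const.max measurable_id).pow_const _
    rw [tail, ← I.law q.1.2, Measure.map_map hm (I.measurable _),
      map_measureReal_apply (hm.comp (I.measurable _)) measurableSet_Ioi]
    refine congrArg P.real (Set.ext fun ω => ?_)
    simp only [mem_ofPred_eq, mem_preimage, mem_Ioi, Function.comp_apply]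
    rw [inv_mul_lt_iff₀ hM, mul_comm]
  have hset : {ω | (fun k => Y k ω) ∈ multipleLargeSet a M c} =
      {ω | c < ∏ k, max (Y k ω) 1 ∧ ∀ j, M < ∏ k ∈ {j}ᶜ, max (Y k ω) 1} ∪
      ⋃ q : {q : Fin n × Fin p // a q.1 q.2 < 1},
        {ω | c < max 1 (Y q.1.2 ω) ^ a q.1.1 q.1.2 * M} := by
    ext ω
    simp [multipleLargeSet]
  rw [hset, multipleLargeBound, ← Finset.sum_congr rfl fun q _ => h2 q]
  exact (measureReal_union_le _ _).trans (add_le_add h1 (measureReal_iUnion_fintype_le _))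

lemma tendsto_div_tail_of_map_max_one [IsProbabilityMeasure ρ] {g : ℝ → ℝ} {l : ℝ}
    (hg : Tendsto (fun x => g x / tail (ρ.map fun y => max y 1) x) atTop (𝓝 l)) :
    Tendsto (fun x => g x / tail ρ x) atTop (𝓝 l) := by
  refine hg.congr' ?_
  filter_upwards [eventually_ge_atTop 1] with x hx
  rw [tail_map_max_one hx]

/-- For fixed M the terms with exponents below one vanish as x → ∞. The defect of the single factor
approximation remains and vanishes only as M → ∞; its limit is `r M` times a power of η, with `r`
independent of η. -/
lemma RVTail.tendsto_multipleLargeBound [IsProbabilityMeasure ρ] (h : RVTail ρ α)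
    (hρ : ∀ᵐ z ∂ρ, 0 ≤ z) {c : ℝ}
    (hc : Tendsto (fun x => prodTail ρ ρ x / tail ρ x) atTop (𝓝 c)) (ha0 : ∀ i j, 0 ≤ a i j) :
    ∃ r : ℕ → ℝ, Tendsto r atTop (𝓝 0) ∧ ∀ (M : ℕ) {η : ℝ}, 0 < M → 0 < η →
      Tendsto (fun x => multipleLargeBound a ρ M (η * x) / tail ρ x) atTop
        (𝓝 (r M * η ^ (-α))) := by
  have hp : IsProbabilityMeasure (ρ.map fun y => max y 1) := isProbabilityMeasure_map_max_one
  obtain ⟨c', hc'⟩ := h.tendsto_prodTail_map_max_one hρ hc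
  obtain ⟨r, hr, hrM⟩ := tendsto_tail_powLaw_sub h.map_max_one ae_map_max_one hc' p
  refine ⟨r, hr, fun M η hM hη => ?_⟩
  have hM' : (0 : ℝ) < (M : ℝ)⁻¹ := inv_pos.2 (Nat.cast_pos.2 hM)
  have h1 := tendsto_finsetSum
    (Finset.univ : Finset {q : Fin n × Fin p // a q.1 q.2 < 1}) fun q _ =>
      h.tendsto_scale (h.tendsto_tail_rpow (ha0 q.1.1 q.1.2) q.2) (mul_pos hM' hη)
  have h2 := (tendsto_div_tail_of_map_max_one (hrM M hη)).add h1
  simp only [zero_mul, Finset.sum_const_zero, add_zero] at h2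
  refine h2.congr fun x => ?_
  rw [multipleLargeBound, add_div, Finset.sum_div]
  simp only [mul_assoc]

/-- The limit of the product vector for a convolution equivalent distribution. -/
theorem IIDSample.vectorLimit_of_prodTail [IsProbabilityMeasure P] [IsProbabilityMeasure ρ]
    [NeZero p] (I : IIDSample P Y ρ) (h : RVTail ρ α) {c : ℝ}
    (hc : Tendsto (fun x => prodTail ρ ρ x / tail ρ x) atTop (𝓝 c))
    (ha0 : ∀ i j, 0 ≤ a i j) (ha1 : ∀ i j, a i j ≤ 1) (hcol : ∀ j, ∃ i, a i j = 1) :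
    VectorLimit P (fun ω => productVector a fun j => Y j ω) α (tail ρ)
      (Finset.univ : Finset (Fin p)) (fun j ω => residualVector a {j} fun k => Y k ω) := by
  have hα := h.index_pos
  have hρ : ∀ᵐ z ∂ρ, 0 ≤ z := I.ae_nonneg 0
  have hp : IsProbabilityMeasure (ρ.map fun y => max y 1) := isProbabilityMeasure_map_max_one
  have J := I.comp measurable_max_one fun y _ => zero_le_one.trans (le_max_right y 1)
  have hZ0 : ∀ᵐ z ∂(ρ.map fun y => max y 1), 0 ≤ z := J.ae_nonneg 0
  obtain ⟨c', hc'⟩ := h.tendsto_prodTail_map_max_one hρ hc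
  have hYm : Measurable fun ω => fun j => Y j ω := measurable_pi_lambda _ I.measurable
  have hWm : ∀ j : Fin p, Measurable fun ω => residualVector a {j} fun k => Y k ω :=
    fun j => (measurable_residualVector a {j}).comp hYm
  have hW0 : ∀ (j : Fin p) ω i, 0 ≤ residualVector a {j} (fun k => Y k ω) i :=
    fun j ω i => residualVector_nonneg (fun k => I.nonneg k ω) _ i
  have hWi : ∀ (j : Fin p) i,
      Integrable (fun ω => residualVector a {j} (fun k => Y k ω) i ^ α) P := by
    intro j i
    -- Only the moment of order exactly α is supplied here, none beyond it, which is why Breiman's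
    -- lemma is applied below to truncated residuals.
    have h1 := integrable_powLaw_rpow hZ0
      (h.map_max_one.integrable_rpow_of_prodTail hZ0 hc') ({j}ᶜ : Finset (Fin p)).card
    rw [← J.map_prod] at h1
    have h2 := (integrable_map_measure (by fun_prop)
      (J.measurable_prod ({j}ᶜ : Finset (Fin p))).aemeasurable).1 h1
    refine h2.mono' (((measurable_pi_apply i).comp (hWm j)).pow_const
      α).aestronglyMeasurable (Eventually.of_forall fun ω => ?_)
    rw [Real.norm_of_nonneg (Real.rpow_nonneg (hW0 j ω i) _)]
    exact Real.rpow_le_rpow (hW0 j ω i)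
      (residualVector_le (fun k => I.nonneg k ω) ha0 ha1 _ i) hα.le
  refine ⟨hα, I.measurable_productVector,
    hWm, hW0, hWi,
    Eventually.of_forall h.tail_pos, fun φ hφ => ?_, ?_⟩
  · obtain ⟨K, hK⟩ := hφ.bounded
    obtain ⟨ε, hε, hv⟩ := hφ.vanish
    obtain ⟨r, hr, hrM⟩ := h.tendsto_multipleLargeBound (a := a) hρ hc ha0
    -- η is fixed first by the modulus, then M is chosen so large that r M η^(-α) is small. The
    -- condition k ≤ M removes the truncation in the limit.
    have hpar : ∀ k : ℕ, ∃ η > 0, ∃ M : ℕ, k ≤ M ∧ 0 < M ∧ |r M * η ^ (-α)| ≤ 1 / ((k : ℝ) + 1) ∧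
        η ≤ ε ∧ ∀ u v : Fin n → ℝ,
        (∀ i, 0 ≤ v i ∧ (u i = v i ∨ (u i = 0 ∧ v i ≤ η))) →
          |φ u - φ v| ≤ 1 / ((k : ℝ) + 1) := by
      intro k
      have hk : (0 : ℝ) < 1 / ((k : ℝ) + 1) := by positivity
      obtain ⟨η, hη0, hη⟩ := hφ.modulus (1 / ((k : ℝ) + 1)) hk
      have h1 : Tendsto (fun M => |r M * min η ε ^ (-α)|) atTop (𝓝 0) := by
        have := (hr.mul_const (min η ε ^ (-α))).abs
        rwa [zero_mul, abs_zero] at this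
      obtain ⟨M, hM1, hM2, hM3⟩ := ((h1.eventually (ge_mem_nhds hk)).and
        ((eventually_ge_atTop k).and (eventually_gt_atTop 0))).exists
      exact ⟨min η ε, lt_min hη0 hε, M, hM2, hM3, hM1, min_le_right _ _,
        fun u v huv => hη u v fun i =>
        ⟨(huv i).1, (huv i).2.imp_right fun h2 => ⟨h2.1, h2.2.trans (min_le_left _ _)⟩⟩⟩
    choose η hη0 M hkM hM0 hrη hηε hmod using hpar
    have hMtop : Tendsto M atTop atTop := tendsto_atTop_mono hkM tendsto_id
    have hTm : ∀ k (j : Fin p), Measurable fun ω => truncatedResidual a (M k) j fun l => Y l ω :=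
      fun k j => (measurable_truncatedResidual a _ j).comp hYm
    have hbr : ∀ k (j : Fin p), Tendsto (fun x =>
        (∫ ω, φ (fun i => x⁻¹ * (Y j ω * truncatedResidual a (M k) j (fun l => Y l ω) i)) ∂P) /
          tail ρ x) atTop
        (𝓝 (∫ q, φ (scaleVec (fun ω => truncatedResidual a (M k) j fun l => Y l ω) q)
          ∂(P.prod (powerMeasure α)))) := by
      intro k j
      have h0 : ∀ ω i, 0 ≤ truncatedResidual a (M k) j (fun l => Y l ω) i :=
        fun ω i => truncatedResidual_nonneg (fun l => I.nonneg l ω) _ j i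
      have := hφ.breiman (I.measurable j) (hTm k j) (I.nonneg j) h0
        (I.indepFun_truncatedResidual (M k) j) ((I.law j).symm ▸ h) (lt_add_one α) fun i => ?_
      · rwa [I.law j] at this
      · refine Integrable.of_bound ((measurable_const.max
          ((measurable_pi_apply i).comp (hTm k j))).pow_const _).aestronglyMeasurable
          (max 1 (M k : ℝ) ^ (α + 1)) (Eventually.of_forall fun ω => ?_)
        rw [Real.norm_of_nonneg (by positivity)]
        exact Real.rpow_le_rpow (by positivity) (max_le_max_left _
          (truncatedResidual_le (fun l => I.nonneg l ω) ha0 ha1 (Nat.cast_nonneg _) j i))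
          (by linarith)
    have hB₀ := h.map_max_one.tendsto_scale
      (h.map_max_one.tendsto_tail_powLaw ae_map_max_one hc' p) hε
    replace hB₀ := tendsto_div_tail_of_map_max_one hB₀
    set l := (p * (∫ z, z ^ α ∂(ρ.map fun y => max y 1)) ^ (p - 1)) * ε ^ (-α) with hl
    refine tendsto_of_approx
      (A := fun k x => ∑ j, (∫ ω, φ (fun i => x⁻¹ * (Y j ω *
        truncatedResidual a (M k) j (fun l => Y l ω) i)) ∂P) / tail ρ x)
      (E := fun k x => 1 / ((k : ℝ) + 1) *
          (tail (powLaw (ρ.map fun y => max y 1) p) (ε * x) / tail ρ x) +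
        (1 + p) * K * (multipleLargeBound a ρ (M k) (η k * x) / tail ρ x))
      (e := fun k => 1 / ((k : ℝ) + 1) * l + (1 + p) * K * (r (M k) * η k ^ (-α)))
      (fun k => tendsto_finsetSum _ fun j _ => hbr k j)
      (tendsto_finsetSum _ fun j _ =>
        (hφ.tendsto_integral_truncatedResidual I hα j (hWi j)).comp hMtop)
      (fun k => (hB₀.const_mul _).add ((hrM (M k) (hM0 k) (hη0 k)).const_mul _)) ?_ ?_
    · have h1 := tendsto_one_div_add_atTop_nhds_zero_nat (𝕜 := ℝ)
      have h2 : Tendsto (fun k => r (M k) * η k ^ (-α)) atTop (𝓝 0) :=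
        squeeze_zero_norm (fun k => hrη k) h1
      have := (h1.mul_const l).add (h2.const_mul ((1 + (p : ℝ)) * K))
      simpa using this
    · intro k
      filter_upwards [eventually_gt_atTop 0,
        eventually_ge_atTop ((η k)⁻¹ * ((M k : ℝ) * M k))] with x hx hxM
      rw [inv_mul_le_iff₀ (hη0 k)] at hxM
      have hHx := h.tail_pos x
      have hB₀m : MeasurableSet {y : Fin p → ℝ | ε * x < ∏ l, max (y l) 1} :=
        measurableSet_lt measurable_const (measurable_prod_max_one _)
      have h1 := abs_integral_le_of_indicator (P := P)
        (f := fun ω => φ (fun i => x⁻¹ * productVector a (fun j => Y j ω) i) -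
          ∑ j, φ (fun i => x⁻¹ * (Y j ω * truncatedResidual a (M k) j (fun l => Y l ω) i)))
        (hYm hB₀m) (hYm (measurableSet_multipleLargeSet (a := a) (M k) (η k * x)))
        fun ω => abs_test_sub_sum_truncatedResidual_le hK hv (hmod k) (by positivity) hε
          (hηε k) hx (Nat.cast_nonneg _) hxM ha0 ha1 fun j => I.nonneg j ω
      have hTi : ∀ j, Integrable (fun ω =>
          φ (fun i => x⁻¹ * (Y j ω * truncatedResidual a (M k) j (fun l => Y l ω) i))) P :=
        fun j => hφ.integrable_comp (X := fun ω i => Y j ω *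
          truncatedResidual a (M k) j (fun l => Y l ω) i) (measurable_pi_lambda _ fun i =>
            (I.measurable j).mul ((measurable_pi_apply i).comp (hTm k j))) x
      rw [integral_sub (hφ.integrable_comp I.measurable_productVector x)
        (integrable_finsetSum _ fun j _ => hTi j), integral_finsetSum _ fun j _ => hTi j] at h1
      have h2 : P.real ((fun ω j => Y j ω) ⁻¹' {y | ε * x < ∏ l, max (y l) 1}) =
          tail (powLaw (ρ.map fun y => max y 1) p) (ε * x) := by
        have h3 := J.map_prod Finset.univ
        rw [Finset.card_univ, Fintype.card_fin] at h3
        rw [← h3, tail, map_measureReal_apply (J.measurable_prod _) measurableSet_Ioi]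
        rfl
      have h4 := I.measure_multipleLargeSet_le (a := a) (Nat.cast_pos.2 (hM0 k)) hxM
      have hK0 : 0 ≤ K := (abs_nonneg _).trans (hK 0)
      rw [← Finset.sum_div, ← sub_div, abs_div, abs_of_pos hHx, div_le_iff₀ hHx, add_mul,
        mul_assoc _ _ (tail ρ x), div_mul_cancel₀ _ hHx.ne', mul_assoc _ _ (tail ρ x),
        div_mul_cancel₀ _ hHx.ne', ← h2]
      refine h1.trans (add_le_add_right ?_ _)
      exact mul_le_mul_of_nonneg_left h4 (by positivity)
  · obtain ⟨i, hi⟩ := hcol 0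
    exact ⟨0, Finset.mem_univ _, I.measure_residualVector_ne_zero h (i := i) fun j hj => by
      rwa [Finset.mem_singleton.1 hj]⟩

end ConvolutionEquivalentLimit

/-! ### Reduction to exponents at most one by a power transform -/

section PowerTransform

variable {Ω : Type*} [MeasurableSpace Ω] {P : Measure Ω} {n p : ℕ} {α s : ℝ} {ρ : Measure ℝ}
  {Y : Fin p → Ω → ℝ} {a : Fin n → Fin p → ℝ}

lemma RegularlyVaryingTail.rvTail {X : Ω → ℝ} [IsProbabilityMeasure P] (hX : Measurable X)
    (h : RegularlyVaryingTail P X α) : RVTail (P.map X) α := by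
  obtain ⟨hα, L, hL, hXL⟩ := h
  have hp : IsProbabilityMeasure (P.map X) := Measure.isProbabilityMeasure_map hX.aemeasurable
  have ht : ∀ x, 0 < x → tail (P.map X) x = x ^ (-α) * L x := fun x hx => by
    rw [← hXL x hx, tail, map_measureReal_apply hX measurableSet_Ioi]
    rfl
  refine ⟨hα, fun x => ?_, fun l hl => ?_⟩
  -- The slowly varying factor is only eventually positive; monotonicity carries positivity of the
  -- tail back to every x.
  · obtain ⟨y, hy, hxy, hy0⟩ := (hL.eventually_pos.and
      ((eventually_ge_atTop x).and (eventually_gt_atTop 0))).exists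
    refine lt_of_lt_of_le ?_ (tail_antitone _ hxy)
    rw [ht y hy0]
    positivity
  · have h1 := (hL.tendsto_ratio l hl).const_mul (l ^ (-α))
    rw [mul_one] at h1
    refine h1.congr' ?_
    filter_upwards [eventually_gt_atTop 0] with x hx
    rw [ht x hx, ht _ (mul_pos hl hx), Real.mul_rpow hl.le hx.le]
    have : x ^ (-α) ≠ 0 := (Real.rpow_pos_of_pos hx _).ne'
    field_simp

lemma measurable_abs_rpow (s : ℝ) : Measurable fun y : ℝ => |y| ^ s :=
  measurable_norm.pow_const s

lemma lt_abs_rpow_iff (hs : 0 < s) {x y : ℝ} (hx : 0 ≤ x) (hy : 0 ≤ y) :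
    x < |y| ^ s ↔ x ^ s⁻¹ < y := by
  rw [abs_of_nonneg hy, Real.rpow_inv_lt_iff_of_pos hx hy hs]

lemma tail_map_abs_rpow (hρ : ∀ᵐ y ∂ρ, 0 ≤ y) (hs : 0 < s) {x : ℝ} (hx : 0 ≤ x) :
    tail (ρ.map fun y => |y| ^ s) x = tail ρ (x ^ s⁻¹) := by
  rw [tail, map_measureReal_apply (measurable_abs_rpow s) measurableSet_Ioi]
  refine measureReal_congr ?_
  filter_upwards [hρ] with y hy
  exact propext (lt_abs_rpow_iff hs hx hy)

lemma prodTail_map_abs_rpow [IsProbabilityMeasure ρ] (hρ : ∀ᵐ y ∂ρ, 0 ≤ y) (hs : 0 < s) {x : ℝ}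
    (hx : 0 ≤ x) :
    prodTail (ρ.map fun y => |y| ^ s) (ρ.map fun y => |y| ^ s) x = prodTail ρ ρ (x ^ s⁻¹) := by
  have hm := measurable_abs_rpow s
  rw [prodTail, Measure.map_prod_map ρ ρ hm hm,
    map_measureReal_apply (hm.prodMap hm) (measurableSet_lt_mul x)]
  refine measureReal_congr ?_
  filter_upwards [ae_prod_nonneg hρ hρ] with q hq
  refine propext ?_
  change x < |q.1| ^ s * |q.2| ^ s ↔ x ^ s⁻¹ < q.1 * q.2
  rw [← lt_abs_rpow_iff hs hx (mul_nonneg hq.1 hq.2), abs_mul,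
    Real.mul_rpow (abs_nonneg _) (abs_nonneg _)]

lemma RVTail.map_abs_rpow [IsProbabilityMeasure ρ] (h : RVTail ρ α) (hρ : ∀ᵐ y ∂ρ, 0 ≤ y)
    (hs : 0 < s) : RVTail (ρ.map fun y => |y| ^ s) (α / s) := by
  have hp : IsProbabilityMeasure (ρ.map fun y => |y| ^ s) :=
    Measure.isProbabilityMeasure_map (measurable_abs_rpow s).aemeasurable
  refine ⟨div_pos h.index_pos hs, fun x => ?_, fun l hl => ?_⟩
  · refine lt_of_lt_of_le ?_ (tail_antitone _ (le_max_left x 0))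
    rw [tail_map_abs_rpow hρ hs (le_max_right x 0)]
    exact h.tail_pos _
  · have h1 := (h.tendsto_ratio (l ^ s⁻¹) (by positivity)).comp
      (tendsto_rpow_atTop (inv_pos.2 hs))
    rw [← Real.rpow_mul hl.le, show s⁻¹ * -α = -(α / s) by ring] at h1
    refine h1.congr' ?_
    filter_upwards [eventually_gt_atTop 0] with x hx
    rw [tail_map_abs_rpow hρ hs hx.le, tail_map_abs_rpow hρ hs (by positivity),
      Real.mul_rpow hl.le hx.le]
    rfl

lemma ProductTailEquivalent.tendsto_map_abs_rpow [IsProbabilityMeasure ρ]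
    (h : ProductTailEquivalent ρ) (hρ : ∀ᵐ y ∂ρ, 0 ≤ y) (hs : 0 < s) :
    ∃ c, Tendsto (fun x => prodTail (ρ.map fun y => |y| ^ s) (ρ.map fun y => |y| ^ s) x /
      tail (ρ.map fun y => |y| ^ s) x) atTop (𝓝 c) := by
  obtain ⟨c, -, hc⟩ := h
  refine ⟨c, (hc.comp (tendsto_rpow_atTop (inv_pos.2 hs))).congr' ?_⟩
  filter_upwards [eventually_ge_atTop 0] with x hx
  rw [prodTail_map_abs_rpow hρ hs hx, tail_map_abs_rpow hρ hs hx]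
  rfl

lemma not_integrable_map_abs_rpow {X : Ω → ℝ} (hX : Measurable X) (hX0 : ∀ᵐ ω ∂P, 0 ≤ X ω)
    (hs : 0 < s) (h : ∫⁻ ω, ENNReal.ofReal (X ω ^ α) ∂P = ∞) :
    ¬ Integrable (fun z => z ^ (α / s)) ((P.map X).map fun y => |y| ^ s) := by
  intro hi
  rw [Measure.map_map (measurable_abs_rpow s) hX] at hi
  have h1 := (integrable_map_measure (by fun_prop)
    ((measurable_abs_rpow s).comp hX).aemeasurable).1 hi
  have h2 := h1.lintegral_lt_top
  refine h2.ne ?_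
  rw [← h]
  refine lintegral_congr_ae ?_
  filter_upwards [hX0] with ω hω
  simp only [Function.comp_apply]
  rw [abs_of_nonneg hω, ← Real.rpow_mul hω, mul_div_cancel₀ _ hs.ne']

lemma RegularlyVaryingVector.congr_ae {X X' : Ω → Fin n → ℝ} {N : Seminorm ℝ (Fin n → ℝ)}
    {μ : Measure (PuncturedSpace n)} (h : RegularlyVaryingVector P X α N μ) (he : X =ᵐ[P] X') :
    RegularlyVaryingVector P X' α N μ := by
  have h1 : ∀ x, P {ω | x < N (X ω)} = P {ω | x < N (X' ω)} := fun x => by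
    refine measure_congr ?_
    filter_upwards [he] with ω hω
    exact congrArg (fun v => x < N v) hω
  have h2 : ∀ x, scaledLaw P X x = scaledLaw P X' x := fun x => by
    unfold scaledLaw
    rw [Measure.map_congr]
    filter_upwards [he] with ω hω
    rw [hω]
  refine ⟨h.index_pos, h.ne_zero, h.radon, h.homogeneous, ?_⟩
  have h3 := h.vague
  simp only [h1, h2] at h3
  exact h3

lemma productVector_abs_rpow (hs : 0 < s) {y : Fin p → ℝ} (hy : ∀ j, 0 ≤ y j) :
    productVector (fun i j => a i j / s) (fun j => |y j| ^ s) = productVector a y := by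
  ext i
  refine Finset.prod_congr rfl fun j _ => ?_
  simp only
  rw [abs_of_nonneg (hy j), ← Real.rpow_mul (hy j), mul_div_cancel₀ _ hs.ne']

lemma limitVector_eq_residualVector (hs : 0 < s) (A : Finset (Fin p)) {y : Fin p → ℝ}
    (hy : ∀ j, 0 ≤ y j) (z : ℝ) (i : Fin n) :
    limitVector a s A y z i =
      z ^ s * residualVector (fun i j => a i j / s) A (fun j => |y j| ^ s) i := by
  unfold limitVector residualVector
  simp only [div_eq_one_iff_eq hs.ne']
  split_ifs
  · congr 1
    refine Finset.prod_congr rfl fun k _ => ?_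
    rw [abs_of_nonneg (hy k), ← Real.rpow_mul (hy k), mul_div_cancel₀ _ hs.ne']
  · rw [mul_zero]

lemma pEff_div (hs : 0 < s) : pEff (fun i j => a i j / s) 1 = pEff a s := by
  simp only [pEff, div_eq_one_iff_eq hs.ne']

lemma PEff_div (hs : 0 < s) : PEff (fun i j => a i j / s) 1 = PEff a s := by
  simp only [PEff, pEff_div hs, div_eq_one_iff_eq hs.ne']

/-- The substitution z ↦ z^s turns the tail c^(-α) into c^(-α/s); the absolute value is harmless
because the measure lives on (0, ∞). -/
lemma map_powerMeasure (hα : 0 < α) (hs : 0 < s) :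
    (powerMeasure α).map (fun z => |z| ^ s) = powerMeasure (α / s) := by
  refine eq_powerMeasure (div_pos hα hs) ?_ fun c hc => ?_
  · rw [Measure.map_apply (measurable_abs_rpow s) measurableSet_Iic, measure_eq_zero_iff_ae_notMem]
    filter_upwards [ae_powerMeasure_pos α] with z hz
    simpa using Real.rpow_pos_of_pos (abs_pos.2 hz.ne') s
  · rw [Measure.map_apply (measurable_abs_rpow s) measurableSet_Ioi]
    have h1 : powerMeasure α ((fun z => |z| ^ s) ⁻¹' Ioi c) = powerMeasure α (Ioi (c ^ s⁻¹)) := by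
      refine measure_congr ?_
      filter_upwards [ae_powerMeasure_pos α] with z hz
      exact propext (lt_abs_rpow_iff hs hc.le hz.le)
    rw [h1, powerMeasure_Ioi hα (by positivity), ← Real.rpow_mul hc.le]
    congr 2
    ring

lemma limitMass_eq [IsProbabilityMeasure P] (hα : 0 < α) (hs : 0 < s)
    (hY : ∀ j, Measurable (Y j)) (hY0 : ∀ j, ∀ᵐ ω ∂P, 0 ≤ Y j ω) (A : Finset (Fin p))
    {B : Set (Fin n → EReal)} (hB : MeasurableSet B) :
    limitMass P Y a s α A B = ∫⁻ z, P {ω | (fun i => ((z * residualVector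
      (fun i j => a i j / s) A (fun j => |Y j ω| ^ s) i : ℝ) : EReal)) ∈ B}
      ∂powerMeasure (α / s) := by
  have hW : Measurable fun ω => residualVector (fun i j => a i j / s) A fun j => |Y j ω| ^ s :=
    (measurable_residualVector _ A).comp
      (measurable_pi_lambda _ fun j => (measurable_abs_rpow s).comp (hY j))
  have hm : Measurable fun q : ℝ × Ω => (fun i => ((q.1 * residualVector
      (fun i j => a i j / s) A (fun j => |Y j q.2| ^ s) i : ℝ) : EReal)) :=
    measurable_pi_lambda _ fun i => (measurable_fst.mul
      ((measurable_pi_apply i).comp (hW.comp measurable_snd))).coe_real_ereal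
  have hF : Measurable fun z => P {ω | (fun i => ((z * residualVector
      (fun i j => a i j / s) A (fun j => |Y j ω| ^ s) i : ℝ) : EReal)) ∈ B} :=
    measurable_measure_prodMk_left (hm hB)
  rw [← map_powerMeasure hα hs, lintegral_map hF (measurable_abs_rpow s)]
  refine lintegral_congr_ae ?_
  filter_upwards [ae_powerMeasure_pos α] with z hz
  refine measure_congr ?_
  filter_upwards [ae_all_iff.2 hY0] with ω hω
  refine propext (iff_of_eq (congrArg (· ∈ B) (funext fun i => ?_)))
  rw [limitVector_eq_residualVector hs A hω z i, abs_of_pos hz]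

end PowerTransform

/-! ### Conclusion of both parts -/

theorem propositionB3 {Ω : Type*} [MeasurableSpace Ω] (P : Measure Ω) [IsProbabilityMeasure P]
    (n p : ℕ) [NeZero n] [NeZero p] (Y : Fin p → Ω → ℝ) (α : ℝ)
    (hYmeas : ∀ j, Measurable (Y j))
    (hYnonneg : ∀ j, ∀ᵐ ω ∂P, 0 ≤ Y j ω)
    (hYindep : iIndepFun Y P)
    (hYident : ∀ j, IdentDistrib (Y j) (Y 0) P P)
    (hYreg : RegularlyVaryingTail P (Y 0) α)
    (a : Fin n → Fin p → ℝ) (ha : ∀ i j, 0 ≤ a i j)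
    (amax : ℝ) (hamax : IsGreatest (Set.range fun q : Fin n × Fin p => a q.1 q.2) amax)
    (hamax_pos : 0 < amax)
    (hcol : ∀ k, IsGreatest (Set.range fun i => a i k) amax)
    (N : Seminorm ℝ (Fin n → ℝ)) (hN : ∀ v, N v = 0 → v = 0) :
    (ProductTailEquivalent (P.map (Y 0)) →
      ∃ μ : Measure (PuncturedSpace n),
        RegularlyVaryingVector P (fun ω => productVector a (fun j => Y j ω)) (α / amax) N μ ∧
        ∃ c : ℝ≥0, 0 < c ∧ ∀ B : Set (Fin n → EReal), MeasurableSet B → 0 ∉ closure B →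
          μ (Subtype.val ⁻¹' B) = c * ∑ j : Fin p, limitMass P Y a amax α {j} B) ∧
    (∫⁻ ω, ENNReal.ofReal (Y 0 ω ^ α) ∂P = ∞ →
      ∃ μ : Measure (PuncturedSpace n),
        RegularlyVaryingVector P (fun ω => productVector a (fun j => Y j ω)) (α / amax) N μ ∧
        ∃ c : ℝ≥0, 0 < c ∧ ∀ B : Set (Fin n → EReal), MeasurableSet B → 0 ∉ closure B →
          μ (Subtype.val ⁻¹' B) = c * ∑ A ∈ PEff a amax, limitMass P Y a amax α A B) := by
  have hα : 0 < α := hYreg.1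
  have : IsProbabilityMeasure (P.map (Y 0)) :=
    Measure.isProbabilityMeasure_map (hYmeas 0).aemeasurable
  -- The absolute value makes the transformed variables nonnegative everywhere, the original ones
  -- being so only almost surely.
  set ρ := (P.map (Y 0)).map fun y => |y| ^ amax with hρdef
  have : IsProbabilityMeasure ρ :=
    Measure.isProbabilityMeasure_map (measurable_abs_rpow amax).aemeasurable
  have hρ0 : ∀ᵐ y ∂(P.map (Y 0)), 0 ≤ y :=
    (ae_map_iff (hYmeas 0).aemeasurable measurableSet_Ici).2 (hYnonneg 0)
  have hRV : RVTail ρ (α / amax) := (hYreg.rvTail (hYmeas 0)).map_abs_rpow hρ0 hamax_pos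
  have hI : IIDSample P (fun j ω => |Y j ω| ^ amax) ρ :=
    { measurable := fun j => (measurable_abs_rpow amax).comp (hYmeas j)
      nonneg := fun j ω => by positivity
      indep := hYindep.comp (fun _ y => |y| ^ amax) fun _ => measurable_abs_rpow amax
      law := fun j => by
        rw [hρdef, ← (hYident j).map_eq, Measure.map_map (measurable_abs_rpow amax) (hYmeas j)]
        rfl }
  have ha0 : ∀ i j, 0 ≤ a i j / amax := fun i j => div_nonneg (ha i j) hamax_pos.le
  have ha1 : ∀ i j, a i j / amax ≤ 1 := fun i j =>
    (div_le_one hamax_pos).2 (hamax.2 ⟨(i, j), rfl⟩)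
  have hX : (fun ω => productVector (fun i j => a i j / amax) fun j => |Y j ω| ^ amax) =ᵐ[P]
      fun ω => productVector a fun j => Y j ω := by
    filter_upwards [ae_all_iff.2 hYnonneg] with ω hω
    exact productVector_abs_rpow hamax_pos hω
  constructor
  · intro hprod
    obtain ⟨c, hc⟩ := hprod.tendsto_map_abs_rpow hρ0 hamax_pos
    obtain ⟨μ, hμ, c, hc0, hB⟩ := (hI.vectorLimit_of_prodTail hRV hc ha0 ha1 fun j => by
      obtain ⟨i, hi⟩ := (hcol j).1
      exact ⟨i, (div_eq_one_iff_eq hamax_pos.ne').2 hi⟩).regularlyVarying N hN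
    refine ⟨μ, hμ.congr_ae hX, c, hc0, fun B hBm hB0 => ?_⟩
    rw [hB B hBm hB0]
    simp only [limitMass_eq hα hamax_pos hYmeas hYnonneg _ hBm]
  · intro hinf
    have hmax : ∃ i j, a i j / amax = 1 := by
      obtain ⟨⟨i, j⟩, hij⟩ := hamax.1
      exact ⟨i, j, (div_eq_one_iff_eq hamax_pos.ne').2 hij⟩
    obtain ⟨μ, hμ, c, hc0, hB⟩ := (hI.vectorLimit_of_not_integrable hRV (hI.ae_nonneg 0)
      (not_integrable_map_abs_rpow (hYmeas 0) (hYnonneg 0) hamax_pos hinf) ha0 ha1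
      hmax).regularlyVarying N hN
    refine ⟨μ, hμ.congr_ae hX, c, hc0, fun B hBm hB0 => ?_⟩
    rw [hB B hBm hB0, ← PEff_div hamax_pos, ← Finset.sum_coe_sort (PEff (fun i j => a i j / amax) 1)]
    simp only [limitMass_eq hα hamax_pos hYmeas hYnonneg _ hBm]
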